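/- **Setting.** Let $\mathsf X,\mathsf Y,\mathsf U$ be measurable spaces, $\lambda_{\mathsf X},\lambda_{\mathsf Y}$ finite measures on $\mathsf X,\mathsf Y$, $\nu$ a probability measure on $\mathsf U$, and $\Theta\subseteq\mathbb R^p$ an open set. Let $m_0$ be a probability density on $\mathsf X$ w.r.t. $\lambda_{\mathsf X}$. For $\theta\in\Theta$ let $m_\theta(x,x')$ and $r_\theta(x,y,x')$ be Markov transition densities w.r.t. $\lambda_{\mathsf X}(dx')$ (state transition and proposal), let $g_\theta(x,y)$ be a Markov transition density w.r.t. $\lambda_{\mathsf Y}(dy)$ (emission), and let $h_\theta:\mathsf X\times\mathsf Y\times\mathsf U\to\mathsf X$ be a measurable map such that, for all $(x,y)$, the image of $\nu$ under $h_\theta(x,y,\cdot)$ is $r_\theta(x,y,x')\,\lambda_{\mathsf X}(dx')$. The data $(X_t,Y_t)_{t\ge0}$, defined on a probability space $(\Omega,\mathcal F,\mathbb P)$, form a state-space model with initial density $m_0$, some state transition density $m(x,x')$ w.r.t. $\lambda_{\mathsf X}$ and some emission density $g(x,y)$ w.r.t. $\lambda_{\mathsf Y}$ (not necessarily in the parametric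 family): for every $T$, $(X_{0:T},Y_{0:T})$ has density $m_0(x_0)g(x_0,y_0)\prod_{t=1}^T m(x_{t-1},x_t)g(x_t,y_t)$ w.r.t. the product reference measure. For a sequence $y_0,y_1,\dots$ in $\mathsf Y$, let $\phi_{\theta,t}$ be the filter density at time $t$, i.e. the density w.r.t. $\lambda_{\mathsf X}$ given by $$\phi_{\theta,t}(x_t)=\frac{\int m_0(x_0)g_\theta(x_0,y_0)\prod_{s=1}^t m_\theta(x_{s-1},x_s)g_\theta(x_s,y_s)\,\lambda_{\mathsf X}^{\otimes t}(dx_{0:t-1})}{\int m_0(x_0)g_\theta(x_0,y_0)\prod_{s=1}^t m_\theta(x_{s-1},x_s)g_\theta(x_s,y_s)\,\lambda_{\mathsf X}^{\otimes(t+1)}(dx_{0:t})},$$ and let $\tau_{\theta,t}(x)=\nabla_\theta\phi_{\theta,t}(x)$ be the tangent filter density. Put $w_\theta(x,y,u)=\dfrac{m_\theta(x,h_\theta(x,y,u))\,g_\theta(h_\theta(x,y,u),y)}{r_\theta(x,y,h_\theta(x,y,u))}$. For a density $\phi$ on $\mathsf X$, an integrable $\tau:\mathsf X\to\mathbb R^p$,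 $y\in\mathsf Y$ and an integer $M\ge1$ define, writing $dx$ for $\lambda_{\mathsf X}(dx)$: * $\displaystyle L_\theta(y,\phi)=\log\iint g_\theta(x',y)m_\theta(x,x')\,dx'\,\phi(x)\,dx$ (one-step log-predictive likelihood); * $\displaystyle D_\theta(y,\phi,\tau)=\frac{\iint g_\theta(x',y)m_\theta(x,x')\,dx'\,\tau(x)\,dx+\iint\nabla_\theta\{g_\theta(x',y)m_\theta(x,x')\}\,dx'\,\phi(x)\,dx}{\iint g_\theta(x',y)m_\theta(x,x')\,dx'\,\phi(x)\,dx}$; * $\displaystyle L^M_\theta(y,\phi)=\mathbb E\Big[\log\Big(\frac1M\sum_{i=1}^M\frac{\phi(\xi^i)m_\theta(\xi^i,\zeta^i)g_\theta(\zeta^i,y)}{\phi(\xi^i)r_\theta(\xi^i,y,\zeta^i)}\Big)\Big]$, where $(\xi^i,\zeta^i)_{i\le M}$ are i.i.d. with density $\phi(x)r_\theta(x,y,x')$ (IWAE-type objective); * $\displaystyle D^M_\theta(y,\phi,\tau)=\mathbb E\Big[\frac{\sum_{i=1}^M\nabla_\theta w_\theta(\xi^i,y,U^i)}{\sum_{i=1}^M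 w_\theta(\xi^i,y,U^i)}\Big]+M\iint\mathbb E\Big[\log\Big(\frac1M w_\theta(x,y,u)+\frac1M\sum_{i=1}^{M-1}w_\theta(\xi^i,y,U^i)\Big)\Big]\tau(x)\,\nu(du)\,dx$, where $(\xi^i,U^i)$ are i.i.d. with law $\phi(x)dx\otimes\nu(du)$. **Assumptions.** There are $\epsilon\in(0,1)$ and $\kappa<\infty$ such that for all $\theta\in\Theta$ and all $x,x',y,u$: 1. (strong mixing) $m_\theta(x,x')$, $g_\theta(x,y)$, $r_\theta(x,y,x')$ and $m(x,x')$ lie in $[\epsilon,\epsilon^{-1}]$; 2. (bounded gradients) the functions $\theta\mapsto m_\theta(x,x')$, $g_\theta(x,y)$, $m_\theta(x,h_\theta(x,y,u))$, $g_\theta(h_\theta(x,y,u),y)$ and $r_\theta(x,y,h_\theta(x,y,u))$ are differentiable on $\Theta$ with gradients of norm at most $\kappa$. **Proposition 3.1.** There is a differentiable function $\ell:\Theta\to\mathbb R$ (the contrast) and, for every integer $M\ge1$, a differentiable function $\ell^M:\Theta\to\mathbb R$ (the COLBO) such that for every $\theta\in\Theta$, with $\phi_{\theta,s}$ and $\tau_{\theta,s}$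 computed from the observations $Y_0,\dots,Y_s$, $\mathbb P$-almost surely as $t\to\infty$, $$\frac1t\sum_{s=0}^{t-1}L_\theta(Y_{s+1},\phi_{\theta,s})\to\ell(\theta),\qquad \frac1t\sum_{s=0}^{t-1}D_\theta(Y_{s+1},\phi_{\theta,s},\tau_{\theta,s})\to\nabla\ell(\theta),$$ $$\frac1t\sum_{s=0}^{t-1}L^M_\theta(Y_{s+1},\phi_{\theta,s})\to\ell^M(\theta),\qquad \frac1t\sum_{s=0}^{t-1}D^M_\theta(Y_{s+1},\phi_{\theta,s},\tau_{\theta,s})\to\nabla\ell^M(\theta).$$ Moreover, the terms of these four sums are integrable, and the same limits hold when they are replaced by their expectations. -/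

import Mathlib

open MeasureTheory Filter Topology

noncomputable section

namespace OSIWAE

section Densities

variable {A B : Type*} [MeasurableSpace A] [MeasurableSpace B]

/-- `f` is a probability density with respect to the reference measure `ref`. -/
structure IsProbDensity (ref : Measure A) (f : A → ℝ) : Prop where
  measurable : Measurable f
  nonneg : ∀ a, 0 ≤ f a
  integral_eq_one : ∫ a, f a ∂ref = 1

/-- `k` is a (jointly measurable) Markov transition density from `A` to `B` with respect to the
reference measure `ref` on `B`; the associated Markov kernel is `a ↦ k a b ref(db)`. -/
structure IsTransitionDensity (ref : Measure B) (k : A → B → ℝ) : Prop where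
  measurable : Measurable (Function.uncurry k)
  nonneg : ∀ a b, 0 ≤ k a b
  integral_eq_one : ∀ a, ∫ b, k a b ∂ref = 1

end Densities

section StateSpaceModels

variable {S O Ω : Type*} [MeasurableSpace S] [MeasurableSpace O] [MeasurableSpace Ω]

/-- The joint density of `(x_0, …, x_T, y_0, …, y_T)` in a state-space model with initial density
`m₀`, state transition density `m` and emission density `g`:
`m₀(x_0) g(x_0, y_0) ∏_{t=1}^T m(x_{t-1}, x_t) g(x_t, y_t)`. -/
def jointDensity (m₀ : S → ℝ) (m : S → S → ℝ) (g : S → O → ℝ) (T : ℕ)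
    (x : Fin (T + 1) → S) (y : Fin (T + 1) → O) : ℝ :=
  m₀ (x 0) * g (x 0) (y 0) *
    ∏ t : Fin T, m (x t.castSucc) (x t.succ) * g (x t.succ) (y t.succ)

/-- The process `(X_t, Y_t)` is a state-space model with initial density `m₀`, state transition
density `m` and emission density `g`: a bivariate Markov chain started from
`m₀(x) ξ(dx) g(x, y) η(dy)` and with transition kernel
`((x, y), (dx', dy')) ↦ m(x, x') ξ(dx') g(x', y') η(dy')`, expressed through the joint laws of its
finite initial segments. -/
structure IsStateSpaceModel (P : Measure Ω) (ξ : Measure S) (η : Measure O)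
    (m₀ : S → ℝ) (m : S → S → ℝ) (g : S → O → ℝ) (X : ℕ → Ω → S) (Y : ℕ → Ω → O) : Prop where
  measurable_state : ∀ t, Measurable (X t)
  measurable_obs : ∀ t, Measurable (Y t)
  law : ∀ T : ℕ,
    P.map (fun ω (t : Fin (T + 1)) => (X t ω, Y t ω)) =
      (Measure.pi fun _ : Fin (T + 1) => ξ.prod η).withDensity
        (fun z => ENNReal.ofReal
          (jointDensity m₀ m g T (fun t => (z t).1) (fun t => (z t).2)))

/-- The density, with respect to `ξ`, of the filter at time `t`, i.e. of the conditional law of the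
state at time `t` given the observations `y_0, …, y_t`. -/
def filterDensity (ξ : Measure S) (m₀ : S → ℝ) (m : S → S → ℝ) (g : S → O → ℝ)
    (y : ℕ → O) (t : ℕ) (x : S) : ℝ :=
  (∫ x' : Fin t → S, jointDensity m₀ m g t (Fin.snoc (α := fun _ => S) x' x) (fun s => y s)
      ∂Measure.pi fun _ => ξ) /
    ∫ x' : Fin (t + 1) → S, jointDensity m₀ m g t x' (fun s => y s) ∂Measure.pi fun _ => ξ

/-- The measure with density `φ` with respect to `ξ`. -/
def densityMeasure (ξ : Measure S) (φ : S → ℝ) : Measure S :=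
  ξ.withDensity fun x => ENNReal.ofReal (φ x)

/-- The one-step log-predictive likelihood
`log ∬ g(x', y) m(x, x') ξ(dx') φ(x) ξ(dx)` of the observation `y` when `φ` is the current
filter density. -/
def predLogLik (ξ : Measure S) (m : S → S → ℝ) (g : S → O → ℝ) (y : O) (φ : S → ℝ) : ℝ :=
  Real.log (∫ x, (∫ x', g x' y * m x x' ∂ξ) * φ x ∂ξ)

/-- The recognition distribution on pairs `(x, x')`, with density `φ(x) r(x, y, x')`. -/
def recognition (ξ : Measure S) (r : S → O → S → ℝ) (y : O) (φ : S → ℝ) : Measure (S × S) :=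
  (ξ.prod ξ).withDensity fun z => ENNReal.ofReal (φ z.1 * r z.1 y z.2)

/-- The multi-sample objective with `M` independent draws `(X^i, X'^i)` from the recognition
distribution: the expectation of
`log (M⁻¹ ∑_i φ(X^i) m(X^i, X'^i) g(X'^i, y) / (φ(X^i) r(X^i, y, X'^i)))`. -/
def iwaeObjective (ξ : Measure S) (m : S → S → ℝ) (g : S → O → ℝ) (r : S → O → S → ℝ)
    (M : ℕ) (y : O) (φ : S → ℝ) : ℝ :=
  ∫ z : Fin M → S × S,
    Real.log ((M : ℝ)⁻¹ * ∑ i, (φ (z i).1 * m (z i).1 (z i).2 * g (z i).2 y) /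
      (φ (z i).1 * r (z i).1 y (z i).2))
    ∂Measure.pi fun _ => recognition ξ r y φ

end StateSpaceModels

section Gradients

variable {p : ℕ} {S O U : Type*} [MeasurableSpace S] [MeasurableSpace O] [MeasurableSpace U]

/-- The tangent filter: the gradient of the filter density in the parameter. -/
def tangentDensity (ξ : Measure S) (m₀ : S → ℝ) (m : EuclideanSpace ℝ (Fin p) → S → S → ℝ)
    (g : EuclideanSpace ℝ (Fin p) → S → O → ℝ) (θ : EuclideanSpace ℝ (Fin p))
    (y : ℕ → O) (t : ℕ) (x : S) : EuclideanSpace ℝ (Fin p) :=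
  gradient (fun θ' => filterDensity ξ m₀ (m θ') (g θ') y t x) θ

/-- The gradient expression associated with the one-step log-predictive likelihood, as a function
of the observation, of the filter density `φ` and of the tangent filter density `τ`. -/
def predLogLikGrad (ξ : Measure S) (m : EuclideanSpace ℝ (Fin p) → S → S → ℝ)
    (g : EuclideanSpace ℝ (Fin p) → S → O → ℝ) (θ : EuclideanSpace ℝ (Fin p))
    (y : O) (φ : S → ℝ) (τ : S → EuclideanSpace ℝ (Fin p)) : EuclideanSpace ℝ (Fin p) :=
  (∫ x, (∫ x', g θ x' y * m θ x x' ∂ξ) * φ x ∂ξ)⁻¹ •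
    ((∫ x, (∫ x', g θ x' y * m θ x x' ∂ξ) • τ x ∂ξ) +
      ∫ x, φ x • (∫ x', gradient (fun θ' => g θ' x' y * m θ' x x') θ ∂ξ) ∂ξ)

/-- The reparameterised importance weight: the weight `m g / r` at the proposed state
`h θ x y u`. -/
def weight (m : EuclideanSpace ℝ (Fin p) → S → S → ℝ)
    (g : EuclideanSpace ℝ (Fin p) → S → O → ℝ) (r : EuclideanSpace ℝ (Fin p) → S → O → S → ℝ)
    (h : EuclideanSpace ℝ (Fin p) → S → O → U → S)
    (θ : EuclideanSpace ℝ (Fin p)) (x : S) (y : O) (u : U) : ℝ :=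
  g θ (h θ x y u) y * m θ x (h θ x y u) / r θ x y (h θ x y u)

/-- The gradient expression associated with the multi-sample objective, as a function of the
observation, of the filter density `φ` and of the tangent filter density `τ`. The expectations are
over independent pairs `(X^i, U^i)` with law `φ(x) ξ(dx) ⊗ ν`. -/
def iwaeGrad (ξ : Measure S) (ν : Measure U) (m : EuclideanSpace ℝ (Fin p) → S → S → ℝ)
    (g : EuclideanSpace ℝ (Fin p) → S → O → ℝ) (r : EuclideanSpace ℝ (Fin p) → S → O → S → ℝ)
    (h : EuclideanSpace ℝ (Fin p) → S → O → U → S) (M : ℕ)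
    (θ : EuclideanSpace ℝ (Fin p)) (y : O) (φ : S → ℝ) (τ : S → EuclideanSpace ℝ (Fin p)) :
    EuclideanSpace ℝ (Fin p) :=
  (∫ z : Fin M → S × U,
      (∑ i, weight m g r h θ (z i).1 y (z i).2)⁻¹ •
        ∑ i, gradient (fun θ' => weight m g r h θ' (z i).1 y (z i).2) θ
      ∂Measure.pi fun _ => (densityMeasure ξ φ).prod ν) +
    (M : ℝ) • ∫ x, ∫ u,
      (∫ z : Fin (M - 1) → S × U,
        Real.log ((M : ℝ)⁻¹ * weight m g r h θ x y u +
          (M : ℝ)⁻¹ * ∑ i, weight m g r h θ (z i).1 y (z i).2)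
        ∂Measure.pi fun _ => (densityMeasure ξ φ).prod ν) • τ x ∂ν ∂ξ

end Gradients

section Averages

variable {Ω E : Type*} [MeasurableSpace Ω] [NormedAddCommGroup E] [NormedSpace ℝ E]

/-- `t⁻¹ ∑_{s < t} f s`. -/
def timeAverage (f : ℕ → E) (t : ℕ) : E :=
  (t : ℝ)⁻¹ • ∑ s ∈ Finset.range t, f s

/-- Every term `F s` is integrable and `t⁻¹ ∑_{s < t} 𝔼[F s]` converges to `a`. -/
def MeanAverageTendsto (P : Measure Ω) (F : ℕ → Ω → E) (a : E) : Prop :=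
  (∀ s, Integrable (F s) P) ∧
    Tendsto (timeAverage fun s => ∫ ω, F s ω ∂P) atTop (𝓝 a)

end Averages

end OSIWAE

end

/-! Each term of the four sums is a fixed functional of `Y_{s+1}`, of the filter and of the tangent
filter at time `s`. Strong mixing makes such functionals forget the past geometrically: run from
time `0`, or restarted from `m₀` at time `j`, they agree up to `C ρ ^ k` after `k` further steps,
for every observation sequence and uniformly in `θ` (`IsForgetting`). Forgetting is pathwise and the
chain `(X, Y)` satisfies a Doeblin condition, so no stationary version of the data is needed: the
means of the terms form a Cauchy sequence, their covariances decay geometrically, and the variance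
of a partial sum grows at most linearly. Chebyshev along geometric subsequences and monotone
interpolation then give the strong law (`IsMixingSeq.ae_tendsto_timeAverage`).

The contrast is the limit of the means. The terms `D` and `D^M` are the exact gradients in `θ` of
the terms `L` and `L^M` (`ParamModel.hasGradientAt_predLogLik`,
`ProposalModel.hasGradientAt_iwaeObjective`) and forget with constants independent of `θ`. Hence the
mean gradients converge uniformly on `Θ`, and their limit is the gradient of the contrast
(`IsMixingSeq.exists_contrast`).

For the filter, prediction with a kernel valued in `[ε, ε⁻¹]` contracts the relative distance of two
densities by `1 - ε ^ 2`. The tangent filter is handled by Fisher's identity: it is `φ (s - ∫ φ s)`,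
where `s` is the conditional expectation of the joint score given the current state. The size of `s`
may grow with time, but only its oscillation matters; the backward kernels are minorised by `ε ^ 2
φ`, so oscillations of `s` stay bounded and those of the difference of two scores decay. Filter and
tangent filter thus forget relative to `φ` (`ParamModel.pairClose_forget`), and so do bounded
functionals that are Lipschitz in this sense (`ParamModel.isForgetting`).

In the multi-sample objective, the reparameterisation moves the proposal into weights lying in `[ε ^
3, ε⁻¹ ^ 3]`, so that `θ` enters through these weights and the product density of the filter.
Exchangeability of the draws turns the `M` derivatives of that product into the factor `M` of `D^M`.
-/

set_option linter.unusedSectionVars false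

noncomputable section

namespace OSIWAE

/-! ### Dobrushin contraction: averages of functions of bounded oscillation. -/

section Contraction

variable {A E : Type*} [MeasurableSpace A] [NormedAddCommGroup E] [NormedSpace ℝ E]
  [CompleteSpace E]

/-- A function with bounded oscillation is bounded. -/
lemma exists_norm_le_of_osc {s : A → E} {B : ℝ} (hs : ∀ a b, ‖s a - s b‖ ≤ B) :
    ∃ C, ∀ a, ‖s a‖ ≤ C := by
  rcases isEmpty_or_nonempty A with hA | ⟨⟨a₀⟩⟩
  · exact ⟨0, fun a => (hA.false a).elim⟩
  · refine ⟨‖s a₀‖ + B, fun a => ?_⟩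
    have := norm_add_le (s a₀) (s a - s a₀)
    rw [add_sub_cancel] at this
    linarith [hs a a₀]

lemma integrable_smul_of_osc {μ : Measure A} {w : A → ℝ} {s : A → E} {B : ℝ}
    (hw : Integrable w μ) (hsm : StronglyMeasurable s) (hs : ∀ a b, ‖s a - s b‖ ≤ B) :
    Integrable (fun a => w a • s a) μ := by
  obtain ⟨C, hC⟩ := exists_norm_le_of_osc hs
  exact hw.smul_bdd C hsm.aestronglyMeasurable (ae_of_all _ hC)

/-- Averages of `s` against two nonnegative weights of equal mass `k`. -/
lemma norm_integral_smul_sub_le_mass {μ : Measure A} {p q : A → ℝ} {s : A → E} {k B : ℝ}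
    (hp : Integrable p μ) (hq : Integrable q μ) (hp0 : ∀ a, 0 ≤ p a) (hq0 : ∀ a, 0 ≤ q a)
    (hpk : ∫ a, p a ∂μ = k) (hqk : ∫ a, q a ∂μ = k) (hsm : StronglyMeasurable s)
    (hs : ∀ a b, ‖s a - s b‖ ≤ B) :
    ‖∫ a, p a • s a ∂μ - ∫ a, q a • s a ∂μ‖ ≤ k * B := by
  have hps := integrable_smul_of_osc hp hsm hs
  have hqs := integrable_smul_of_osc hq hsm hs
  have hk : 0 ≤ k := hpk ▸ integral_nonneg hp0
  -- Multiplied by the common mass `k`, the difference becomes the double integral of `p a q b (s a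
  -- - s b)`, which is at most `k ^ 2 B`. One factor `k` is divided out at the end; if `k = 0`, both
  -- weights vanish almost everywhere.
  have key : ‖k • (∫ a, p a • s a ∂μ - ∫ a, q a • s a ∂μ)‖ ≤ k * (k * B) := by
    have h1 : k • (∫ a, p a • s a ∂μ - ∫ a, q a • s a ∂μ) =
        ∫ a, p a • (k • s a - ∫ b, q b • s b ∂μ) ∂μ := by
      simp_rw [smul_sub, smul_comm (p _) k]
      rw [integral_sub (f := fun a => k • p a • s a) (hps.smul k) (hp.smul_const _),
          integral_smul, integral_smul_const, hpk]
    have h2 : ∀ a, ‖k • s a - ∫ b, q b • s b ∂μ‖ ≤ k * B := by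
      intro a
      have : k • s a - ∫ b, q b • s b ∂μ = ∫ b, q b • (s a - s b) ∂μ := by
        simp_rw [smul_sub]
        rw [integral_sub (hq.smul_const _) hqs, integral_smul_const, hqk]
      rw [this, ← hqk, ← integral_mul_const]
      refine norm_integral_le_of_norm_le (hq.mul_const _) (ae_of_all _ fun b => ?_)
      rw [norm_smul, Real.norm_of_nonneg (hq0 b)]
      exact mul_le_mul_of_nonneg_left (hs a b) (hq0 b)
    rw [h1]
    nth_rw 2 [← hpk]
    rw [← integral_mul_const]
    refine norm_integral_le_of_norm_le (hp.mul_const _) (ae_of_all _ fun a => ?_)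
    rw [norm_smul, Real.norm_of_nonneg (hp0 a)]
    exact mul_le_mul_of_nonneg_left (h2 a) (hp0 a)
  rcases hk.eq_or_lt with rfl | hk
  · have hz : ∀ w : A → ℝ, Integrable w μ → (∀ a, 0 ≤ w a) → ∫ a, w a ∂μ = 0 →
        ∫ a, w a • s a ∂μ = 0 := by
      intro w hw hw0 hwk
      rw [integral_eq_zero_iff_of_nonneg hw0 hw] at hwk
      refine integral_eq_zero_of_ae ?_
      filter_upwards [hwk] with a ha
      simp [ha]
    simp [hz p hp hp0 hpk, hz q hq hq0 hqk]
  · rw [norm_smul, Real.norm_of_nonneg hk.le] at key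
    exact le_of_mul_le_mul_left key hk

/-- Two probability densities with a common minorant of mass at least `δ` contract oscillations
by `1 - δ`. -/
lemma norm_integral_smul_sub_le {μ : Measure A} {p q c : A → ℝ} {s : A → E} {δ B : ℝ}
    (hp : Integrable p μ) (hq : Integrable q μ) (hc : Integrable c μ)
    (hcp : ∀ a, c a ≤ p a) (hcq : ∀ a, c a ≤ q a) (hp1 : ∫ a, p a ∂μ = 1)
    (hq1 : ∫ a, q a ∂μ = 1) (hcδ : δ ≤ ∫ a, c a ∂μ) (hsm : StronglyMeasurable s)
    (hs : ∀ a b, ‖s a - s b‖ ≤ B) :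
    ‖∫ a, p a • s a ∂μ - ∫ a, q a • s a ∂μ‖ ≤ (1 - δ) * B := by
  have hB : 0 ≤ B := by
    rcases isEmpty_or_nonempty A with hA | ⟨⟨a₀⟩⟩
    · simp [integral_of_isEmpty] at hp1
    · exact (norm_nonneg _).trans (hs a₀ a₀)
  have hps := integrable_smul_of_osc hp hsm hs
  have hqs := integrable_smul_of_osc hq hsm hs
  have hcs := integrable_smul_of_osc hc hsm hs
  -- The common part `c` cancels in the difference; only the remainders, of mass `1 - ∫ c ≤ 1 - δ`,
  -- contribute.
  have h := norm_integral_smul_sub_le_mass (hp.sub hc) (hq.sub hc) (s := s)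
    (k := 1 - ∫ a, c a ∂μ) (B := B)
    (fun a => sub_nonneg.2 (hcp a)) (fun a => sub_nonneg.2 (hcq a))
    (by simp only [Pi.sub_apply]; rw [integral_sub hp hc, hp1])
    (by simp only [Pi.sub_apply]; rw [integral_sub hq hc, hq1]) hsm hs
  have e : ∀ w : A → ℝ, Integrable (fun a => w a • s a) μ →
      ∫ a, (w - c) a • s a ∂μ = ∫ a, w a • s a ∂μ - ∫ a, c a • s a ∂μ := by
    intro w hw
    simp_rw [Pi.sub_apply, sub_smul]
    exact integral_sub hw hcs
  rw [e p hps, e q hqs, sub_sub_sub_cancel_right] at h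
  exact h.trans (mul_le_mul_of_nonneg_right (by linarith) hB)

end Contraction

/-- The Bochner integral of a non-integrable function is `0`, so having total mass `1` forces
integrability. -/
lemma IsTransitionDensity.integrable {A B : Type*} [MeasurableSpace A] [MeasurableSpace B]
    {μ : Measure B} {q : A → B → ℝ} (hq : IsTransitionDensity μ q) (z : A) :
    Integrable (q z) μ := by
  by_contra h
  have := hq.integral_eq_one z
  rw [integral_undef h] at this
  exact zero_ne_one this

/-! ### Markov chains: conditioning and geometric loss of memory. -/

section Markov

variable {Z Ω : Type*} [MeasurableSpace Z] [MeasurableSpace Ω]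

/-- The action of a transition density on functions. -/
def transOp (μ : Measure Z) (q : Z → Z → ℝ) (u : Z → ℝ) (z : Z) : ℝ := ∫ z', q z z' * u z' ∂μ

/-- `W` is a Markov process with transition density `q`. -/
structure IsMarkovSeq (P : Measure Ω) (μ : Measure Z) (q : Z → Z → ℝ) (W : ℕ → Ω → Z) :
    Prop where
  measurable : ∀ n, Measurable (W n)
  step : ∀ (n : ℕ) (Φ : (ℕ → Z) → ℝ) (C : ℝ), Measurable Φ → (∀ z, |Φ z| ≤ C) →
    DependsOn Φ (Set.Iic (n + 1)) →
    ∫ ω, Φ (fun k => W k ω) ∂P =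
      ∫ ω, ∫ z', q (W n ω) z' * Φ (Function.update (fun k => W k ω) (n + 1) z') ∂μ ∂P

variable {P : Measure Ω} [IsProbabilityMeasure P] {μ : Measure Z} [SFinite μ] {q : Z → Z → ℝ}
  {W : ℕ → Ω → Z}

lemma abs_integral_mul_le (hq : IsTransitionDensity μ q) {f : Z → ℝ} {C : ℝ}
    (hf : ∀ z, |f z| ≤ C) (z : Z) : |∫ z', q z z' * f z' ∂μ| ≤ C := by
  have := norm_integral_le_of_norm_le ((hq.integrable z).mul_const C) (f := fun z' => q z z' * f z')
    (ae_of_all _ fun z' => by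
      rw [norm_mul, Real.norm_of_nonneg (hq.nonneg z z')]
      exact mul_le_mul_of_nonneg_left (hf z') (hq.nonneg z z'))
  rwa [integral_mul_const, hq.integral_eq_one, one_mul] at this

lemma measurable_transOp (hq : IsTransitionDensity μ q) {u : Z → ℝ} (hu : Measurable u) :
    Measurable (transOp μ q u) := by
  have : StronglyMeasurable (fun a : Z × Z => q a.1 a.2 * u a.2) :=
    (hq.measurable.mul (hu.comp measurable_snd)).stronglyMeasurable
  exact this.integral_prod_right.measurable

/-- The Markov property `IsMarkovSeq.step` overwrites one coordinate of the path and integrates it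
out; this provides the joint measurability needed there. -/
lemma measurable_update_path (n : ℕ) :
    Measurable fun a : (ℕ → Z) × Z => Function.update a.1 n a.2 := by
  refine measurable_pi_lambda _ fun k => ?_
  rcases eq_or_ne k n with rfl | h
  · simpa using measurable_snd
  · simp only [Function.update_of_ne h]
    fun_prop

/-- The time shift on sequences. -/
def shift {A : Type*} (n : ℕ) (z : ℕ → A) : ℕ → A := fun k => z (n + k)

lemma measurable_shift (n : ℕ) : Measurable (shift n : (ℕ → Z) → ℕ → Z) :=
  measurable_pi_lambda _ fun k => measurable_pi_apply (n + k)

lemma IsMarkovSeq.measurable_path (hW : IsMarkovSeq P μ q W) :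
    Measurable fun ω k => W k ω := measurable_pi_lambda _ hW.measurable

lemma IsMarkovSeq.integrable (hW : IsMarkovSeq P μ q W) {f : (ℕ → Z) → ℝ} {C : ℝ}
    (hfm : Measurable f) (hf : ∀ z, |f z| ≤ C) : Integrable (fun ω => f (fun k => W k ω)) P :=
  Integrable.of_bound (hfm.comp hW.measurable_path).aestronglyMeasurable C
    (ae_of_all _ fun _ => hf _)

/-- A functional of `k + 1` consecutive values can be replaced by its conditional expectation given
the first of them. -/
lemma IsMarkovSeq.exists_reduction (hW : IsMarkovSeq P μ q W)
    (hq : IsTransitionDensity μ q) {C : ℝ} (k : ℕ) :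
    ∀ G : (ℕ → Z) → ℝ, Measurable G → (∀ z, |G z| ≤ C) → DependsOn G (Set.Iic k) →
    ∃ u : Z → ℝ, Measurable u ∧ (∀ z, |u z| ≤ C) ∧
      ∀ (n : ℕ) (f : (ℕ → Z) → ℝ) (D : ℝ), Measurable f → (∀ z, |f z| ≤ D) →
        DependsOn f (Set.Iic n) →
        ∫ ω, f (fun k => W k ω) * G (shift n fun k => W k ω) ∂P =
          ∫ ω, f (fun k => W k ω) * u (W n ω) ∂P := by
  induction k with
  | zero =>
    intro G hGm hG hGd
    refine ⟨fun z => G fun _ => z, hGm.comp (measurable_pi_lambda _ fun _ => measurable_id),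
      fun z => hG _, fun n f D _ _ _ => ?_⟩
    congr 1 with ω
    congr 1
    refine hGd fun i hi => ?_
    obtain rfl : i = 0 := by simpa using hi
    rfl
  | succ k ih =>
    intro G hGm hG hGd
    -- The last coordinate is integrated out against `q`, which keeps the bound `C` and leaves a
    -- functional of one coordinate fewer. Homogeneity of the chain makes the resulting `u`
    -- independent of the time `n` and of the factor `f`.
    obtain ⟨u, hum, hu, H⟩ := ih
      (fun z => ∫ z', q (z k) z' * G (Function.update z (k + 1) z') ∂μ)
      (by
        have : StronglyMeasurable (fun a : (ℕ → Z) × Z =>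
            q (a.1 k) a.2 * G (Function.update a.1 (k + 1) a.2)) := by
          refine Measurable.stronglyMeasurable (Measurable.mul ?_ ?_)
          · exact hq.measurable.comp (f := fun a : (ℕ → Z) × Z => (a.1 k, a.2)) (by fun_prop)
          · exact hGm.comp (measurable_update_path _)
        exact this.integral_prod_right.measurable)
      (fun z => abs_integral_mul_le hq (f := fun z' => G (Function.update z (k + 1) z'))
        (fun _ => hG _) _)
      (by
        intro z z' h
        have h0 : z k = z' k := h k (by simp)
        simp only [h0]
        congr 1 with w
        congr 1
        refine hGd fun i hi => ?_
        rcases eq_or_ne i (k + 1) with rfl | hne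
        · simp
        · have : i ≤ k + 1 := hi
          simp only [Function.update_of_ne hne]
          exact h i (by simp only [Set.mem_Iic]; omega))
    refine ⟨u, hum, hu, fun n f D hfm hf hfd => ?_⟩
    rw [← H n f D hfm hf hfd]
    have hstep := hW.step (n + k) (fun z => f z * G (shift n z)) (D * C)
      (hfm.mul (hGm.comp (measurable_shift n)))
      (fun z => by
        rw [abs_mul]
        exact mul_le_mul (hf z) (hG _) (abs_nonneg _) ((abs_nonneg _).trans (hf z)))
      (by
        intro z z' h
        have h1 : f z = f z' := hfd fun i hi => h i (by
          have : i ≤ n := hi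
          simp only [Set.mem_Iic]; omega)
        have h2 : G (shift n z) = G (shift n z') := hGd fun i hi => h (n + i) (by
          have : i ≤ k + 1 := hi
          simp only [Set.mem_Iic]; omega)
        simp only [h1, h2])
    rw [hstep]
    congr 1 with ω
    rw [← integral_const_mul]
    congr 1 with z'
    have h1 : f (Function.update (fun k => W k ω) (n + k + 1) z') = f fun k => W k ω :=
      hfd fun i hi => by
        have : i ≤ n := hi
        rw [Function.update_of_ne (by omega)]
    have h2 : shift n (Function.update (fun k => W k ω) (n + k + 1) z') =
        Function.update (shift n fun k => W k ω) (k + 1) z' := by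
      funext i
      rcases eq_or_ne i (k + 1) with rfl | hne
      · simp [shift, add_assoc]
      · rw [Function.update_of_ne hne]
        simp only [shift]
        rw [Function.update_of_ne (by omega)]
    simp only [h1, h2]
    change _ = _ * (q (W (n + k) ω) z' * _)
    ring

lemma IsMarkovSeq.integral_mul_succ (hW : IsMarkovSeq P μ q W)
    {u : Z → ℝ} {C : ℝ} (hum : Measurable u)
    (hu : ∀ z, |u z| ≤ C) (n : ℕ) (f : (ℕ → Z) → ℝ) (D : ℝ) (hfm : Measurable f)
    (hf : ∀ z, |f z| ≤ D) (hfd : DependsOn f (Set.Iic n)) :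
    ∫ ω, f (fun k => W k ω) * u (W (n + 1) ω) ∂P =
      ∫ ω, f (fun k => W k ω) * transOp μ q u (W n ω) ∂P := by
  have hstep := hW.step n (fun z => f z * u (z (n + 1))) (D * C)
      (hfm.mul (hum.comp (measurable_pi_apply _)))
      (fun z => by
        rw [abs_mul]
        exact mul_le_mul (hf z) (hu _) (abs_nonneg _) ((abs_nonneg _).trans (hf z)))
      (by
        intro z z' h
        have h1 : f z = f z' := hfd fun i hi => h i (by
          have : i ≤ n := hi
          simp only [Set.mem_Iic]; omega)
        simp only [h1, h (n + 1) (by simp)])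
  rw [hstep]
  congr 1 with ω
  rw [transOp, ← integral_const_mul]
  congr 1 with z'
  have h1 : f (Function.update (fun k => W k ω) (n + 1) z') = f fun k => W k ω :=
    hfd fun i hi => by
      have : i ≤ n := hi
      rw [Function.update_of_ne (by omega)]
  simp only [h1, Function.update_self]
  ring

/-- Iterates of the transition operator. -/
lemma IsMarkovSeq.integral_mul_iterate (hW : IsMarkovSeq P μ q W)
    (hq : IsTransitionDensity μ q) {C : ℝ} (j : ℕ) :
    ∀ (u : Z → ℝ), Measurable u → (∀ z, |u z| ≤ C) → ∀ (n : ℕ) (f : (ℕ → Z) → ℝ) (D : ℝ),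
      Measurable f → (∀ z, |f z| ≤ D) → DependsOn f (Set.Iic n) →
      ∫ ω, f (fun k => W k ω) * u (W (n + j) ω) ∂P =
        ∫ ω, f (fun k => W k ω) * (transOp μ q)^[j] u (W n ω) ∂P := by
  induction j with
  | zero => intros; rfl
  | succ j ih =>
    intro u hum hu n f D hfm hf hfd
    rw [← add_assoc, hW.integral_mul_succ hum hu (n + j) f D hfm hf
      (fun z z' h => hfd fun i hi => h i (by
        have : i ≤ n := hi
        simp only [Set.mem_Iic]; omega)),
      ih _ (measurable_transOp hq hum) (fun z => abs_integral_mul_le hq hu z) n f D hfm hf hfd]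
    rfl

lemma iterate_transOp_bound (hq : IsTransitionDensity μ q) {C : ℝ} (j : ℕ) :
    ∀ (u : Z → ℝ), Measurable u → (∀ z, |u z| ≤ C) →
      Measurable ((transOp μ q)^[j] u) ∧ ∀ z, |(transOp μ q)^[j] u z| ≤ C := by
  induction j with
  | zero => intro u hum hu; exact ⟨hum, hu⟩
  | succ j ih =>
    intro u hum hu
    exact ih _ (measurable_transOp hq hum) (fun z => abs_integral_mul_le hq hu z)

/-- Any two rows of `q` share the minorant `c`, so each application of the operator multiplies
oscillations by `1 - δ`. -/
lemma iterate_transOp_osc (hq : IsTransitionDensity μ q) {c : Z → ℝ} {δ : ℝ}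
    (hc : Integrable c μ) (hcq : ∀ z z', c z' ≤ q z z') (hcδ : δ ≤ ∫ z, c z ∂μ) (j : ℕ) :
    ∀ (u : Z → ℝ) (B : ℝ), Measurable u → (∀ z z', |u z - u z'| ≤ B) →
      ∀ z z', |(transOp μ q)^[j] u z - (transOp μ q)^[j] u z'| ≤ (1 - δ) ^ j * B := by
  induction j with
  | zero => intro u B _ hu; simpa using hu
  | succ j ih =>
    intro u B hum hu z z'
    have := ih (transOp μ q u) ((1 - δ) * B) (measurable_transOp hq hum) (fun z z' =>
      norm_integral_smul_sub_le (hq.integrable z) (hq.integrable z') hc (hcq z) (hcq z')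
        (hq.integral_eq_one z) (hq.integral_eq_one z') hcδ hum.stronglyMeasurable hu) z z'
    rwa [← mul_assoc, ← pow_succ] at this

section Mixing

variable {c : Z → ℝ} {δ : ℝ}

/-- After `j` steps the function is nearly constant, hence close to its mean under the law of any `W
n`; `2 * C` is the initial oscillation. -/
lemma iterate_transOp_sub_integral_le [Nonempty Ω] (hW : IsMarkovSeq P μ q W)
    (hq : IsTransitionDensity μ q)
    (hc : Integrable c μ) (hcq : ∀ z z', c z' ≤ q z z') (hcδ : δ ≤ ∫ z, c z ∂μ)
    {u : Z → ℝ} {C : ℝ} (hum : Measurable u) (hu : ∀ z, |u z| ≤ C) (j n : ℕ) (z : Z) :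
    |(transOp μ q)^[j] u z - ∫ ω, (transOp μ q)^[j] u (W n ω) ∂P| ≤ 2 * C * (1 - δ) ^ j := by
  obtain ⟨hm, hb⟩ := iterate_transOp_bound hq j u hum hu
  have hi : Integrable (fun ω => (transOp μ q)^[j] u (W n ω)) P :=
    Integrable.of_bound (hm.comp (hW.measurable n)).aestronglyMeasurable
        C (ae_of_all _ fun _ => hb _)
  have : (transOp μ q)^[j] u z - ∫ ω, (transOp μ q)^[j] u (W n ω) ∂P =
      ∫ ω, ((transOp μ q)^[j] u z - (transOp μ q)^[j] u (W n ω)) ∂P := by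
    rw [integral_sub (integrable_const _) hi]; simp
  rw [this]
  have h := norm_integral_le_of_norm_le_const (μ := P)
    (f := fun ω => (transOp μ q)^[j] u z - (transOp μ q)^[j] u (W n ω))
    (C := (1 - δ) ^ j * (2 * C)) (ae_of_all _ fun ω =>
      iterate_transOp_osc hq hc hcq hcδ j u (2 * C) hum (fun a b => by
        have := abs_sub (u a) (u b)
        linarith [hu a, hu b]) _ _)
  rw [probReal_univ, mul_one, Real.norm_eq_abs] at h
  linarith

/-- Conditioning turns the future functional into `u (W (n + j))`, and then into the `j`-th iterate
of `u` at `W n`. This is almost constant, so its covariance with a function of the past is small.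
The window length `k` of `G` does not enter the bound. -/
lemma IsMarkovSeq.cov_le (hW : IsMarkovSeq P μ q W)
    (hq : IsTransitionDensity μ q)
    (hc : Integrable c μ) (hcq : ∀ z z', c z' ≤ q z z') (hcδ : δ ≤ ∫ z, c z ∂μ)
    {G f : (ℕ → Z) → ℝ} {C D : ℝ} {k n : ℕ} (hGm : Measurable G) (hG : ∀ z, |G z| ≤ C)
    (hGd : DependsOn G (Set.Iic k)) (hfm : Measurable f) (hf : ∀ z, |f z| ≤ D)
    (hfd : DependsOn f (Set.Iic n)) (j : ℕ) :
    |∫ ω, f (fun k => W k ω) * G (shift (n + j) fun k => W k ω) ∂P -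
      (∫ ω, f (fun k => W k ω) ∂P) * ∫ ω, G (shift (n + j) fun k => W k ω) ∂P| ≤
      D * (2 * C * (1 - δ) ^ j) := by
  have : Nonempty Ω := nonempty_of_isProbabilityMeasure P
  obtain ⟨u, hum, hu, H⟩ := hW.exists_reduction hq k G hGm hG hGd
  have hd : ∀ f : (ℕ → Z) → ℝ, DependsOn f (Set.Iic n) → DependsOn f (Set.Iic (n + j)) :=
    fun f hfd z z' h => hfd fun i hi => h i (by
        have : i ≤ n := hi
        simp only [Set.mem_Iic]; omega)
  have h1 := H (n + j) f D hfm hf (hd f hfd)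
  rw [hW.integral_mul_iterate hq j u hum hu n f D hfm hf hfd] at h1
  -- The same reduction with the constant `f = 1` expresses the mean of the future functional
  -- through the same iterate.
  have hone : DependsOn (fun _ : ℕ → Z => (1 : ℝ)) (Set.Iic n) := fun _ _ _ => rfl
  have h2 := H (n + j) (fun _ => 1) 1 measurable_const (by simp) (hd _ hone)
  rw [hW.integral_mul_iterate hq j u hum hu n _ 1 measurable_const (by simp) hone] at h2
  simp only [one_mul] at h2
  rw [h1, h2]
  obtain ⟨hm, hb⟩ := iterate_transOp_bound hq j u hum hu
  set v := (transOp μ q)^[j] u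
  set e := ∫ ω, v (W n ω) ∂P
  have hfi := hW.integrable hfm hf
  have hvi : Integrable (fun ω => f (fun k => W k ω) * v (W n ω)) P :=
    hfi.mul_bdd (c := C) (hm.comp (hW.measurable n)).aestronglyMeasurable
        (ae_of_all _ fun _ => hb _)
  rw [← integral_mul_const, ← integral_sub hvi (hfi.mul_const _)]
  have h := norm_integral_le_of_norm_le_const (μ := P)
    (f := fun ω => f (fun k => W k ω) * v (W n ω) - f (fun k => W k ω) * e)
    (C := D * (2 * C * (1 - δ) ^ j)) (ae_of_all _ fun ω => by
      rw [← mul_sub, norm_mul]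
      exact mul_le_mul (hf _)
        (iterate_transOp_sub_integral_le hW hq hc hcq hcδ hum hu j n _) (norm_nonneg _)
        ((abs_nonneg _).trans (hf fun k => W k ω)))
  simpa using h

/-- This replaces stationarity. Both expectations are means of the same `b`-fold iterate, at times
`j` and `0`, and that iterate is within `2 * C * (1 - δ) ^ b` of a constant. -/
lemma IsMarkovSeq.integral_shift_sub_le (hW : IsMarkovSeq P μ q W)
    (hq : IsTransitionDensity μ q)
    (hc : Integrable c μ) (hcq : ∀ z z', c z' ≤ q z z') (hcδ : δ ≤ ∫ z, c z ∂μ)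
    {G : (ℕ → Z) → ℝ} {C : ℝ} {k : ℕ} (hGm : Measurable G) (hG : ∀ z, |G z| ≤ C)
    (hGd : DependsOn G (Set.Iic k)) (b j : ℕ) :
    |∫ ω, G (shift (j + b) fun k => W k ω) ∂P - ∫ ω, G (shift b fun k => W k ω) ∂P| ≤
      2 * C * (1 - δ) ^ b := by
  have : Nonempty Ω := nonempty_of_isProbabilityMeasure P
  obtain ⟨u, hum, hu, H⟩ := hW.exists_reduction hq k G hGm hG hGd
  have hone : ∀ n, DependsOn (fun _ : ℕ → Z => (1 : ℝ)) (Set.Iic n) := fun _ _ _ _ => rfl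
  have h2 : ∀ j, ∫ ω, G (shift (j + b) fun k => W k ω) ∂P =
      ∫ ω, (transOp μ q)^[b] u (W j ω) ∂P := by
    intro j
    have h2 := H (j + b) (fun _ => 1) 1 measurable_const (by simp) (hone _)
    rw [hW.integral_mul_iterate hq b u hum hu j _ 1 measurable_const (by simp) (hone _)] at h2
    simpa only [one_mul] using h2
  have h3 := h2 0
  rw [zero_add] at h3
  rw [h2 j, h3]
  obtain ⟨hm, hb⟩ := iterate_transOp_bound hq b u hum hu
  set v := (transOp μ q)^[b] u
  have hi : Integrable (fun ω => v (W j ω)) P :=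
    Integrable.of_bound (hm.comp (hW.measurable j)).aestronglyMeasurable
        C (ae_of_all _ fun _ => hb _)
  have h := norm_integral_le_of_norm_le_const (μ := P)
    (f := fun ω => v (W j ω) - ∫ ω, v (W 0 ω) ∂P)
    (C := 2 * C * (1 - δ) ^ b) (ae_of_all _ fun ω =>
        iterate_transOp_sub_integral_le hW hq hc hcq hcδ hum hu b 0 _)
  rw [integral_sub hi (integrable_const _)] at h
  simpa using h

end Mixing

end Markov

/-! ### Strong law of large numbers for forgetting functionals. -/

section LawOfLargeNumbers

variable {Z Ω : Type*} [MeasurableSpace Z] [MeasurableSpace Ω]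

/-- A Markov process whose transition density is minorised by a function of mass at least `1 - ρ`
which does not depend on the initial state. -/
structure IsMixingSeq (P : Measure Ω) (μ : Measure Z) (q : Z → Z → ℝ) (W : ℕ → Ω → Z)
    (ρ : ℝ) : Prop where
  markov : IsMarkovSeq P μ q W
  trans : IsTransitionDensity μ q
  minor : ∃ c : Z → ℝ, Integrable c μ ∧ (∀ z z', c z' ≤ q z z') ∧ 1 - ρ ≤ ∫ z, c z ∂μ
  pos : 0 < ρ
  lt_one : ρ < 1

/-- A sequence of bounded functionals of the paths, the `k`-th of which depends on the coordinates
up to `k + 1` only, and forgets the remote past at a geometric rate. -/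
structure IsForgetting {E : Type*} [NormedAddCommGroup E] [MeasurableSpace E] (C ρ : ℝ)
    (F : ℕ → (ℕ → Z) → E) : Prop where
  measurable : ∀ k, Measurable (F k)
  bound : ∀ k z, ‖F k z‖ ≤ C
  depends : ∀ k, DependsOn (F k) (Set.Iic (k + 1))
  forget : ∀ j k z, ‖F (j + k) z - F k (shift j z)‖ ≤ C * ρ ^ k

variable {P : Measure Ω} [IsProbabilityMeasure P] {μ : Measure Z} [SFinite μ] {q : Z → Z → ℝ}
  {W : ℕ → Ω → Z} {ρ C : ℝ} {F : ℕ → (ℕ → Z) → ℝ}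

lemma IsMixingSeq.abs_mean_sub_shift_le (hW : IsMixingSeq P μ q W ρ)
    (hF : IsForgetting C ρ F) (j k : ℕ) :
    |∫ ω, F (j + k) (fun i => W i ω) ∂P - ∫ ω, F k (shift j fun i => W i ω) ∂P| ≤ C * ρ ^ k := by
  rw [← integral_sub (hW.markov.integrable (hF.measurable _) (hF.bound _))
    (hW.markov.integrable (f := fun z => F k (shift j z))
      ((hF.measurable k).comp (measurable_shift j)) (fun _ => hF.bound _ _))]
  have h := norm_integral_le_of_norm_le_const (μ := P)
    (f := fun ω => F (j + k) (fun i => W i ω) - F k (shift j fun i => W i ω))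
    (ae_of_all _ fun ω => hF.forget j k _)
  simpa using h

/-- Asymptotic stationarity of the means. -/
lemma IsMixingSeq.abs_mean_sub_le (hW : IsMixingSeq P μ q W ρ)
    (hF : IsForgetting C ρ F) {n k : ℕ} (hn : k + k ≤ n) :
    |∫ ω, F n (fun i => W i ω) ∂P - ∫ ω, F (k + k) (fun i => W i ω) ∂P| ≤ 4 * C * ρ ^ k := by
  -- Write `n = j + k + k`. Both functionals are replaced by `F k` of the shifted path, at cost `C ρ
  -- ^ k` each; changing the shift from `j + k` to `k` costs `2 C ρ ^ k` by mixing.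
  obtain ⟨j, rfl⟩ := Nat.exists_eq_add_of_le' hn
  rw [← add_assoc]
  obtain ⟨c, hc, hcq, hcδ⟩ := hW.minor
  have h1 := hW.abs_mean_sub_shift_le hF (j + k) k
  have h2 := hW.abs_mean_sub_shift_le hF k k
  have h3 := hW.markov.integral_shift_sub_le hW.trans hc hcq hcδ (hF.measurable k) (hF.bound k)
    (hF.depends k) k j
  rw [sub_sub_cancel] at h3
  rw [abs_le] at *
  constructor <;> linarith [h1.1, h1.2, h2.1, h2.2, h3.1, h3.2]

lemma IsForgetting.const_nonneg {E : Type*} [NormedAddCommGroup E] [MeasurableSpace E]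
    {F : ℕ → (ℕ → Z) → E} (hF : IsForgetting C ρ F) [Nonempty Z] : 0 ≤ C :=
  (norm_nonneg _).trans (hF.bound 0 fun _ => Classical.arbitrary Z)

lemma IsMixingSeq.nonempty (_ : IsMixingSeq P μ q W ρ) : Nonempty Z :=
  (nonempty_of_isProbabilityMeasure P).map (W 0)

/-- The later functional is replaced by `F k` of the path shifted by `s + 1 + j`, at cost `C ^ 2 ρ ^
k` in the product and again in the product of means. As `F s` depends on coordinates up to `s + 1`
only, a gap `j` remains, and mixing over it gives `2 C ^ 2 ρ ^ j`. -/
lemma IsMixingSeq.abs_cov_le (hW : IsMixingSeq P μ q W ρ)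
    (hF : IsForgetting C ρ F) (s j k : ℕ) :
    |∫ ω, F s (fun i => W i ω) * F (s + 1 + j + k) (fun i => W i ω) ∂P -
      (∫ ω, F s (fun i => W i ω) ∂P) * ∫ ω, F (s + 1 + j + k) (fun i => W i ω) ∂P| ≤
      2 * C ^ 2 * (ρ ^ j + ρ ^ k) := by
  have := hW.nonempty
  have hC := hF.const_nonneg
  obtain ⟨c, hc, hcq, hcδ⟩ := hW.minor
  have h1 := hW.markov.cov_le hW.trans hc hcq hcδ (hF.measurable k) (hF.bound k)
    (hF.depends k) (hF.measurable s) (hF.bound s) (hF.depends s) j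
  have h2 := hW.abs_mean_sub_shift_le hF (s + 1 + j) k
  have hs : |∫ ω, F s (fun i => W i ω) ∂P| ≤ C := by
    have h := norm_integral_le_of_norm_le_const (μ := P) (f := fun ω => F s (fun i => W i ω))
      (ae_of_all _ fun ω => hF.bound s _)
    simpa using h
  have hsh : Measurable fun z : ℕ → Z => F k (shift (s + 1 + j) z) :=
    (hF.measurable k).comp (measurable_shift _)
  have h3 : |∫ ω, F s (fun i => W i ω) * F (s + 1 + j + k) (fun i => W i ω) ∂P -
      ∫ ω, F s (fun i => W i ω) * F k (shift (s + 1 + j) fun i => W i ω) ∂P| ≤ C * (C * ρ ^ k) := by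
    rw [← integral_sub
      (hW.markov.integrable (f := fun z => F s z * F (s + 1 + j + k) z) (C := C * C)
        ((hF.measurable s).mul (hF.measurable _)) (fun z => by
          rw [abs_mul]
          exact mul_le_mul (hF.bound _ _) (hF.bound _ _) (abs_nonneg _) hC))
      (hW.markov.integrable (f := fun z => F s z * F k (shift (s + 1 + j) z)) (C := C * C)
        ((hF.measurable s).mul hsh) (fun z => by
          rw [abs_mul]
          exact mul_le_mul (hF.bound _ _) (hF.bound _ _) (abs_nonneg _) hC))]
    have h := norm_integral_le_of_norm_le_const (μ := P) (C := C * (C * ρ ^ k))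
      (f := fun ω => F s (fun i => W i ω) * F (s + 1 + j + k) (fun i => W i ω) -
        F s (fun i => W i ω) * F k (shift (s + 1 + j) fun i => W i ω))
      (ae_of_all _ fun ω => by
        rw [← mul_sub, norm_mul]
        exact mul_le_mul (hF.bound _ _) (hF.forget _ _ _) (norm_nonneg _) hC)
    simpa using h
  have h4 : |(∫ ω, F s (fun i => W i ω) ∂P) * ∫ ω, F (s + 1 + j + k) (fun i => W i ω) ∂P -
      (∫ ω, F s (fun i => W i ω) ∂P) * ∫ ω, F k (shift (s + 1 + j) fun i => W i ω) ∂P| ≤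
      C * (C * ρ ^ k) := by
    rw [← mul_sub, abs_mul]
    exact mul_le_mul hs h2 (abs_nonneg _) hC
  rw [sub_sub_cancel] at h1
  rw [abs_le] at h1 h3 h4 ⊢
  constructor <;> nlinarith [h1.1, h1.2, h3.1, h3.2, h4.1, h4.2]

/-- Each exponent occurs at most twice, so the sum is at most two geometric series. -/
lemma sum_pow_half_le (h0 : 0 < ρ) (h1 : ρ < 1) (t : ℕ) :
    ∑ m ∈ Finset.range t, ρ ^ (m / 2) ≤ 2 * (1 - ρ)⁻¹ := by
  have h : ∀ t : ℕ, ∑ m ∈ Finset.range (2 * t), ρ ^ (m / 2) =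
      2 * ∑ i ∈ Finset.range t, ρ ^ i := by
    intro t
    induction t with
    | zero => simp
    | succ t ih =>
      rw [show 2 * (t + 1) = 2 * t + 1 + 1 by ring, Finset.sum_range_succ, Finset.sum_range_succ,
        ih, Finset.sum_range_succ]
      have e1 : (2 * t + 1) / 2 = t := by omega
      have e2 : 2 * t / 2 = t := by omega
      rw [e1, e2]
      ring
  calc ∑ m ∈ Finset.range t, ρ ^ (m / 2) ≤ ∑ m ∈ Finset.range (2 * t), ρ ^ (m / 2) :=
        Finset.sum_le_sum_of_subset_of_nonneg (Finset.range_mono (by omega))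
          fun _ _ _ => by positivity
    _ ≤ 2 * (1 - ρ)⁻¹ := by
        rw [h, ← tsum_geometric_of_lt_one h0.le h1]
        have := (summable_geometric_of_lt_one h0.le h1).sum_le_tsum (Finset.range t)
          fun _ _ => by positivity
        linarith

/-- The variance of the sums grows at most linearly. -/
lemma IsMixingSeq.integral_sq_sum_le (hW : IsMixingSeq P μ q W ρ)
    (hF : IsForgetting C ρ F) (t : ℕ) :
    ∫ ω, (∑ s ∈ Finset.range t, (F s (fun i => W i ω) - ∫ ω', F s (fun i => W i ω') ∂P)) ^ 2 ∂P ≤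
      (4 * C ^ 2 + 16 * C ^ 2 * (1 - ρ)⁻¹) * t := by
  have := hW.nonempty
  have hC := hF.const_nonneg
  have hρ := hW.pos
  set a : ℕ → ℝ := fun s => ∫ ω', F s (fun i => W i ω') ∂P with ha
  have haC : ∀ s, |a s| ≤ C := by
    intro s
    have h := norm_integral_le_of_norm_le_const (μ := P) (f := fun ω => F s (fun i => W i ω))
      (ae_of_all _ fun ω => hF.bound s _)
    simpa using h
  set Y : ℕ → Ω → ℝ := fun s ω => F s (fun i => W i ω) - a s with hY
  have hYm : ∀ s, Measurable (Y s) := fun s =>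
    ((hF.measurable s).comp hW.markov.measurable_path).sub_const _
  have hYb : ∀ s ω, ‖Y s ω‖ ≤ 2 * C := by
    intro s ω
    have := norm_sub_le (F s (fun i => W i ω)) (a s)
    have h2 := hF.bound s (fun i => W i ω)
    have h3 := haC s
    rw [← Real.norm_eq_abs] at h3
    linarith
  have hYi : ∀ s, Integrable (Y s) P := fun s =>
    Integrable.of_bound (hYm s).aestronglyMeasurable _ (ae_of_all _ (hYb s))
  have hYYi : ∀ s t, Integrable (fun ω => Y s ω * Y t ω) P := fun s t =>
    (hYi s).mul_bdd (c := 2 * C) (hYm t).aestronglyMeasurable (ae_of_all _ (hYb t))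
  -- The lag is split in two halves, one spent on mixing of the chain and the other on forgetting of
  -- the functional; hence the exponent is half the lag.
  have hcov : ∀ s t, s < t → ∫ ω, Y s ω * Y t ω ∂P ≤ 4 * C ^ 2 * ρ ^ ((t - 1 - s) / 2) := by
    intro s t hst
    obtain ⟨d, rfl⟩ := Nat.exists_eq_add_of_lt hst
    have hd : s + d + 1 - 1 - s = d := by omega
    have hsplit : s + d + 1 = s + 1 + (d - d / 2) + d / 2 := by omega
    have h1 := hW.abs_cov_le hF s (d - d / 2) (d / 2)
    rw [← hsplit] at h1
    have hFi : ∀ s, Integrable (fun ω => F s (fun i => W i ω)) P := fun s =>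
      hW.markov.integrable (hF.measurable _) (hF.bound _)
    have hFF : ∀ s t, Integrable (fun ω => F s (fun i => W i ω) * F t (fun i => W i ω)) P :=
      fun s t => (hFi s).mul_bdd (c := C)
        ((hF.measurable t).comp hW.markov.measurable_path).aestronglyMeasurable
        (ae_of_all _ fun _ => hF.bound t _)
    have h2 : ∫ ω, Y s ω * Y (s + d + 1) ω ∂P =
        ∫ ω, F s (fun i => W i ω) * F (s + d + 1) (fun i => W i ω) ∂P - a s * a (s + d + 1) := by
      have : ∀ ω, Y s ω * Y (s + d + 1) ω =
          (F s (fun i => W i ω) * F (s + d + 1) (fun i => W i ω) -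
            a (s + d + 1) * F s (fun i => W i ω)) - a s * Y (s + d + 1) ω := by
        intro ω; simp only [hY]; ring
      simp_rw [this]
      rw [integral_sub ((hFF _ _).sub' ((hFi s).const_mul _)) ((hYi _).const_mul _),
        integral_sub (hFF _ _) ((hFi s).const_mul _), integral_const_mul, integral_const_mul]
      have h0 : ∫ ω, Y (s + d + 1) ω ∂P = 0 := by
        simp only [hY]
        rw [integral_sub (hFi _) (integrable_const _)]
        simp [ha]
      rw [h0]
      change _ - a (s + d + 1) * a s - _ = _
      ring
    rw [h2, hd]
    refine (le_abs_self _).trans (h1.trans ?_)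
    have h3 : ρ ^ (d - d / 2) ≤ ρ ^ (d / 2) :=
      pow_le_pow_of_le_one hρ.le hW.lt_one.le (by omega)
    have : 0 ≤ C ^ 2 := by positivity
    nlinarith
  have hSi : ∀ t, Integrable (fun ω => (∑ s ∈ Finset.range t, Y s ω) ^ 2) P := by
    intro t
    simp_rw [sq, Finset.sum_mul_sum]
    exact integrable_finsetSum _ fun s _ => integrable_finsetSum _ fun s' _ => hYYi s s'
  change ∫ ω, (∑ s ∈ Finset.range t, Y s ω) ^ 2 ∂P ≤ _
  induction t with
  | zero => simp
  | succ t ih =>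
    have e : ∀ ω, (∑ s ∈ Finset.range (t + 1), Y s ω) ^ 2 =
        (∑ s ∈ Finset.range t, Y s ω) ^ 2 + 2 * (∑ s ∈ Finset.range t, Y s ω * Y t ω) +
          Y t ω * Y t ω := by
      intro ω
      rw [Finset.sum_range_succ, ← Finset.sum_mul]
      ring
    simp_rw [e]
    have hi2 : Integrable (fun ω => ∑ s ∈ Finset.range t, Y s ω * Y t ω) P :=
      integrable_finsetSum _ fun s _ => hYYi s t
    rw [integral_add ((hSi t).fun_add (hi2.const_mul 2)) (hYYi t t),
      integral_add (hSi t) (hi2.const_mul 2), integral_const_mul,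
      integral_finsetSum _ fun s _ => hYYi s t]
    have h1 : ∑ s ∈ Finset.range t, ∫ ω, Y s ω * Y t ω ∂P ≤ 4 * C ^ 2 * (2 * (1 - ρ)⁻¹) := by
      refine (Finset.sum_le_sum fun s hs => hcov s t (Finset.mem_range.1 hs)).trans ?_
      rw [← Finset.mul_sum, Finset.sum_range_reflect (fun m => ρ ^ (m / 2)) t]
      exact mul_le_mul_of_nonneg_left (sum_pow_half_le hρ hW.lt_one t) (by positivity)
    have h2 : ∫ ω, Y t ω * Y t ω ∂P ≤ 4 * C ^ 2 := by
      have h := norm_integral_le_of_norm_le_const (μ := P) (f := fun ω => Y t ω * Y t ω)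
        (C := 2 * C * (2 * C))
        (ae_of_all _ fun ω => by
          rw [norm_mul]
          exact mul_le_mul (hYb _ _) (hYb _ _) (norm_nonneg _) (by positivity))
      simp only [probReal_univ, mul_one] at h
      have := (le_abs_self _).trans h
      linarith
    push_cast
    linarith

/-- Strong law along geometric subsequences. -/
lemma IsMixingSeq.ae_tendsto_floor_pow (hW : IsMixingSeq P μ q W ρ)
    (hF : IsForgetting C ρ F) {b : ℝ} (hb : 1 < b) :
    ∀ᵐ ω ∂P, Tendsto (fun n : ℕ => (∑ s ∈ Finset.range ⌊b ^ n⌋₊,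
      (F s (fun i => W i ω) - ∫ ω', F s (fun i => W i ω') ∂P)) / (⌊b ^ n⌋₊ : ℝ)) atTop (𝓝 0) := by
  set K := 4 * C ^ 2 + 16 * C ^ 2 * (1 - ρ)⁻¹ with hK
  have hK0 : 0 ≤ K := by
    have := inv_nonneg.2 (sub_nonneg.2 hW.lt_one.le)
    positivity
  set S : ℕ → Ω → ℝ := fun n ω => (∑ s ∈ Finset.range n,
      (F s (fun i => W i ω) - ∫ ω', F s (fun i => W i ω') ∂P)) with hS
  have hSm : ∀ n, Measurable (S n) := fun n => by
    refine Finset.measurable_sum _ fun s _ => ?_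
    exact ((hF.measurable s).comp hW.markov.measurable_path).sub_const _
  have hfl : ∀ n : ℕ, b ^ n / 2 ≤ (⌊b ^ n⌋₊ : ℝ) := by
    intro n
    have h1 : 1 ≤ b ^ n := one_le_pow₀ hb.le
    have h2 := Nat.lt_floor_add_one (b ^ n)
    have h3 : (1 : ℝ) ≤ (⌊b ^ n⌋₊ : ℝ) := by
      exact_mod_cast Nat.one_le_floor_iff _ |>.2 h1
    linarith
  have hb0 : (0 : ℝ) < b := by linarith
  -- The variance bound gives a second moment at most `K / N` for the average over `N = ⌊b ^ n⌋₊`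
  -- terms, and `N ≥ b ^ n / 2` makes this geometric in `n`.
  have hle : ∀ n : ℕ, ∫⁻ ω, ENNReal.ofReal ((S ⌊b ^ n⌋₊ ω / (⌊b ^ n⌋₊ : ℝ)) ^ 2) ∂P ≤
      ENNReal.ofReal (2 * K * (b⁻¹) ^ n) := by
    intro n
    have hpos : 0 < (⌊b ^ n⌋₊ : ℝ) := lt_of_lt_of_le (by positivity) (hfl n)
    have hbd : ∃ D, ∀ ω, |S ⌊b ^ n⌋₊ ω| ≤ D := by
      refine ⟨∑ s ∈ Finset.range ⌊b ^ n⌋₊, (C + |∫ ω', F s (fun i => W i ω') ∂P|), fun ω => ?_⟩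
      refine (Finset.abs_sum_le_sum_abs _ _).trans (Finset.sum_le_sum fun s _ => ?_)
      refine (abs_sub _ _).trans ?_
      have := hF.bound s fun i => W i ω
      rw [Real.norm_eq_abs] at this
      linarith
    obtain ⟨D, hD⟩ := hbd
    have hi : Integrable (fun ω => (S ⌊b ^ n⌋₊ ω / (⌊b ^ n⌋₊ : ℝ)) ^ 2) P := by
      refine Integrable.of_bound (C := (D / (⌊b ^ n⌋₊ : ℝ)) ^ 2)
        (((hSm _).div_const _).pow_const 2).aestronglyMeasurable (ae_of_all _ fun ω => ?_)
      rw [Real.norm_eq_abs, abs_pow, abs_div, abs_of_pos hpos]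
      have := hD ω
      gcongr
    rw [← ofReal_integral_eq_lintegral_ofReal hi (ae_of_all _ fun ω => sq_nonneg _)]
    refine ENNReal.ofReal_le_ofReal ?_
    simp_rw [div_pow]
    rw [integral_div]
    have h1 := hW.integral_sq_sum_le hF ⌊b ^ n⌋₊
    rw [← hK] at h1
    rw [div_le_iff₀ (by positivity)]
    refine h1.trans ?_
    have h2 := hfl n
    have h3 : (b⁻¹) ^ n * b ^ n = 1 := by rw [← mul_pow, inv_mul_cancel₀ hb0.ne', one_pow]
    have h4 : 1 ≤ 2 * (b⁻¹) ^ n * (⌊b ^ n⌋₊ : ℝ) := by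
      have : 0 ≤ (b⁻¹) ^ n := by positivity
      nlinarith
    nlinarith [mul_le_mul_of_nonneg_left h4 (mul_nonneg hK0 hpos.le)]
  -- The series of squared averages has finite expectation, so it converges almost surely and its
  -- terms tend to zero.
  have hsum : ∫⁻ ω, ∑' n : ℕ, ENNReal.ofReal ((S ⌊b ^ n⌋₊ ω / (⌊b ^ n⌋₊ : ℝ)) ^ 2) ∂P ≠ ⊤ := by
    rw [lintegral_tsum fun n =>
      (((hSm _).div_const _).pow_const 2).ennreal_ofReal.aemeasurable]
    refine ne_top_of_le_ne_top ?_ (ENNReal.tsum_le_tsum hle)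
    have hbi : b⁻¹ < 1 := inv_lt_one_of_one_lt₀ hb
    have : Summable fun n : ℕ => 2 * K * (b⁻¹) ^ n :=
      (summable_geometric_of_lt_one (by positivity) hbi).mul_left _
    exact this.tsum_ofReal_ne_top
  have hae := ae_lt_top' (AEMeasurable.tsum fun n =>
    (((hSm _).div_const _).pow_const 2).ennreal_ofReal.aemeasurable) hsum
  filter_upwards [hae] with ω hω
  have h1 := ENNReal.tendsto_atTop_zero_of_tsum_ne_top hω.ne
  have h2 := (ENNReal.tendsto_toReal ENNReal.zero_ne_top).comp h1
  have h3 : Tendsto (fun n : ℕ => (S ⌊b ^ n⌋₊ ω / (⌊b ^ n⌋₊ : ℝ)) ^ 2) atTop (𝓝 0) := by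
    refine Tendsto.congr (fun n => ?_) h2
    simp only [Function.comp]
    exact ENNReal.toReal_ofReal (sq_nonneg _)
  rw [tendsto_zero_iff_abs_tendsto_zero]
  have h4 := h3.sqrt
  simpa only [Real.sqrt_sq_eq_abs, Function.comp_def, Real.sqrt_zero] using h4

/-- Strong law of large numbers for forgetting functionals of a mixing process. -/
theorem IsMixingSeq.ae_tendsto_timeAverage (hW : IsMixingSeq P μ q W ρ)
    (hF : IsForgetting C ρ F) {l : ℝ}
    (hl : Tendsto (fun s => ∫ ω, F s (fun i => W i ω) ∂P) atTop (𝓝 l)) :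
    ∀ᵐ ω ∂P, Tendsto (timeAverage fun s => F s (fun i => W i ω)) atTop (𝓝 l) := by
  -- Countably many ratios `1 + 1 / (k + 1)`, tending to `1`, share one exceptional null set.
  have hall : ∀ᵐ ω ∂P, ∀ k : ℕ, Tendsto (fun n : ℕ =>
      (∑ s ∈ Finset.range ⌊(1 + 1 / ((k : ℝ) + 1)) ^ n⌋₊,
        (F s (fun i => W i ω) - ∫ ω', F s (fun i => W i ω') ∂P)) /
          (⌊(1 + 1 / ((k : ℝ) + 1)) ^ n⌋₊ : ℝ)) atTop (𝓝 0) := by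
    rw [ae_all_iff]
    intro k
    exact hW.ae_tendsto_floor_pow hF (by
      have : (0 : ℝ) < 1 / ((k : ℝ) + 1) := by positivity
      linarith)
  have hces := hl.cesaro_smul
  filter_upwards [hall] with ω hω
  -- Adding the bound `C` makes the summands nonnegative and the partial sums monotone, which allows
  -- interpolation between the geometric subsequences. The shift is removed from the limit
  -- afterwards.
  have main := tendsto_div_of_monotone_of_tendsto_div_floor_pow
    (fun n => ∑ s ∈ Finset.range n, (F s (fun i => W i ω) + C)) (l + C)
    (monotone_nat_of_le_succ fun n => by
      rw [Finset.sum_range_succ]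
      have := (abs_le.1 (hF.bound n fun i => W i ω)).1
      linarith) (fun k => 1 + 1 / ((k : ℝ) + 1))
    (fun k => by
      have : (0 : ℝ) < 1 / ((k : ℝ) + 1) := by positivity
      linarith)
    (by simpa using (tendsto_one_div_add_atTop_nhds_zero_nat (𝕜 := ℝ)).const_add 1)
    (fun k => by
      set b := 1 + 1 / ((k : ℝ) + 1) with hbdef
      have hb : 1 < b := by
        have : (0 : ℝ) < 1 / ((k : ℝ) + 1) := by positivity
        linarith
      have hfl : Tendsto (fun n : ℕ => ⌊b ^ n⌋₊) atTop atTop :=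
        tendsto_nat_floor_atTop.comp (tendsto_pow_atTop_atTop_of_one_lt hb)
      have h2 := ((hω k).add (hces.comp hfl)).add_const C
      rw [zero_add, ← hbdef] at h2
      refine h2.congr' ?_
      filter_upwards [hfl.eventually_gt_atTop 0] with n hn
      have : (⌊b ^ n⌋₊ : ℝ) ≠ 0 := by exact_mod_cast hn.ne'
      simp only [Function.comp, smul_eq_mul, Finset.sum_add_distrib, Finset.sum_sub_distrib,
        Finset.sum_const, Finset.card_range, nsmul_eq_mul]
      field_simp
      ring)
  have h3 := main.sub_const C
  rw [add_sub_cancel_right] at h3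
  refine h3.congr' ?_
  filter_upwards [eventually_gt_atTop 0] with n hn
  have : (n : ℝ) ≠ 0 := by exact_mod_cast hn.ne'
  simp only [timeAverage, smul_eq_mul, Finset.sum_add_distrib,
        Finset.sum_const, Finset.card_range, nsmul_eq_mul]
  field_simp
  ring

end LawOfLargeNumbers

/-! ### Calculus rules for gradients. -/

section GradientCalculus

variable {E : Type*} [NormedAddCommGroup E] [InnerProductSpace ℝ E] [CompleteSpace E]
  {f f₁ f₂ : E → ℝ} {f' f₁' f₂' θ : E}

lemma hasGradientAt_of_hasFDerivAt {L : E →L[ℝ] ℝ} (h : HasFDerivAt f L θ)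
    (hL : ∀ v, L v = inner ℝ f' v) : HasGradientAt f f' θ := by
  have : InnerProductSpace.toDual ℝ E f' = L :=
    ContinuousLinearMap.ext fun v => by rw [hL, InnerProductSpace.toDual_apply_apply]
  rw [hasGradientAt_iff_hasFDerivAt, this]
  exact h

lemma hasGradientAt_comp {h : ℝ → ℝ} {h' : ℝ} (hh : HasDerivAt h h' (f θ))
    (hf : HasGradientAt f f' θ) : HasGradientAt (fun x => h (f x)) (h' • f') θ :=
  hasGradientAt_of_hasFDerivAt (hh.comp_hasFDerivAt θ hf.hasFDerivAt) fun v => by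
    simp [inner_smul_left]

lemma hasGradientAt_mul (h₁ : HasGradientAt f₁ f₁' θ) (h₂ : HasGradientAt f₂ f₂' θ) :
    HasGradientAt (fun x => f₁ x * f₂ x) (f₁ θ • f₂' + f₂ θ • f₁') θ :=
  hasGradientAt_of_hasFDerivAt (h₁.hasFDerivAt.mul h₂.hasFDerivAt) fun v => by
    simp [inner_smul_left, inner_add_left]

lemma hasGradientAt_log (h : HasGradientAt f f' θ) (h0 : f θ ≠ 0) :
    HasGradientAt (fun x => Real.log (f x)) ((f θ)⁻¹ • f') θ :=
  hasGradientAt_comp (Real.hasDerivAt_log h0) h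

lemma hasGradientAt_div (h₁ : HasGradientAt f₁ f₁' θ) (h₂ : HasGradientAt f₂ f₂' θ)
    (h0 : f₂ θ ≠ 0) :
    HasGradientAt (fun x => f₁ x / f₂ x)
      ((f₂ θ)⁻¹ • f₁' - (f₁ θ * ((f₂ θ) ^ 2)⁻¹) • f₂') θ := by
  have := hasGradientAt_mul h₁ (hasGradientAt_comp (hasDerivAt_inv h0) h₂)
  simp only [div_eq_mul_inv]
  convert this using 1
  module

lemma hasGradientAt_const_mul (c : ℝ) (h : HasGradientAt f f' θ) :
    HasGradientAt (fun x => c * f x) (c • f') θ := by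
  simpa using hasGradientAt_mul (hasGradientAt_const θ c) h

lemma hasGradientAt_sum {ι : Type*} {s : Finset ι} {F : ι → E → ℝ} {F' : ι → E}
    (h : ∀ i ∈ s, HasGradientAt (F i) (F' i) θ) :
    HasGradientAt (fun x => ∑ i ∈ s, F i x) (∑ i ∈ s, F' i) θ := by
  refine hasGradientAt_of_hasFDerivAt (HasFDerivAt.fun_sum fun i hi => (h i hi).hasFDerivAt)
    fun v => ?_
  simp [sum_inner]

lemma hasGradientAt_prod {ι : Type*} [DecidableEq ι] {s : Finset ι} {F : ι → E → ℝ} {F' : ι → E}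
    (h : ∀ i ∈ s, HasGradientAt (F i) (F' i) θ) :
    HasGradientAt (fun x => ∏ i ∈ s, F i x) (∑ i ∈ s, (∏ j ∈ s.erase i, F j θ) • F' i) θ := by
  refine hasGradientAt_of_hasFDerivAt (HasFDerivAt.finsetProd fun i hi => (h i hi).hasFDerivAt)
    fun v => ?_
  simp [sum_inner, inner_smul_left]

/-- Differentiation under the integral sign. -/
lemma hasGradientAt_integral {A : Type*} [MeasurableSpace A] {μ : Measure A} {Θ : Set E}
    (hΘ : IsOpen Θ) (hθ : θ ∈ Θ) {F : E → A → ℝ} {G : E → A → E} {bound : A → ℝ}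
    (hF : ∀ θ' ∈ Θ, AEStronglyMeasurable (F θ') μ) (hFi : Integrable (F θ) μ)
    (hG : AEStronglyMeasurable (G θ) μ) (hb : ∀ θ' ∈ Θ, ∀ a, ‖G θ' a‖ ≤ bound a)
    (hbi : Integrable bound μ)
    (hd : ∀ θ' ∈ Θ, ∀ a, HasGradientAt (fun x => F x a) (G θ' a) θ') :
    HasGradientAt (fun x => ∫ a, F x a ∂μ) (∫ a, G θ a ∂μ) θ := by
  have hGi : Integrable (G θ) μ := hbi.mono' hG (ae_of_all _ (hb θ hθ))
  have hm : AEStronglyMeasurable (fun a => InnerProductSpace.toDual ℝ E (G θ a)) μ :=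
    (InnerProductSpace.toDual ℝ E).continuous.comp_aestronglyMeasurable hG
  have h := hasFDerivAt_integral_of_dominated_of_fderiv_le (hΘ.mem_nhds hθ)
    (F' := fun x a => InnerProductSpace.toDual ℝ E (G x a)) (bound := bound)
    (eventually_of_mem (hΘ.mem_nhds hθ) hF) hFi hm
    (ae_of_all _ fun a x hx => by simpa using hb x hx a) hbi
    (ae_of_all _ fun a x hx => (hd x hx a).hasFDerivAt)
  refine hasGradientAt_of_hasFDerivAt h fun v => ?_
  rw [ContinuousLinearMap.integral_apply (hbi.mono' hm (ae_of_all _ fun a => by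
    simpa using hb θ hθ a))]
  simp only [InnerProductSpace.toDual_apply_apply]
  rw [real_inner_comm, ← integral_inner hGi v]
  simp_rw [real_inner_comm]

end GradientCalculus

/-! ### Measurability of gradients. -/

section Euclidean

variable {p : ℕ} {Θ : Set (EuclideanSpace ℝ (Fin p))} {θ : EuclideanSpace ℝ (Fin p)}

lemma euclidean_eq_sum (v : EuclideanSpace ℝ (Fin p)) :
    v = ∑ i, inner ℝ (EuclideanSpace.basisFun (Fin p) ℝ i) v •
      EuclideanSpace.basisFun (Fin p) ℝ i :=
  ((EuclideanSpace.basisFun (Fin p) ℝ).sum_repr' v).symm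

/-- Gradients of measurable functions are measurable. -/
lemma measurable_of_hasGradientAt {A : Type*} [MeasurableSpace A] (hΘ : IsOpen Θ) (hθ : θ ∈ Θ)
    {F : EuclideanSpace ℝ (Fin p) → A → ℝ} {G : A → EuclideanSpace ℝ (Fin p)}
    (hF : ∀ θ' ∈ Θ, Measurable (F θ')) (hd : ∀ a, HasGradientAt (fun x => F x a) (G a) θ) :
    Measurable G := by
  classical
  have hcoord : ∀ v, Measurable fun a => inner ℝ v (G a) := by
    intro v
    have hc : Tendsto (fun n : ℕ => ‖((n : ℝ) + 1)‖) atTop atTop :=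
      tendsto_norm_atTop_atTop.comp (tendsto_atTop_add_const_right _ _ tendsto_natCast_atTop_atTop)
    have hθn : Tendsto (fun n : ℕ => θ + ((n : ℝ) + 1)⁻¹ • v) atTop (𝓝 θ) := by
      have h1 : Tendsto (fun n : ℕ => ((n : ℝ) + 1)⁻¹) atTop (𝓝 0) := by
        simpa using tendsto_one_div_add_atTop_nhds_zero_nat (𝕜 := ℝ)
      simpa using (h1.smul_const v).const_add θ
    have hev := hθn.eventually (hΘ.mem_nhds hθ)
    -- Each coordinate is a limit of difference quotients. Measurability of `F` is known on `Θ`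
    -- only, so the quotient is set to `0` when the increment leaves `Θ`; since `Θ` is open this
    -- concerns finitely many `n`.
    refine measurable_of_tendsto_metrizable (f := fun (n : ℕ) a =>
      if θ + ((n : ℝ) + 1)⁻¹ • v ∈ Θ then
        ((n : ℝ) + 1) • (F (θ + ((n : ℝ) + 1)⁻¹ • v) a - F θ a) else 0) (fun n => ?_) ?_
    · by_cases hn : θ + ((n : ℝ) + 1)⁻¹ • v ∈ Θ
      · simp only [hn, if_true]
        exact ((hF _ hn).sub (hF _ hθ)).const_mul ((n : ℝ) + 1)
      · simp only [hn, if_false]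
        exact measurable_const
    · rw [tendsto_pi_nhds]
      intro a
      have h := (hd a).hasFDerivAt.lim v hc
      simp only [InnerProductSpace.toDual_apply_apply] at h
      rw [real_inner_comm]
      refine h.congr' ?_
      filter_upwards [hev] with n hn
      have hn' : θ + ((n : ℝ) + 1)⁻¹ • v ∈ Θ := hn
      simp only [hn', if_true]
  have : G = fun a => ∑ i, inner ℝ (EuclideanSpace.basisFun (Fin p) ℝ i) (G a) •
      EuclideanSpace.basisFun (Fin p) ℝ i := by
    funext a
    exact euclidean_eq_sum _
  rw [this]
  exact Finset.measurable_sum _ fun i _ => (hcoord _).smul_const _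

end Euclidean

/-! ### Existence and differentiability of the limit of the means. -/

section Contrast

variable {p : ℕ} {Z Ω : Type*} [MeasurableSpace Z] [MeasurableSpace Ω]
  {P : Measure Ω} [IsProbabilityMeasure P] {μ : Measure Z} [SFinite μ] {q : Z → Z → ℝ}
  {W : ℕ → Ω → Z} {ρ C : ℝ}

lemma IsForgetting.inner {F : ℕ → (ℕ → Z) → EuclideanSpace ℝ (Fin p)} (hF : IsForgetting C ρ F)
    {e : EuclideanSpace ℝ (Fin p)} (he : ‖e‖ ≤ 1) :
    IsForgetting C ρ fun k z => inner ℝ e (F k z) where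
  measurable k := (hF.measurable k).const_inner
  bound k z := by
    refine (norm_inner_le_norm _ _).trans ?_
    have := hF.bound k z
    nlinarith [norm_nonneg e, norm_nonneg (F k z)]
  depends k z z' h := by simp only [hF.depends k h]
  forget j k z := by
    rw [← inner_sub_right]
    refine (norm_inner_le_norm _ _).trans ?_
    have := hF.forget j k z
    nlinarith [norm_nonneg e, norm_nonneg (F (j + k) z - F k (shift j z))]

lemma IsForgetting.integrable {E : Type*} [NormedAddCommGroup E] [MeasurableSpace E]
    [BorelSpace E] [SecondCountableTopology E]
    {F : ℕ → (ℕ → Z) → E} (hF : IsForgetting C ρ F) (hW : IsMixingSeq P μ q W ρ) (k : ℕ) :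
    Integrable (fun ω => F k fun i => W i ω) P :=
  Integrable.of_bound ((hF.measurable k).comp hW.markov.measurable_path).aestronglyMeasurable C
    (ae_of_all _ fun _ => hF.bound _ _)

/-- The scalar bound is applied to the inner product with the unit vector along the difference of
the means, so no factor depending on the dimension is lost. -/
lemma IsMixingSeq.norm_mean_sub_le (hW : IsMixingSeq P μ q W ρ)
    {F : ℕ → (ℕ → Z) → EuclideanSpace ℝ (Fin p)} (hF : IsForgetting C ρ F)
    {n k : ℕ} (hn : k + k ≤ n) :
    ‖∫ ω, F n (fun i => W i ω) ∂P - ∫ ω, F (k + k) (fun i => W i ω) ∂P‖ ≤ 4 * C * ρ ^ k := by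
  have := hW.nonempty
  have hC := hF.const_nonneg
  have hρ := hW.pos
  set w := ∫ ω, F n (fun i => W i ω) ∂P - ∫ ω, F (k + k) (fun i => W i ω) ∂P with hw
  rcases eq_or_ne w 0 with h0 | h0
  · rw [h0, norm_zero]; positivity
  have hn0 : ‖w‖ ≠ 0 := norm_ne_zero_iff.2 h0
  set e := ‖w‖⁻¹ • w with he
  have he1 : ‖e‖ ≤ 1 := by
    rw [he, norm_smul, norm_inv, norm_norm, inv_mul_cancel₀ hn0]
  have h := hW.abs_mean_sub_le (hF.inner he1) hn
  rw [integral_inner (hF.integrable hW n), integral_inner (hF.integrable hW (k + k)),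
    ← inner_sub_right, ← hw, he, inner_smul_left, real_inner_self_eq_norm_sq] at h
  have e2 : ‖w‖⁻¹ * ‖w‖ ^ 2 = ‖w‖ := by field_simp
  simp only [conj_trivial] at h
  rw [e2, abs_of_nonneg (norm_nonneg _)] at h
  exact h

/-- The bound makes the sequence Cauchy. Writing the limit as `limUnder` names it as a function of
the parameter at once. -/
lemma tendsto_of_tail_bound {E : Type*} [NormedAddCommGroup E] [CompleteSpace E] {a : ℕ → E}
    {K ρ : ℝ} (h0 : 0 < ρ) (h1 : ρ < 1)
    (h : ∀ n k, k + k ≤ n → ‖a n - a (k + k)‖ ≤ K * ρ ^ k) :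
    Tendsto a atTop (𝓝 (limUnder atTop a)) := by
  refine CauchySeq.tendsto_limUnder (Metric.cauchySeq_iff'.2 fun ε hε => ?_)
  have ht : Tendsto (fun k : ℕ => K * ρ ^ k) atTop (𝓝 0) := by
    simpa using (tendsto_pow_atTop_nhds_zero_of_lt_one h0.le h1).const_mul K
  obtain ⟨k, hk⟩ := (ht.eventually_lt_const hε).exists
  exact ⟨k + k, fun n hn => by
    rw [dist_eq_norm]
    exact (h n k hn).trans_lt hk⟩

lemma timeAverage_inner (e : EuclideanSpace ℝ (Fin p)) (f : ℕ → EuclideanSpace ℝ (Fin p)) (t : ℕ) :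
    inner ℝ e (timeAverage f t) = timeAverage (fun s => inner ℝ e (f s)) t := by
  simp only [timeAverage, inner_smul_right, inner_sum, smul_eq_mul]

lemma IsMixingSeq.ae_tendsto_timeAverage_euclidean (hW : IsMixingSeq P μ q W ρ)
    {F : ℕ → (ℕ → Z) → EuclideanSpace ℝ (Fin p)} (hF : IsForgetting C ρ F)
    {l : EuclideanSpace ℝ (Fin p)}
    (hl : Tendsto (fun s => ∫ ω, F s (fun i => W i ω) ∂P) atTop (𝓝 l)) :
    ∀ᵐ ω ∂P, Tendsto (timeAverage fun s => F s (fun i => W i ω)) atTop (𝓝 l) := by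
  have hall : ∀ᵐ ω ∂P, ∀ i : Fin p, Tendsto (timeAverage fun s =>
      inner ℝ (EuclideanSpace.basisFun (Fin p) ℝ i) (F s (fun i => W i ω))) atTop
      (𝓝 (inner ℝ (EuclideanSpace.basisFun (Fin p) ℝ i) l)) := by
    rw [ae_all_iff]
    intro i
    refine hW.ae_tendsto_timeAverage
      (hF.inner (e := EuclideanSpace.basisFun (Fin p) ℝ i) (by simp)) ?_
    simp_rw [integral_inner (hF.integrable hW _)]
    exact tendsto_const_nhds.inner hl
  filter_upwards [hall] with ω hω
  rw [euclidean_eq_sum l]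
  refine (tendsto_finsetSum Finset.univ fun i _ => (hω i).smul_const
    (EuclideanSpace.basisFun (Fin p) ℝ i)).congr fun t => ?_
  rw [euclidean_eq_sum (timeAverage _ t)]
  simp_rw [timeAverage_inner]

/-- Existence and differentiability of the contrast function associated with forgetting
functionals of a mixing process. -/
theorem IsMixingSeq.exists_contrast (hW : IsMixingSeq P μ q W ρ)
    {Θ : Set (EuclideanSpace ℝ (Fin p))} (hΘ : IsOpen Θ)
    {F : EuclideanSpace ℝ (Fin p) → ℕ → (ℕ → Z) → ℝ}
    {G : EuclideanSpace ℝ (Fin p) → ℕ → (ℕ → Z) → EuclideanSpace ℝ (Fin p)}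
    (hF : ∀ θ ∈ Θ, IsForgetting C ρ (F θ)) (hG : ∀ θ ∈ Θ, IsForgetting C ρ (G θ))
    (hFG : ∀ θ ∈ Θ, ∀ k z, HasGradientAt (fun x => F x k z) (G θ k z) θ) :
    ∃ l : EuclideanSpace ℝ (Fin p) → ℝ, DifferentiableOn ℝ l Θ ∧ ∀ θ ∈ Θ,
      (∀ᵐ ω ∂P,
        Tendsto (timeAverage fun s => F θ s (fun i => W i ω)) atTop (𝓝 (l θ)) ∧
        Tendsto (timeAverage fun s => G θ s (fun i => W i ω)) atTop (𝓝 (gradient l θ))) ∧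
      MeanAverageTendsto P (fun s ω => F θ s (fun i => W i ω)) (l θ) ∧
      MeanAverageTendsto P (fun s ω => G θ s (fun i => W i ω)) (gradient l θ) := by
  have := hW.nonempty
  set a : EuclideanSpace ℝ (Fin p) → ℕ → ℝ := fun θ k => ∫ ω, F θ k (fun i => W i ω) ∂P with ha
  set d : EuclideanSpace ℝ (Fin p) → ℕ → EuclideanSpace ℝ (Fin p) :=
    fun θ k => ∫ ω, G θ k (fun i => W i ω) ∂P with hd
  have hgrad : ∀ k, ∀ θ ∈ Θ, HasGradientAt (fun x => a x k) (d θ k) θ := by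
    intro k θ hθ
    refine hasGradientAt_integral hΘ hθ (bound := fun _ => C)
      (G := fun x ω => G x k fun i => W i ω)
      (fun θ' hθ' => ((hF θ' hθ').integrable hW k).aestronglyMeasurable)
      ((hF θ hθ).integrable hW k) ((hG θ hθ).integrable hW k).aestronglyMeasurable
      (fun θ' hθ' ω => (hG θ' hθ').bound _ _) (integrable_const _) (fun θ' hθ' ω => hFG θ' hθ' k _)
  have hal : ∀ θ ∈ Θ, Tendsto (a θ) atTop (𝓝 (limUnder atTop (a θ))) := fun θ hθ =>
    tendsto_of_tail_bound hW.pos hW.lt_one fun n k hn => hW.abs_mean_sub_le (hF θ hθ) hn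
  have hdl : ∀ θ ∈ Θ, Tendsto (d θ) atTop (𝓝 (limUnder atTop (d θ))) := fun θ hθ =>
    tendsto_of_tail_bound hW.pos hW.lt_one fun n k hn => hW.norm_mean_sub_le (hG θ hθ) hn
  -- The tail bounds involve only `C` and `ρ`, which are the same for all `θ`, so convergence is
  -- uniform on `Θ`; the constant `8` is the triangle inequality through index `k + k`.
  have hunif : TendstoUniformlyOn
      (fun k θ => InnerProductSpace.toDual ℝ (EuclideanSpace ℝ (Fin p)) (d θ k))
      (fun θ => InnerProductSpace.toDual ℝ _ (limUnder atTop (d θ))) atTop Θ := by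
    rw [Metric.tendstoUniformlyOn_iff]
    intro ε hε
    have ht : Tendsto (fun k : ℕ => 8 * C * ρ ^ k) atTop (𝓝 0) := by
      simpa using (tendsto_pow_atTop_nhds_zero_of_lt_one hW.pos.le hW.lt_one).const_mul (8 * C)
    obtain ⟨k, hk⟩ := (ht.eventually_lt_const hε).exists
    filter_upwards [eventually_ge_atTop (k + k)] with n hn θ hθ
    rw [dist_eq_norm, ← map_sub, LinearIsometryEquiv.norm_map]
    have h1 := hW.norm_mean_sub_le (hG θ hθ) hn
    have h2 : ‖limUnder atTop (d θ) - d θ (k + k)‖ ≤ 4 * C * ρ ^ k := by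
      refine le_of_tendsto ((hdl θ hθ).sub_const _).norm ?_
      filter_upwards [eventually_ge_atTop (k + k)] with m hm
      exact hW.norm_mean_sub_le (hG θ hθ) hm
    have h3 := norm_sub_le (limUnder atTop (d θ) - d θ (k + k)) (d θ n - d θ (k + k))
    rw [sub_sub_sub_cancel_right] at h3
    change ‖d θ n - d θ (k + k)‖ ≤ _ at h1
    linarith
  -- Pointwise convergence of the means and uniform convergence of their gradients allow the limit
  -- and the gradient to be exchanged.
  have hlim : ∀ θ ∈ Θ, HasGradientAt (fun x => limUnder atTop (a x)) (limUnder atTop (d θ)) θ := by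
    intro θ hθ
    rw [hasGradientAt_iff_hasFDerivAt]
    exact hasFDerivAt_of_tendstoUniformlyOn hΘ hunif (fun k x hx => (hgrad k x hx).hasFDerivAt)
      (f := fun k x => a x k) (fun x hx => hal x hx) hθ
  refine ⟨fun x => limUnder atTop (a x),
    fun θ hθ => (hlim θ hθ).differentiableAt.differentiableWithinAt, fun θ hθ => ?_⟩
  rw [(hlim θ hθ).gradient]
  refine ⟨?_, ⟨(hF θ hθ).integrable hW, (hal θ hθ).cesaro_smul⟩,
    ⟨(hG θ hθ).integrable hW, (hdl θ hθ).cesaro_smul⟩⟩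
  filter_upwards [hW.ae_tendsto_timeAverage (hF θ hθ) (hal θ hθ),
    hW.ae_tendsto_timeAverage_euclidean (hG θ hθ) (hdl θ hθ)] with ω h1 h2
  exact ⟨h1, h2⟩

end Contrast

/-! ### Isolating one coordinate in a power of a measure. -/

section PiIntegrals

variable {A E : Type*} [MeasurableSpace A] [NormedAddCommGroup E] [NormedSpace ℝ E]

lemma measurePreserving_insertNth (μ : Measure A) [SigmaFinite μ] {n : ℕ} (i : Fin (n + 1)) :
    MeasurePreserving (MeasurableEquiv.piFinSuccAbove (fun _ : Fin (n + 1) => A) i).symm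
      (μ.prod (Measure.pi fun _ : Fin n => μ)) (Measure.pi fun _ : Fin (n + 1) => μ) :=
  (measurePreserving_piFinSuccAbove (fun _ : Fin (n + 1) => μ) i).symm

lemma integral_pi_insertNth (μ : Measure A) [SigmaFinite μ] {n : ℕ} (i : Fin (n + 1))
    (f : (Fin (n + 1) → A) → E) :
    ∫ v, f v ∂(Measure.pi fun _ : Fin (n + 1) => μ) =
      ∫ a : A × (Fin n → A), f (i.insertNth (α := fun _ => A) a.1 a.2)
        ∂(μ.prod (Measure.pi fun _ : Fin n => μ)) :=
  ((measurePreserving_insertNth μ i).integral_comp' f).symm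

lemma integrable_pi_insertNth (μ : Measure A) [SigmaFinite μ] {n : ℕ} (i : Fin (n + 1))
    {f : (Fin (n + 1) → A) → E} (hf : Integrable f (Measure.pi fun _ : Fin (n + 1) => μ)) :
    Integrable (fun a : A × (Fin n → A) => f (i.insertNth (α := fun _ => A) a.1 a.2))
        (μ.prod (Measure.pi fun _ : Fin n => μ)) :=
  (measurePreserving_insertNth μ i).integrable_comp_of_integrable hf

end PiIntegrals

/-! ### The data process as a mixing Markov chain. -/

section DataProcess

variable {S O Ω : Type*} [MeasurableSpace S] [MeasurableSpace O] [MeasurableSpace Ω]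
  {ξ : Measure S} [IsFiniteMeasure ξ] {η : Measure O} [IsFiniteMeasure η]
  {m₀ : S → ℝ} {m : S → S → ℝ} {g : S → O → ℝ}

lemma jointDensity_succ (T : ℕ) (x : Fin (T + 2) → S) (y : Fin (T + 2) → O) :
    jointDensity m₀ m g (T + 1) x y =
      jointDensity m₀ m g T (fun t => x t.castSucc) (fun t => y t.castSucc) *
        (m (x (Fin.last T).castSucc) (x (Fin.last (T + 1))) *
          g (x (Fin.last (T + 1))) (y (Fin.last (T + 1)))) := by
  simp only [jointDensity, Fin.prod_univ_castSucc, Fin.succ_last, Fin.castSucc_zero,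
    Fin.succ_castSucc]
  ring

lemma measurable_jointDensity (hm₀ : Measurable m₀) (hm : Measurable (Function.uncurry m))
    (hg : Measurable (Function.uncurry g)) (T : ℕ) :
    Measurable fun a : (Fin (T + 1) → S) × (Fin (T + 1) → O) =>
      jointDensity m₀ m g T a.1 a.2 := by
  unfold jointDensity
  refine Measurable.mul (Measurable.mul ?_ ?_) (Finset.measurable_prod _ fun t _ =>
    Measurable.mul ?_ ?_)
  · exact hm₀.comp (f := fun a : (Fin (T + 1) → S) × (Fin (T + 1) → O) => a.1 0) (by fun_prop)
  · exact hg.comp (f := fun a : (Fin (T + 1) → S) × (Fin (T + 1) → O) => (a.1 0, a.2 0))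
      (by fun_prop)
  · exact hm.comp (f := fun a : (Fin (T + 1) → S) × (Fin (T + 1) → O) =>
      (a.1 t.castSucc, a.1 t.succ)) (by fun_prop)
  · exact hg.comp (f := fun a : (Fin (T + 1) → S) × (Fin (T + 1) → O) => (a.1 t.succ, a.2 t.succ))
      (by fun_prop)

lemma jointDensity_nonneg (hm₀ : ∀ x, 0 ≤ m₀ x) (hm : ∀ x x', 0 ≤ m x x') (hg : ∀ x y, 0 ≤ g x y)
    (T : ℕ) (x : Fin (T + 1) → S) (y : Fin (T + 1) → O) : 0 ≤ jointDensity m₀ m g T x y :=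
  mul_nonneg (mul_nonneg (hm₀ _) (hg _ _))
    (Finset.prod_nonneg fun _ _ => mul_nonneg (hm _ _) (hg _ _))

/-- The transition density of the bivariate chain. -/
def pairTrans (m : S → S → ℝ) (g : S → O → ℝ) (z z' : S × O) : ℝ := m z.1 z'.1 * g z'.1 z'.2

lemma integrable_mul_emission (hg : IsTransitionDensity η g) {f : S → ℝ} (hf : Integrable f ξ) :
    Integrable (fun z : S × O => f z.1 * g z.1 z.2) (ξ.prod η) := by
  have hm : AEStronglyMeasurable (fun z : S × O => f z.1 * g z.1 z.2) (ξ.prod η) :=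
    hf.aestronglyMeasurable.comp_fst.mul hg.measurable.aestronglyMeasurable
  rw [integrable_prod_iff hm]
  refine ⟨ae_of_all _ fun x => (hg.integrable x).const_mul (f x), ?_⟩
  simp only [norm_mul, Real.norm_of_nonneg (hg.nonneg _ _), integral_const_mul,
    hg.integral_eq_one, mul_one]
  exact hf.norm

lemma integral_mul_emission (hg : IsTransitionDensity η g) {f : S → ℝ} (hf : Integrable f ξ) :
    ∫ z : S × O, f z.1 * g z.1 z.2 ∂(ξ.prod η) = ∫ x, f x ∂ξ := by
  rw [integral_prod _ (integrable_mul_emission hg hf)]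
  simp only [integral_const_mul, hg.integral_eq_one, mul_one]

lemma isTransitionDensity_pairTrans (hm : IsTransitionDensity ξ m) (hg : IsTransitionDensity η g) :
    IsTransitionDensity (ξ.prod η) (pairTrans m g) where
  measurable := by
    refine Measurable.mul ?_ ?_
    · exact hm.measurable.comp (f := fun a : (S × O) × (S × O) => (a.1.1, a.2.1)) (by fun_prop)
    · exact hg.measurable.comp (f := fun a : (S × O) × (S × O) => (a.2.1, a.2.2)) (by fun_prop)
  nonneg _ _ := mul_nonneg (hm.nonneg _ _) (hg.nonneg _ _)
  integral_eq_one z := by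
    rw [← hm.integral_eq_one z.1, ← integral_mul_emission hg (hm.integrable z.1)]
    rfl

variable {P : Measure Ω} [IsProbabilityMeasure P] {X : ℕ → Ω → S} {Y : ℕ → Ω → O}

lemma IsStateSpaceModel.measurable_initial (h : IsStateSpaceModel P ξ η m₀ m g X Y) (T : ℕ) :
    Measurable fun ω (t : Fin (T + 1)) => (X t ω, Y t ω) :=
  measurable_pi_lambda _ fun t => (h.measurable_state t).prodMk (h.measurable_obs t)

lemma IsStateSpaceModel.integral_initial (h : IsStateSpaceModel P ξ η m₀ m g X Y)
    (hm₀ : IsProbDensity ξ m₀) (hm : IsTransitionDensity ξ m) (hg : IsTransitionDensity η g)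
    (T : ℕ) {f : (Fin (T + 1) → S × O) → ℝ} (hf : Measurable f) {C : ℝ} (hC : ∀ v, |f v| ≤ C) :
    Integrable (fun v => jointDensity m₀ m g T (fun t => (v t).1) (fun t => (v t).2) * f v)
        (Measure.pi fun _ => ξ.prod η) ∧
    ∫ ω, f (fun t => (X t ω, Y t ω)) ∂P =
      ∫ v, jointDensity m₀ m g T (fun t => (v t).1) (fun t => (v t).2) * f v
        ∂(Measure.pi fun _ => ξ.prod η) := by
  have hJ : Measurable fun v : Fin (T + 1) → S × O =>
      jointDensity m₀ m g T (fun t => (v t).1) (fun t => (v t).2) :=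
    (measurable_jointDensity hm₀.measurable hm.measurable hg.measurable T).comp
      (f := fun v : Fin (T + 1) → S × O => (fun t => (v t).1, fun t => (v t).2)) (by fun_prop)
  have hJ0 : ∀ v : Fin (T + 1) → S × O,
      0 ≤ jointDensity m₀ m g T (fun t => (v t).1) (fun t => (v t).2) := fun v =>
    jointDensity_nonneg hm₀.nonneg hm.nonneg hg.nonneg T _ _
  have hmap : IsProbabilityMeasure (P.map fun ω (t : Fin (T + 1)) => (X t ω, Y t ω)) :=
    Measure.isProbabilityMeasure_map (h.measurable_initial T).aemeasurable
  have hint : Integrable f (P.map fun ω (t : Fin (T + 1)) => (X t ω, Y t ω)) :=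
    Integrable.of_bound hf.aestronglyMeasurable C (ae_of_all _ hC)
  rw [h.law T] at hint
  rw [integrable_withDensity_iff_integrable_smul' hJ.ennreal_ofReal
    (ae_of_all _ fun _ => ENNReal.ofReal_lt_top)] at hint
  simp only [ENNReal.toReal_ofReal (hJ0 _), smul_eq_mul] at hint
  refine ⟨hint, ?_⟩
  rw [← integral_map (h.measurable_initial T).aemeasurable hf.aestronglyMeasurable, h.law T,
    integral_withDensity_eq_integral_toReal_smul hJ.ennreal_ofReal
      (ae_of_all _ fun _ => ENNReal.ofReal_lt_top)]
  simp only [ENNReal.toReal_ofReal (hJ0 _), smul_eq_mul]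

/-- The functional depends on finitely many coordinates, so the law of an initial segment suffices.
Its density splits off the last factor as `pairTrans`, and Fubini integrates the last pair first. -/
lemma IsStateSpaceModel.isMarkovSeq (h : IsStateSpaceModel P ξ η m₀ m g X Y)
    (hm₀ : IsProbDensity ξ m₀) (hm : IsTransitionDensity ξ m) (hg : IsTransitionDensity η g) :
    IsMarkovSeq P (ξ.prod η) (pairTrans m g) fun n ω => (X n ω, Y n ω) where
  measurable n := (h.measurable_state n).prodMk (h.measurable_obs n)
  step n Φ C hΦm hΦ hΦd := by
    have hq := isTransitionDensity_pairTrans hm hg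
    -- A finite segment is extended to a sequence by freezing it at its last value; by `DependsOn`
    -- the frozen coordinates are irrelevant.
    have hextm : ∀ N : ℕ, Measurable fun (v : Fin (N + 1) → S × O) (k : ℕ) =>
        v ⟨min k N, by omega⟩ := fun N => by fun_prop
    have h1 : ∀ ω, Φ (fun k => (X k ω, Y k ω)) =
        Φ (fun k => (X (min k (n + 1)) ω, Y (min k (n + 1)) ω)) := fun ω => hΦd fun k hk => by
      have : k ≤ n + 1 := hk
      simp [min_eq_left this]
    obtain ⟨hi, he⟩ := h.integral_initial hm₀ hm hg (n + 1)
      (f := fun v => Φ fun k => v ⟨min k (n + 1), by omega⟩) (hΦm.comp (hextm (n + 1)))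
      (fun _ => hΦ _)
    have hi' := integrable_pi_insertNth (ξ.prod η) (Fin.last (n + 1)) hi
    simp_rw [h1]
    change ∫ ω, (fun v : Fin (n + 2) → S × O => Φ fun k => v ⟨min k (n + 1), by omega⟩)
      (fun t => (X t ω, Y t ω)) ∂P = _
    rw [he, integral_pi_insertNth _ (Fin.last (n + 1)), integral_prod_symm _ hi']
    have hext : ∀ (v : Fin (n + 1) → S × O) (z' : S × O),
        Φ (fun k => (Fin.last (n + 1)).insertNth (α := fun _ => S × O) z' v
          ⟨min k (n + 1), by omega⟩) =
        Φ (Function.update (fun k => v ⟨min k n, by omega⟩) (n + 1) z') := by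
      intro v z'
      refine hΦd fun k hk => ?_
      have hk' : k ≤ n + 1 := hk
      rw [Fin.insertNth_last']
      rcases hk'.eq_or_lt with rfl | hlt
      · rw [Function.update_self]
        have : (⟨min (n + 1) (n + 1), by omega⟩ : Fin (n + 1 + 1)) = Fin.last (n + 1) := by
          ext; simp
        rw [this, Fin.snoc_last]
      · rw [Function.update_of_ne hlt.ne]
        have : (⟨min k (n + 1), by omega⟩ : Fin (n + 1 + 1)) =
            Fin.castSucc ⟨min k n, by omega⟩ := by
          ext; simp; omega
        rw [this, Fin.snoc_castSucc]
    obtain ⟨-, he2⟩ := h.integral_initial hm₀ hm hg n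
      (f := fun v => ∫ z', pairTrans m g (v (Fin.last n)) z' *
        Φ (Function.update (fun k => v ⟨min k n, by omega⟩) (n + 1) z') ∂(ξ.prod η))
      (by
        have : StronglyMeasurable (fun a : (Fin (n + 1) → S × O) × (S × O) =>
            pairTrans m g (a.1 (Fin.last n)) a.2 *
              Φ (Function.update (fun k => a.1 ⟨min k n, by omega⟩) (n + 1) a.2)) := by
          refine Measurable.stronglyMeasurable (Measurable.mul ?_ ?_)
          · exact hq.measurable.comp
              (f := fun a : (Fin (n + 1) → S × O) × (S × O) => (a.1 (Fin.last n), a.2))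
              (by fun_prop)
          · exact hΦm.comp ((measurable_update_path (n + 1)).comp
              (((hextm n).comp measurable_fst).prodMk measurable_snd))
        exact this.integral_prod_right.measurable)
      (C := C) (fun v => abs_integral_mul_le hq (fun _ => hΦ _) _)
    have h2 : ∀ ω, ∫ z', pairTrans m g (X n ω, Y n ω) z' *
          Φ (Function.update (fun k => (X k ω, Y k ω)) (n + 1) z') ∂(ξ.prod η) =
        (fun v : Fin (n + 1) → S × O => ∫ z', pairTrans m g (v (Fin.last n)) z' *
          Φ (Function.update (fun k => v ⟨min k n, by omega⟩) (n + 1) z') ∂(ξ.prod η))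
            (fun t => (X t ω, Y t ω)) := by
      intro ω
      simp only [Fin.val_last]
      congr 1 with z'
      congr 1
      refine hΦd fun k hk => ?_
      have hk' : k ≤ n + 1 := hk
      rcases hk'.eq_or_lt with rfl | hlt
      · simp
      · rw [Function.update_of_ne hlt.ne, Function.update_of_ne hlt.ne,
          min_eq_left (by omega : k ≤ n)]
    simp_rw [h2]
    rw [he2]
    congr 1 with v
    rw [← integral_const_mul]
    congr 1 with z'
    rw [hext, jointDensity_succ, Fin.insertNth_last']
    simp only [Fin.snoc_castSucc, Fin.snoc_last, pairTrans]
    ring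

/-- The minorant is `ε g(x', y')`, of mass `ε ξ(S)`. Since `m` integrates to one and is at most
`ε⁻¹`, `ξ(S) ≥ ε`, so the mass is at least `ε ^ 2`. No lower bound on the emission density of the
data is needed. -/
lemma IsStateSpaceModel.isMixingSeq (h : IsStateSpaceModel P ξ η m₀ m g X Y)
    (hm₀ : IsProbDensity ξ m₀) (hm : IsTransitionDensity ξ m) (hg : IsTransitionDensity η g)
    {ε ρ : ℝ} (hε : 0 < ε) (hmε : ∀ x x', ε ≤ m x x' ∧ m x x' ≤ ε⁻¹) (hρε : 1 - ρ ≤ ε ^ 2)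
    (hρ0 : 0 < ρ) (hρ1 : ρ < 1) :
    IsMixingSeq P (ξ.prod η) (pairTrans m g) (fun n ω => (X n ω, Y n ω)) ρ where
  markov := h.isMarkovSeq hm₀ hm hg
  trans := isTransitionDensity_pairTrans hm hg
  pos := hρ0
  lt_one := hρ1
  minor := by
    refine ⟨fun z => ε * g z.1 z.2, integrable_mul_emission hg (integrable_const ε),
      fun z z' => mul_le_mul_of_nonneg_right (hmε _ _).1 (hg.nonneg _ _), hρε.trans ?_⟩
    rw [integral_mul_emission hg (integrable_const ε), integral_const, smul_eq_mul]
    obtain ⟨x₀⟩ : Nonempty S := (nonempty_of_isProbabilityMeasure P).map (X 0)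
    have h1 : (1 : ℝ) ≤ ξ.real Set.univ * ε⁻¹ := by
      rw [← hm.integral_eq_one x₀, ← smul_eq_mul, ← integral_const]
      exact integral_mono (hm.integrable x₀) (integrable_const _) fun x' => (hmε x₀ x').2
    have h2 : ε ≤ ξ.real Set.univ := by
      have := mul_le_mul_of_nonneg_right h1 hε.le
      rwa [mul_assoc, inv_mul_cancel₀ hε.ne', one_mul, mul_one] at this
    nlinarith

end DataProcess

/-! ### One filtering step: contraction of relative distances, and backward kernels. -/

section FilterStep

variable {S : Type*} [MeasurableSpace S]

/-- Prediction: push-forward of the density `φ` under the transition density `m`. -/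
def predict (ξ : Measure S) (m : S → S → ℝ) (φ : S → ℝ) (x' : S) : ℝ := ∫ x, m x x' * φ x ∂ξ

/-- Prediction followed by normalised multiplication with the likelihood `γ`. -/
def filterStep (ξ : Measure S) (m : S → S → ℝ) (γ φ : S → ℝ) (x : S) : ℝ :=
  γ x * predict ξ m φ x / ∫ x', γ x' * predict ξ m φ x' ∂ξ

/-- The density of the backward kernel. -/
def backward (ξ : Measure S) (m : S → S → ℝ) (φ : S → ℝ) (x' x : S) : ℝ :=
  m x x' * φ x / predict ξ m φ x'

/-- Two-sided bounds on a transition density and on a likelihood. -/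
structure StepBounds (ξ : Measure S) (ε : ℝ) (m : S → S → ℝ) (γ : S → ℝ) : Prop where
  pos : 0 < ε
  le_one : ε ≤ 1
  trans : IsTransitionDensity ξ m
  trans_ge : ∀ x x', ε ≤ m x x'
  trans_le : ∀ x x', m x x' ≤ ε⁻¹
  measurable : Measurable γ
  ge : ∀ x, ε ≤ γ x
  le : ∀ x, γ x ≤ ε⁻¹

/-- `φ'` is squeezed between `a * φ` and `a * (1 + η) * φ` for some positive `a`. -/
def RelClose (η : ℝ) (φ φ' : S → ℝ) : Prop :=
  ∃ a, 0 < a ∧ ∀ x, a * φ x ≤ φ' x ∧ φ' x ≤ a * (1 + η) * φ x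

variable {ξ : Measure S} [IsFiniteMeasure ξ] {ε : ℝ} {m : S → S → ℝ} {γ φ φ' : S → ℝ}

lemma IsProbDensity.integrable {f : S → ℝ} (hf : IsProbDensity ξ f) : Integrable f ξ := by
  by_contra h
  have := hf.integral_eq_one
  rw [integral_undef h] at this
  exact zero_ne_one this

lemma IsProbDensity.nonempty {f : S → ℝ} (hf : IsProbDensity ξ f) : Nonempty S := by
  by_contra h
  rw [not_nonempty_iff] at h
  have := hf.integral_eq_one
  simp [integral_of_isEmpty] at this

lemma RelClose.mono {η η' : ℝ} (h : RelClose η φ φ') (hφ : ∀ x, 0 ≤ φ x) (hη : η ≤ η') :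
    RelClose η' φ φ' := by
  obtain ⟨a, ha, h⟩ := h
  refine ⟨a, ha, fun x => ⟨(h x).1, (h x).2.trans ?_⟩⟩
  have := hφ x
  gcongr

section Compare

variable {η : ℝ} (hφ : IsProbDensity ξ φ) (hφ' : IsProbDensity ξ φ') (h : RelClose η φ φ')
  (hη : 0 ≤ η)

include hφ hφ' h hη in
-- Integrating the two inequalities between densities of equal mass gives `a ≤ 1 ≤ a * (1 + η)`,
-- which eliminates `a`.
lemma RelClose.le_mul : (∀ x, φ x ≤ (1 + η) * φ' x) ∧ ∀ x, φ' x ≤ (1 + η) * φ x := by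
  obtain ⟨a, ha, h⟩ := h
  have h1 : a ≤ 1 := by
    have := integral_mono (hφ.integrable.const_mul a) hφ'.integrable fun x => (h x).1
    rwa [integral_const_mul, hφ.integral_eq_one, hφ'.integral_eq_one, mul_one] at this
  have h2 : 1 ≤ a * (1 + η) := by
    have := integral_mono hφ'.integrable (hφ.integrable.const_mul (a * (1 + η)))
      fun x => (h x).2
    rwa [integral_const_mul, hφ.integral_eq_one, hφ'.integral_eq_one, mul_one] at this
  refine ⟨fun x => ?_, fun x => ?_⟩
  · have := hφ.nonneg x
    have h3 := (h x).1
    nlinarith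
  · refine (h x).2.trans ?_
    have := hφ.nonneg x
    have : 0 ≤ (1 + η) * φ x := by positivity
    nlinarith

include hφ hφ' h hη in
lemma RelClose.abs_sub_le (x : S) : |φ x - φ' x| ≤ η * φ x := by
  obtain ⟨h1, h2⟩ := h.le_mul hφ hφ' hη
  have h1 := h1 x
  have h2 := h2 x
  have h0 := hφ.nonneg x
  rw [abs_le]
  refine ⟨by linarith, ?_⟩
  by_contra hc
  push Not at hc
  nlinarith [mul_lt_mul_of_pos_left hc (by linarith : (0 : ℝ) < 1 + η),
    mul_nonneg (mul_nonneg hη hη) h0]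

end Compare

/-- Averages with respect to two comparable probability densities. -/
lemma norm_integral_sub_le_of_le_mul {E : Type*} [NormedAddCommGroup E] [NormedSpace ℝ E]
    [CompleteSpace E] {η B : ℝ} {s : S → E} (hp : Integrable φ ξ) (hq : Integrable φ' ξ)
    (hp0 : ∀ x, 0 ≤ φ x) (hp1 : ∫ x, φ x ∂ξ = 1) (hq1 : ∫ x, φ' x ∂ξ = 1)
    (hη : 0 ≤ η) (h : ∀ x, φ x ≤ (1 + η) * φ' x) (hsm : StronglyMeasurable s)
    (hs : ∀ a b, ‖s a - s b‖ ≤ B) : ‖∫ x, φ x • s x ∂ξ - ∫ x, φ' x • s x ∂ξ‖ ≤ η * B := by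
  have hB : 0 ≤ B := by
    rcases isEmpty_or_nonempty S with hA | ⟨⟨a₀⟩⟩
    · simp [integral_of_isEmpty] at hp1
    · exact (norm_nonneg _).trans (hs a₀ a₀)
  have h1 : (0 : ℝ) < 1 + η := by linarith
  -- The common minorant is `φ / (1 + η)`, leaving the excess mass `η / (1 + η) ≤ η`.
  refine (norm_integral_smul_sub_le hp hq (c := fun x => (1 + η)⁻¹ * φ x) (δ := (1 + η)⁻¹)
    (hp.const_mul _) (fun x => ?_) (fun x => ?_) hp1 hq1 ?_ hsm hs).trans ?_
  · have : (1 + η)⁻¹ ≤ 1 := inv_le_one_of_one_le₀ (by linarith)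
    nlinarith [hp0 x]
  · rw [inv_mul_le_iff₀ h1]
    exact h x
  · rw [integral_const_mul, hp1, mul_one]
  · refine mul_le_mul_of_nonneg_right ?_ hB
    have : 1 - (1 + η)⁻¹ = η * (1 + η)⁻¹ := by field_simp; ring
    rw [this]
    exact mul_le_of_le_one_right hη (inv_le_one_of_one_le₀ (by linarith))

namespace StepBounds

variable (h : StepBounds ξ ε m γ)
include h

lemma trans_nonneg (x x' : S) : 0 ≤ m x x' := h.pos.le.trans (h.trans_ge x x')

lemma nonneg (x : S) : 0 ≤ γ x := h.pos.le.trans (h.ge x)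

lemma measurable_left (x' : S) : Measurable fun x => m x x' :=
  h.trans.measurable.comp (f := fun x => (x, x')) (by fun_prop)

lemma mass_ge [Nonempty S] : ε ≤ ξ.real Set.univ := by
  obtain ⟨x₀⟩ := ‹Nonempty S›
  have h1 : (1 : ℝ) ≤ ξ.real Set.univ * ε⁻¹ := by
    rw [← h.trans.integral_eq_one x₀, ← smul_eq_mul, ← integral_const]
    exact integral_mono (h.trans.integrable x₀) (integrable_const _) fun x' => h.trans_le x₀ x'
  have h2 := mul_le_mul_of_nonneg_right h1 h.pos.le
  rwa [mul_assoc, inv_mul_cancel₀ h.pos.ne', one_mul, mul_one] at h2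

lemma integrable_trans_mul (hφ : Integrable φ ξ) (x' : S) :
    Integrable (fun x => m x x' * φ x) ξ :=
  hφ.bdd_mul (c := ε⁻¹) (h.measurable_left x').aestronglyMeasurable (ae_of_all _ fun x => by
    rw [Real.norm_of_nonneg (h.trans_nonneg x x')]
    exact h.trans_le x x')

lemma measurable_predict (hφ : Measurable φ) : Measurable (predict ξ m φ) := by
  have : StronglyMeasurable fun a : S × S => m a.2 a.1 * φ a.2 :=
    ((h.trans.measurable.comp measurable_swap).mul (hφ.comp measurable_snd)).stronglyMeasurable
  exact this.integral_prod_right.measurable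

lemma predict_ge_mul (hφ : Integrable φ ξ) (h0 : ∀ x, 0 ≤ φ x) (x' : S) :
    ε * ∫ x, φ x ∂ξ ≤ predict ξ m φ x' := by
  rw [← integral_const_mul]
  exact integral_mono (hφ.const_mul _) (h.integrable_trans_mul hφ x')
    fun x => mul_le_mul_of_nonneg_right (h.trans_ge x x') (h0 x)

lemma predict_le_mul (hφ : Integrable φ ξ) (h0 : ∀ x, 0 ≤ φ x) (x' : S) :
    predict ξ m φ x' ≤ ε⁻¹ * ∫ x, φ x ∂ξ := by
  rw [← integral_const_mul]
  exact integral_mono (h.integrable_trans_mul hφ x') (hφ.const_mul _)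
    fun x => mul_le_mul_of_nonneg_right (h.trans_le x x') (h0 x)

lemma predict_ge (hφ : IsProbDensity ξ φ) (x' : S) : ε ≤ predict ξ m φ x' := by
  simpa [hφ.integral_eq_one] using h.predict_ge_mul hφ.integrable hφ.nonneg x'

lemma predict_le (hφ : IsProbDensity ξ φ) (x' : S) : predict ξ m φ x' ≤ ε⁻¹ := by
  simpa [hφ.integral_eq_one] using h.predict_le_mul hφ.integrable hφ.nonneg x'

lemma predict_pos (hφ : IsProbDensity ξ φ) (x' : S) : 0 < predict ξ m φ x' :=
  h.pos.trans_le (h.predict_ge hφ x')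

lemma mul_predict_ge (hφ : IsProbDensity ξ φ) (x : S) : ε ^ 2 ≤ γ x * predict ξ m φ x := by
  rw [sq]
  exact mul_le_mul (h.ge x) (h.predict_ge hφ x) h.pos.le (h.nonneg x)

lemma mul_predict_le (hφ : IsProbDensity ξ φ) (x : S) :
    γ x * predict ξ m φ x ≤ ε⁻¹ ^ 2 := by
  rw [sq]
  exact mul_le_mul (h.le x) (h.predict_le hφ x) (h.predict_pos hφ x).le
    (inv_nonneg.2 h.pos.le)

lemma integrable_mul_predict (hφ : IsProbDensity ξ φ) :
    Integrable (fun x => γ x * predict ξ m φ x) ξ :=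
  Integrable.of_bound (h.measurable.mul (h.measurable_predict hφ.measurable)).aestronglyMeasurable
    (ε⁻¹ ^ 2) (ae_of_all _ fun x => by
      rw [Real.norm_of_nonneg (mul_nonneg (h.nonneg x) (h.predict_pos hφ x).le)]
      exact h.mul_predict_le hφ x)

lemma integral_mul_predict_ge (hφ : IsProbDensity ξ φ) :
    ε ^ 3 ≤ ∫ x, γ x * predict ξ m φ x ∂ξ := by
  have := hφ.nonempty
  have h1 : ∫ _ : S, ε ^ 2 ∂ξ ≤ ∫ x, γ x * predict ξ m φ x ∂ξ :=
    integral_mono (integrable_const _) (h.integrable_mul_predict hφ) fun x => h.mul_predict_ge hφ x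
  rw [integral_const, smul_eq_mul] at h1
  refine le_trans ?_ h1
  nlinarith [h.mass_ge, sq_nonneg ε]

lemma integral_mul_predict_pos (hφ : IsProbDensity ξ φ) :
    0 < ∫ x, γ x * predict ξ m φ x ∂ξ :=
  (pow_pos h.pos 3).trans_le (h.integral_mul_predict_ge hφ)

lemma isProbDensity_filterStep (hφ : IsProbDensity ξ φ) :
    IsProbDensity ξ (filterStep ξ m γ φ) where
  measurable := (h.measurable.mul (h.measurable_predict hφ.measurable)).div_const _
  nonneg x := div_nonneg (mul_nonneg (h.nonneg x) (h.predict_pos hφ x).le)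
    (h.integral_mul_predict_pos hφ).le
  integral_eq_one := by
    simp only [filterStep]
    rw [integral_div, div_self (h.integral_mul_predict_pos hφ).ne']

lemma filterStep_le (hφ : IsProbDensity ξ φ) (x : S) : filterStep ξ m γ φ x ≤ ε⁻¹ ^ 5 := by
  have := h.pos
  rw [filterStep, div_le_iff₀ (h.integral_mul_predict_pos hφ)]
  refine (h.mul_predict_le hφ x).trans ?_
  calc ε⁻¹ ^ 2 = ε⁻¹ ^ 5 * ε ^ 3 := by field_simp
    _ ≤ _ := mul_le_mul_of_nonneg_left (h.integral_mul_predict_ge hφ) (by positivity)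

/-- The same likelihood multiplies both functions and the normalisations only rescale the constant
`a`, so relative distance is unaffected by the update. -/
lemma relClose_filterStep_of_predict {η : ℝ} (hφ : IsProbDensity ξ φ) (hφ' : IsProbDensity ξ φ')
    (hc : RelClose η (predict ξ m φ) (predict ξ m φ')) :
    RelClose η (filterStep ξ m γ φ) (filterStep ξ m γ φ') := by
  obtain ⟨a, ha, hc⟩ := hc
  have hZ := h.integral_mul_predict_pos hφ
  have hZ' := h.integral_mul_predict_pos hφ'
  simp only [RelClose, filterStep]
  set Z := ∫ x, γ x * predict ξ m φ x ∂ξ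
  set Z' := ∫ x, γ x * predict ξ m φ' x ∂ξ
  refine ⟨a * Z / Z', by positivity, fun x => ?_⟩
  have hγ := h.nonneg x
  constructor
  · calc a * Z / Z' * (γ x * predict ξ m φ x / Z) = γ x * (a * predict ξ m φ x) / Z' := by
          field_simp
      _ ≤ _ := by have := (hc x).1; gcongr
  · calc _ ≤ γ x * (a * (1 + η) * predict ξ m φ x) / Z' := by have := (hc x).2; gcongr
      _ = a * Z / Z' * (1 + η) * (γ x * predict ξ m φ x / Z) := by field_simp

/-- One step of the filter makes any two initial densities comparable. -/
lemma relClose_filterStep (hφ : IsProbDensity ξ φ) (hφ' : IsProbDensity ξ φ') :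
    RelClose (ε⁻¹ ^ 4) (filterStep ξ m γ φ) (filterStep ξ m γ φ') := by
  have hε := h.pos
  -- Both predictions lie in `[ε, ε⁻¹]`, so their ratio lies in `[ε ^ 2, ε⁻¹ ^ 2]`; take `a = ε ^
  -- 2`.
  refine h.relClose_filterStep_of_predict hφ hφ' ⟨ε ^ 2, by positivity, fun x => ⟨?_, ?_⟩⟩
  · have h1 := h.predict_le hφ x
    have h2 := h.predict_ge hφ' x
    calc ε ^ 2 * predict ξ m φ x ≤ ε ^ 2 * ε⁻¹ := by gcongr
      _ = ε := by field_simp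
      _ ≤ _ := h2
  · have h1 := h.predict_ge hφ x
    have h2 := h.predict_le hφ' x
    calc predict ξ m φ' x ≤ ε⁻¹ := h2
      _ = ε ^ 2 * ε⁻¹ ^ 4 * ε := by field_simp
      _ ≤ ε ^ 2 * (1 + ε⁻¹ ^ 4) * predict ξ m φ x := by
        gcongr
        linarith

/-- The filter contracts relative distances. -/
lemma relClose_filterStep_of_relClose {η : ℝ} (hη : 0 ≤ η) (hφ : IsProbDensity ξ φ)
    (hφ' : IsProbDensity ξ φ') (hc : RelClose η φ φ') :
    RelClose ((1 - ε ^ 2) * η) (filterStep ξ m γ φ) (filterStep ξ m γ φ') := by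
  have hε := h.pos
  obtain ⟨a, ha, hc⟩ := hc
  -- The two inequalities of `RelClose` say that `d` and `e` are nonnegative. Prediction of a
  -- nonnegative `f` is at least `ε ^ 2 (∫ f)` times that of `φ`. Applied to `d` this raises `a` to
  -- `a + ε ^ 2 ∫ d`, and applied to `e` it lowers the upper constant; the gap shrinks by `1 - ε ^
  -- 2`.
  set d : S → ℝ := fun x => φ' x - a * φ x with hd
  have hdi : Integrable d ξ := hφ'.integrable.sub (hφ.integrable.const_mul a)
  set e : S → ℝ := fun x => a * η * φ x - d x with he
  have hei : Integrable e ξ := (hφ.integrable.const_mul _).sub hdi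
  have hd0 : ∀ x, 0 ≤ d x := fun x => sub_nonneg.2 (hc x).1
  have he0 : ∀ x, 0 ≤ e x := fun x => by
    have := (hc x).2
    simp only [he, hd]
    linarith
  have hpd : ∀ x, predict ξ m d x = predict ξ m φ' x - a * predict ξ m φ x := by
    intro x
    simp only [predict, hd, mul_sub]
    rw [integral_sub (h.integrable_trans_mul hφ'.integrable x)
      (h.integrable_trans_mul (hφ.integrable.const_mul a) x), ← integral_const_mul]
    congr 2 with x'
    ring
  have hpe : ∀ x, predict ξ m e x = a * η * predict ξ m φ x - predict ξ m d x := by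
    intro x
    simp only [predict, he, mul_sub]
    rw [integral_sub (h.integrable_trans_mul (hφ.integrable.const_mul _) x)
      (h.integrable_trans_mul hdi x), ← integral_const_mul]
    congr 2 with x'
    ring
  have hde : ∫ x, e x ∂ξ = a * η - ∫ x, d x ∂ξ := by
    simp only [he]
    rw [integral_sub (hφ.integrable.const_mul _) hdi, integral_const_mul, hφ.integral_eq_one,
      mul_one]
  have hd1 : 0 ≤ ∫ x, d x ∂ξ := integral_nonneg hd0
  have he1 : 0 ≤ ∫ x, e x ∂ξ := integral_nonneg he0
  have key : ∀ (f : S → ℝ), Integrable f ξ → (∀ x, 0 ≤ f x) → ∀ x,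
      ε ^ 2 * (∫ x, f x ∂ξ) * predict ξ m φ x ≤ predict ξ m f x := by
    intro f hf hf0 x
    have h1 := h.predict_le hφ x
    have h2 := h.predict_ge_mul hf hf0 x
    have h3 : 0 ≤ ∫ x, f x ∂ξ := integral_nonneg hf0
    calc ε ^ 2 * (∫ x, f x ∂ξ) * predict ξ m φ x ≤ ε ^ 2 * (∫ x, f x ∂ξ) * ε⁻¹ := by gcongr
      _ = ε * ∫ x, f x ∂ξ := by field_simp
      _ ≤ _ := h2
  refine h.relClose_filterStep_of_predict hφ hφ'
    ⟨a + ε ^ 2 * ∫ x, d x ∂ξ, by positivity, fun x => ⟨?_, ?_⟩⟩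
  · have := key d hdi hd0 x
    rw [hpd] at this
    linarith
  · have h1 := key e hei he0 x
    rw [hpe, hpd, hde] at h1
    have h2 := h.predict_pos hφ x
    have h3 : ε ^ 2 ≤ 1 := pow_le_one₀ hε.le h.le_one
    have h4 : 0 ≤ (ε ^ 2 * ∫ x, d x ∂ξ) * ((1 - ε ^ 2) * η) * predict ξ m φ x := by
      have : 0 ≤ 1 - ε ^ 2 := by linarith
      positivity
    nlinarith

section Backward

lemma measurable_backward (hφ : Measurable φ) :
    Measurable (Function.uncurry (backward ξ m φ)) := by
  unfold backward
  exact ((h.trans.measurable.comp measurable_swap).mul (hφ.comp measurable_snd)).div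
    ((h.measurable_predict hφ).comp measurable_fst)

lemma isTransitionDensity_backward (hφ : IsProbDensity ξ φ) :
    IsTransitionDensity ξ (backward ξ m φ) where
  measurable := h.measurable_backward hφ.measurable
  nonneg x' x := div_nonneg (mul_nonneg (h.trans_nonneg x x') (hφ.nonneg x))
    (h.predict_pos hφ x').le
  integral_eq_one x' := by
    simp only [backward]
    rw [integral_div]
    exact div_self (h.predict_pos hφ x').ne'

/-- The minorant does not depend on the conditioning state `x'`: this is the Doeblin condition for
the backward kernels, of mass `ε ^ 2`. -/
lemma backward_ge (hφ : IsProbDensity ξ φ) (x' x : S) :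
    ε ^ 2 * φ x ≤ backward ξ m φ x' x := by
  have h1 := h.predict_le hφ x'
  have h2 := h.predict_pos hφ x'
  have h3 := hφ.nonneg x
  have hε := h.pos
  rw [backward, le_div_iff₀ h2]
  calc ε ^ 2 * φ x * predict ξ m φ x' ≤ ε ^ 2 * φ x * ε⁻¹ := by gcongr
    _ = ε * φ x := by field_simp
    _ ≤ _ := mul_le_mul_of_nonneg_right (h.trans_ge x x') h3

/-- The constant `a` of `RelClose` cancels between numerator and normalisation, so the backward
kernels inherit the ratio `1 + η` of the filters. -/
lemma backward_le_mul {η : ℝ} (hφ : IsProbDensity ξ φ) (hφ' : IsProbDensity ξ φ')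
    (hc : RelClose η φ φ') (x' x : S) :
    backward ξ m φ x' x ≤ (1 + η) * backward ξ m φ' x' x := by
  obtain ⟨a, ha, hc⟩ := hc
  have h2 := h.predict_pos hφ x'
  have h2' := h.predict_pos hφ' x'
  have h3 : predict ξ m φ' x' ≤ a * (1 + η) * predict ξ m φ x' := by
    simp only [predict]
    rw [← integral_const_mul]
    refine integral_mono (h.integrable_trans_mul hφ'.integrable x')
      ((h.integrable_trans_mul hφ.integrable x').const_mul _) fun y => ?_
    have := mul_le_mul_of_nonneg_left (hc y).2 (h.trans_nonneg y x')
    simp only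
    linarith
  have h4 := mul_le_mul_of_nonneg_left (hc x).1 (h.trans_nonneg x x')
  have h5 := h.trans_nonneg x x'
  have h6 := hφ.nonneg x
  rw [backward, backward, ← mul_div_assoc, div_le_div_iff₀ h2 h2']
  -- The sign of `1 + η` follows from `h3`, as the left side there is positive.
  have h8 : 0 ≤ 1 + η := by
    by_contra hneg
    push Not at hneg
    have : a * (1 + η) * predict ξ m φ x' < 0 :=
      mul_neg_of_neg_of_pos (mul_neg_of_pos_of_neg ha hneg) h2
    linarith
  calc m x x' * φ x * predict ξ m φ' x' ≤ m x x' * φ x * (a * (1 + η) * predict ξ m φ x') := by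
        gcongr
    _ = (1 + η) * (m x x' * (a * φ x)) * predict ξ m φ x' := by ring
    _ ≤ _ := by gcongr

end Backward

end StepBounds

end FilterStep

/-! ### Recursion for the conditional score, and the tangent filter. -/

section Score

variable {S E : Type*} [MeasurableSpace S] [NormedAddCommGroup E] [NormedSpace ℝ E]
  [CompleteSpace E]

/-- One step of the recursion for the conditional score: `dm` and `dγ` are the gradients of the
transition density and of the likelihood. -/
def scoreStep (ξ : Measure S) (m : S → S → ℝ) (dm : S → S → E) (γ : S → ℝ) (dγ : S → E)
    (φ : S → ℝ) (s : S → E) (x' : S) : E :=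
  (∫ x, backward ξ m φ x' x • (s x + (m x x')⁻¹ • dm x x') ∂ξ) + (γ x')⁻¹ • dγ x'

/-- The tangent filter associated with the density `φ` and the conditional score `s`. -/
def tangent (ξ : Measure S) (φ : S → ℝ) (s : S → E) (x : S) : E :=
  φ x • (s x - ∫ x', φ x' • s x' ∂ξ)

/-- Bounds on the gradients of a transition density and of a likelihood. -/
structure GradBounds (κ : ℝ) (dm : S → S → E) (dγ : S → E) : Prop where
  nonneg : 0 ≤ κ
  trans_meas : StronglyMeasurable (Function.uncurry dm)
  trans_le : ∀ x x', ‖dm x x'‖ ≤ κ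
  meas : StronglyMeasurable dγ
  le : ∀ x, ‖dγ x‖ ≤ κ

variable {ξ : Measure S} [IsFiniteMeasure ξ] {ε κ : ℝ} {m : S → S → ℝ} {γ φ φ' : S → ℝ}
  {dm : S → S → E} {dγ : S → E} {s s' : S → E}

lemma norm_inv_smul_le {a : ℝ} {v : E} (hε : 0 < ε) (ha : ε ≤ a) (hv : ‖v‖ ≤ κ) :
    ‖a⁻¹ • v‖ ≤ κ / ε := by
  rw [norm_smul, norm_inv, Real.norm_of_nonneg (hε.le.trans ha), inv_mul_eq_div]
  exact div_le_div₀ ((norm_nonneg v).trans hv) hv hε ha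

section Step

variable (h : StepBounds ξ ε m γ) (hd : GradBounds κ dm dγ)

include h hd in
lemma stronglyMeasurable_trans_score : StronglyMeasurable
    fun a : S × S => (m a.1 a.2)⁻¹ • dm a.1 a.2 :=
  h.trans.measurable.inv.stronglyMeasurable.smul hd.trans_meas

include h hd in
lemma stronglyMeasurable_augmented (hs : StronglyMeasurable s) (x' : S) :
    StronglyMeasurable fun x => s x + (m x x')⁻¹ • dm x x' :=
  hs.add ((stronglyMeasurable_trans_score h hd).comp_measurable (g := fun x => (x, x'))
    (by fun_prop))

include h hd in
lemma augmented_osc {B : ℝ} (hB : ∀ a b, ‖s a - s b‖ ≤ B) (x' a b : S) :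
    ‖(s a + (m a x')⁻¹ • dm a x') - (s b + (m b x')⁻¹ • dm b x')‖ ≤ B + 2 * (κ / ε) := by
  rw [add_sub_add_comm]
  refine (norm_add_le _ _).trans (add_le_add (hB a b) ((norm_sub_le _ _).trans ?_))
  linarith [norm_inv_smul_le h.pos (h.trans_ge a x') (hd.trans_le a x'),
    norm_inv_smul_le h.pos (h.trans_ge b x') (hd.trans_le b x')]

include h hd in
-- Separates the average of the old score, which contracts, from the increments of the
-- log-gradients, which are bounded independently of `s`.
lemma scoreStep_split {B : ℝ} (hφ : IsProbDensity ξ φ) (hs : StronglyMeasurable s)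
    (hB : ∀ a b, ‖s a - s b‖ ≤ B) (x' : S) :
    ∃ v : E, ‖v‖ ≤ 2 * (κ / ε) ∧
      scoreStep ξ m dm γ dγ φ s x' = (∫ x, backward ξ m φ x' x • s x ∂ξ) + v := by
  have hb := h.isTransitionDensity_backward hφ
  have hsm := (stronglyMeasurable_trans_score h hd).comp_measurable (g := fun x => (x, x'))
    (by fun_prop)
  have hbd : ∀ x, ‖(m x x')⁻¹ • dm x x'‖ ≤ κ / ε := fun x =>
    norm_inv_smul_le h.pos (h.trans_ge x x') (hd.trans_le x x')
  have hi : Integrable (fun x => backward ξ m φ x' x • ((m x x')⁻¹ • dm x x')) ξ :=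
    (hb.integrable x').smul_bdd (κ / ε) hsm.aestronglyMeasurable (ae_of_all _ hbd)
  refine ⟨(∫ x, backward ξ m φ x' x • ((m x x')⁻¹ • dm x x') ∂ξ) + (γ x')⁻¹ • dγ x', ?_, ?_⟩
  · refine (norm_add_le _ _).trans ?_
    have h1 : ‖∫ x, backward ξ m φ x' x • ((m x x')⁻¹ • dm x x') ∂ξ‖ ≤ κ / ε := by
      have := norm_integral_le_of_norm_le ((hb.integrable x').mul_const (κ / ε))
        (f := fun x => backward ξ m φ x' x • ((m x x')⁻¹ • dm x x')) (ae_of_all _ fun x => by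
          rw [norm_smul, Real.norm_of_nonneg (hb.nonneg x' x)]
          exact mul_le_mul_of_nonneg_left (hbd x) (hb.nonneg x' x))
      rwa [integral_mul_const, hb.integral_eq_one, one_mul] at this
    linarith [norm_inv_smul_le h.pos (h.ge x') (hd.le x')]
  · simp only [scoreStep, smul_add]
    rw [integral_add (integrable_smul_of_osc (hb.integrable x') hs hB) hi, add_assoc]

include h hd in
lemma stronglyMeasurable_scoreStep (hφ : Measurable φ) (hs : StronglyMeasurable s) :
    StronglyMeasurable (scoreStep ξ m dm γ dγ φ s) := by
  refine StronglyMeasurable.add ?_ (h.measurable.inv.stronglyMeasurable.smul hd.meas)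
  have : StronglyMeasurable fun a : S × S =>
      backward ξ m φ a.1 a.2 • (s a.2 + (m a.2 a.1)⁻¹ • dm a.2 a.1) :=
    (h.measurable_backward hφ).stronglyMeasurable.smul ((hs.comp_measurable measurable_snd).add
      ((stronglyMeasurable_trans_score h hd).comp_measurable measurable_swap))
  exact this.integral_prod_right

include h hd in
/-- Oscillations of the conditional score stay bounded. -/
lemma scoreStep_osc {B : ℝ} (hφ : IsProbDensity ξ φ) (hs : StronglyMeasurable s)
    (hB : ∀ a b, ‖s a - s b‖ ≤ B) (a b : S) :
    ‖scoreStep ξ m dm γ dγ φ s a - scoreStep ξ m dm γ dγ φ s b‖ ≤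
      (1 - ε ^ 2) * B + 4 * (κ / ε) := by
  obtain ⟨v, hv, ev⟩ := scoreStep_split h hd hφ hs hB a
  obtain ⟨w, hw, ew⟩ := scoreStep_split h hd hφ hs hB b
  have hb := h.isTransitionDensity_backward hφ
  rw [ev, ew, add_sub_add_comm]
  refine (norm_add_le _ _).trans ?_
  have h1 := norm_integral_smul_sub_le (hb.integrable a) (hb.integrable b)
    (hφ.integrable.const_mul (ε ^ 2)) (h.backward_ge hφ a) (h.backward_ge hφ b)
    (hb.integral_eq_one a) (hb.integral_eq_one b) (δ := ε ^ 2)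
    (by rw [integral_const_mul, hφ.integral_eq_one, mul_one]) hs hB
  linarith [norm_sub_le v w]

include h hd in
/-- Contraction of the differences of conditional scores. -/
lemma scoreStep_sub_osc {B D η : ℝ} (hφ : IsProbDensity ξ φ) (hφ' : IsProbDensity ξ φ')
    (hη : 0 ≤ η) (hc : RelClose η φ φ') (hs : StronglyMeasurable s) (hs' : StronglyMeasurable s')
    (hB' : ∀ a b, ‖s' a - s' b‖ ≤ B)
    (hD : ∀ a b, ‖(s a - s' a) - (s b - s' b)‖ ≤ D) (a b : S) :
    ‖(scoreStep ξ m dm γ dγ φ s a - scoreStep ξ m dm γ dγ φ' s' a) -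
      (scoreStep ξ m dm γ dγ φ s b - scoreStep ξ m dm γ dγ φ' s' b)‖ ≤
      (1 - ε ^ 2) * D + 2 * (B + 2 * (κ / ε)) * η := by
  have hb := h.isTransitionDensity_backward hφ
  have hb' := h.isTransitionDensity_backward hφ'
  -- With the backward kernel of `φ` fixed, the difference `s - s'` is averaged and contracts below.
  -- The change of kernel from `φ` to `φ'` acts on the augmented score of `s'`, of oscillation at
  -- most `B + 2 κ / ε`, and costs a factor `η`.
  have key : ∀ x', ∃ v : E, ‖v‖ ≤ η * (B + 2 * (κ / ε)) ∧
      scoreStep ξ m dm γ dγ φ s x' - scoreStep ξ m dm γ dγ φ' s' x' =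
        (∫ x, backward ξ m φ x' x • (s x - s' x) ∂ξ) + v := by
    intro x'
    refine ⟨_, norm_integral_sub_le_of_le_mul (hb.integrable x') (hb'.integrable x') (hb.nonneg x')
      (hb.integral_eq_one x') (hb'.integral_eq_one x') hη (h.backward_le_mul hφ hφ' hc x')
      (stronglyMeasurable_augmented h hd hs' x') (augmented_osc h hd hB' x'), ?_⟩
    rw [scoreStep, scoreStep, add_sub_add_right_eq_sub, ← add_sub_assoc, ← integral_add
      (f := fun x => backward ξ m φ x' x • (s x - s' x))
      (integrable_smul_of_osc (hb.integrable x') (hs.sub hs') hD)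
      (integrable_smul_of_osc (hb.integrable x') (stronglyMeasurable_augmented h hd hs' x')
        (augmented_osc h hd hB' x'))]
    congr 2 with x
    rw [← smul_add]
    congr 1
    abel
  obtain ⟨v, hv, ev⟩ := key a
  obtain ⟨w, hw, ew⟩ := key b
  rw [ev, ew, add_sub_add_comm]
  refine (norm_add_le _ _).trans ?_
  have h1 := norm_integral_smul_sub_le (hb.integrable a) (hb.integrable b)
    (hφ.integrable.const_mul (ε ^ 2)) (h.backward_ge hφ a) (h.backward_ge hφ b)
    (hb.integral_eq_one a) (hb.integral_eq_one b) (δ := ε ^ 2)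
    (by rw [integral_const_mul, hφ.integral_eq_one, mul_one]) (hs.sub hs') hD
  simp only [Pi.sub_apply] at h1
  linarith [norm_sub_le v w]

end Step

lemma norm_sub_integral_le {B : ℝ} (hφ : IsProbDensity ξ φ) (hs : StronglyMeasurable s)
    (hB : ∀ a b, ‖s a - s b‖ ≤ B) (x : S) : ‖s x - ∫ x', φ x' • s x' ∂ξ‖ ≤ B := by
  have : s x - ∫ x', φ x' • s x' ∂ξ = ∫ x', φ x' • (s x - s x') ∂ξ := by
    simp_rw [smul_sub]
    rw [integral_sub (hφ.integrable.smul_const _) (integrable_smul_of_osc hφ.integrable hs hB),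
      integral_smul_const, hφ.integral_eq_one, one_smul]
  rw [this]
  have h1 := norm_integral_le_of_norm_le (hφ.integrable.mul_const B)
    (f := fun x' => φ x' • (s x - s x')) (ae_of_all _ fun x' => by
      rw [norm_smul, Real.norm_of_nonneg (hφ.nonneg x')]
      exact mul_le_mul_of_nonneg_left (hB x x') (hφ.nonneg x'))
  rwa [integral_mul_const, hφ.integral_eq_one, one_mul] at h1

lemma norm_tangent_le {B : ℝ} (hφ : IsProbDensity ξ φ) (hs : StronglyMeasurable s)
    (hB : ∀ a b, ‖s a - s b‖ ≤ B) (x : S) : ‖tangent ξ φ s x‖ ≤ B * φ x := by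
  rw [tangent, norm_smul, Real.norm_of_nonneg (hφ.nonneg x), mul_comm]
  exact mul_le_mul_of_nonneg_right (norm_sub_integral_le hφ hs hB x) (hφ.nonneg x)

lemma stronglyMeasurable_tangent (hφ : Measurable φ) (hs : StronglyMeasurable s) :
    StronglyMeasurable (tangent ξ φ s) :=
  hφ.stronglyMeasurable.smul (hs.sub stronglyMeasurable_const)

/-- Centring makes the tangent depend on scores through oscillations only. The three errors come
from `s - s'`, from the outer density, and from the density in the centring integral. -/
lemma norm_tangent_sub_le {B D η : ℝ} (hφ : IsProbDensity ξ φ) (hφ' : IsProbDensity ξ φ')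
    (hη : 0 ≤ η) (hc : RelClose η φ φ') (hs : StronglyMeasurable s) (hs' : StronglyMeasurable s')
    (hB : ∀ a b, ‖s a - s b‖ ≤ B) (hB' : ∀ a b, ‖s' a - s' b‖ ≤ B)
    (hD : ∀ a b, ‖(s a - s' a) - (s b - s' b)‖ ≤ D) (x : S) :
    ‖tangent ξ φ s x - tangent ξ φ' s' x‖ ≤ (D + 2 * B * η) * φ x := by
  have h0 := hφ.nonneg x
  have e : tangent ξ φ s x - tangent ξ φ' s' x =
      φ x • ((s - s') x - ∫ y, φ y • (s - s') y ∂ξ) +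
      (φ x - φ' x) • (s' x - ∫ y, φ' y • s' y ∂ξ) -
      φ x • ((∫ y, φ y • s' y ∂ξ) - ∫ y, φ' y • s' y ∂ξ) := by
    have h1 : ∫ y, φ y • (s - s') y ∂ξ = (∫ y, φ y • s y ∂ξ) - ∫ y, φ y • s' y ∂ξ := by
      simp_rw [Pi.sub_apply, smul_sub]
      exact integral_sub (integrable_smul_of_osc hφ.integrable hs hB)
        (integrable_smul_of_osc hφ.integrable hs' hB')
    rw [h1, tangent, tangent, Pi.sub_apply]
    module
  have h1 := norm_sub_integral_le hφ (hs.sub hs') hD x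
  have h2 := norm_sub_integral_le hφ' hs' hB' x
  have h3 := norm_integral_sub_le_of_le_mul hφ.integrable hφ'.integrable hφ.nonneg
    hφ.integral_eq_one hφ'.integral_eq_one hη (hc.le_mul hφ hφ' hη).1 hs' hB'
  have h4 := hc.abs_sub_le hφ hφ' hη x
  rw [e]
  refine (norm_sub_le _ _).trans ?_
  refine (add_le_add (norm_add_le _ _) le_rfl).trans ?_
  rw [norm_smul, norm_smul, norm_smul, Real.norm_of_nonneg h0, Real.norm_eq_abs]
  have h5 := mul_le_mul_of_nonneg_left h1 h0
  have h6 := mul_le_mul h4 h2 (norm_nonneg _) (mul_nonneg hη h0)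
  have h7 := mul_le_mul_of_nonneg_left h3 h0
  linarith

end Score

/-! ### Geometric forgetting of filters and conditional scores. -/

section FilterSequence

variable {S O E : Type*} [MeasurableSpace S] [MeasurableSpace O] [NormedAddCommGroup E]
  [NormedSpace ℝ E] [CompleteSpace E]

/-- The filter densities, computed recursively. -/
def filt (ξ : Measure S) (m₀ : S → ℝ) (m : S → S → ℝ) (g : S → O → ℝ) (y : ℕ → O) : ℕ → S → ℝ
  | 0 => fun x => g x (y 0) * m₀ x / ∫ x', g x' (y 0) * m₀ x' ∂ξ
  | t + 1 => filterStep ξ m (fun x => g x (y (t + 1))) (filt ξ m₀ m g y t)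

/-- The conditional expectation of the joint score given the current state and the observations,
computed recursively. -/
def score (ξ : Measure S) (m₀ : S → ℝ) (m : S → S → ℝ) (g : S → O → ℝ) (dm : S → S → E)
    (dg : S → O → E) (y : ℕ → O) : ℕ → S → E
  | 0 => fun x => (g x (y 0))⁻¹ • dg x (y 0)
  | t + 1 => scoreStep ξ m dm (fun x => g x (y (t + 1))) (fun x => dg x (y (t + 1)))
      (filt ξ m₀ m g y t) (score ξ m₀ m g dm dg y t)

/-- Two-sided bounds on a state-space model. -/
structure ModelBounds (ξ : Measure S) (ε : ℝ) (m₀ : S → ℝ) (m : S → S → ℝ) (g : S → O → ℝ) :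
    Prop where
  initial : IsProbDensity ξ m₀
  step : ∀ y, StepBounds ξ ε m fun x => g x y
  measurable : Measurable (Function.uncurry g)

/-- Bounds on the gradients of a state-space model. -/
structure ModelGradBounds (κ : ℝ) (dm : S → S → E) (dg : S → O → E) : Prop where
  step : ∀ y, GradBounds κ dm fun x => dg x y

variable {ξ : Measure S} [IsFiniteMeasure ξ] {ε κ : ℝ} {m₀ : S → ℝ} {m : S → S → ℝ}
  {g : S → O → ℝ} {dm : S → S → E} {dg : S → O → E}

section Density

variable (h : ModelBounds ξ ε m₀ m g)
include h

lemma integrable_mul_initial (y : O) : Integrable (fun x => g x y * m₀ x) ξ :=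
  h.initial.integrable.bdd_mul (c := ε⁻¹) (h.step y).measurable.aestronglyMeasurable
    (ae_of_all _ fun x => by
      rw [Real.norm_of_nonneg ((h.step y).nonneg x)]
      exact (h.step y).le x)

lemma integral_mul_initial_ge (y : O) : ε ≤ ∫ x, g x y * m₀ x ∂ξ := by
  have := integral_mono (h.initial.integrable.const_mul ε) (integrable_mul_initial h y)
    fun x => mul_le_mul_of_nonneg_right ((h.step y).ge x) (h.initial.nonneg x)
  rwa [integral_const_mul, h.initial.integral_eq_one, mul_one] at this

lemma isProbDensity_filt (y : ℕ → O) (t : ℕ) : IsProbDensity ξ (filt ξ m₀ m g y t) := by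
  induction t with
  | zero =>
    have hZ := (h.step (y 0)).pos.trans_le (integral_mul_initial_ge h (y 0))
    refine ⟨((h.step (y 0)).measurable.mul h.initial.measurable).div_const _, fun x =>
      div_nonneg (mul_nonneg ((h.step (y 0)).nonneg x) (h.initial.nonneg x)) hZ.le, ?_⟩
    simp only [filt]
    rw [integral_div, div_self hZ.ne']
  | succ t ih => exact (h.step (y (t + 1))).isProbDensity_filterStep ih

/-- An integrable envelope free of the parameter, used to dominate when differentiating under
integrals. The term `m₀` serves time `0` only, because `m₀` need not be bounded. -/
lemma filt_le (y : ℕ → O) (t : ℕ) (x : S) :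
    filt ξ m₀ m g y t x ≤ ε⁻¹ ^ 5 * (1 + m₀ x) := by
  have hs := h.step (y 0)
  have hε := hs.pos
  have hε1 : 1 ≤ ε⁻¹ := (one_le_inv₀ hε).2 hs.le_one
  have hm := h.initial.nonneg x
  cases t with
  | zero =>
    have hZ := hε.trans_le (integral_mul_initial_ge h (y 0))
    simp only [filt]
    rw [div_le_iff₀ hZ]
    have h1 : g x (y 0) * m₀ x ≤ ε⁻¹ * m₀ x := mul_le_mul_of_nonneg_right (hs.le x) hm
    have h2 : ε⁻¹ ^ 2 ≤ ε⁻¹ ^ 5 := pow_le_pow_right₀ hε1 (by norm_num)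
    calc g x (y 0) * m₀ x ≤ ε⁻¹ * m₀ x := h1
      _ = ε⁻¹ ^ 2 * m₀ x * ε := by field_simp
      _ ≤ ε⁻¹ ^ 5 * (1 + m₀ x) * ε := by gcongr; linarith
      _ ≤ _ := by have := integral_mul_initial_ge h (y 0); gcongr
  | succ t =>
    refine ((h.step (y (t + 1))).filterStep_le (isProbDensity_filt h y t) x).trans ?_
    exact le_mul_of_one_le_right (by positivity) (by linarith)

lemma measurable_filt (t : ℕ) :
    Measurable fun a : (ℕ → O) × S => filt ξ m₀ m g a.1 t a.2 := by
  induction t with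
  | zero =>
    have h1 : Measurable fun a : (ℕ → O) × S => g a.2 (a.1 0) * m₀ a.2 :=
      (h.measurable.comp (f := fun a : (ℕ → O) × S => (a.2, a.1 0)) (by fun_prop)).mul
        (h.initial.measurable.comp measurable_snd)
    have h2 : Measurable fun y : ℕ → O => ∫ x, g x (y 0) * m₀ x ∂ξ :=
      h1.stronglyMeasurable.integral_prod_right.measurable
    exact h1.div (h2.comp measurable_fst)
  | succ t ih =>
    have h0 : Measurable fun a : (ℕ → O) × S =>
        predict ξ m (filt ξ m₀ m g a.1 t) a.2 := by
      -- The bounds on `m` are bundled with the likelihood of an observation, so some observation is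
      -- needed to access them.
      rcases isEmpty_or_nonempty O with hO | ⟨⟨y₀⟩⟩
      · have : IsEmpty ((ℕ → O) × S) := ⟨fun a => hO.false (a.1 0)⟩
        exact measurable_of_empty _
      have : Measurable fun a : ((ℕ → O) × S) × S => m a.2 a.1.2 * filt ξ m₀ m g a.1.1 t a.2 :=
        ((h.step y₀).trans.measurable.comp (f := fun a : ((ℕ → O) × S) × S => (a.2, a.1.2))
          (by fun_prop)).mul
          (ih.comp (f := fun a : ((ℕ → O) × S) × S => (a.1.1, a.2)) (by fun_prop))
      exact this.stronglyMeasurable.integral_prod_right.measurable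
    have h1 : Measurable fun a : (ℕ → O) × S =>
        g a.2 (a.1 (t + 1)) * predict ξ m (filt ξ m₀ m g a.1 t) a.2 :=
      (h.measurable.comp (f := fun a : (ℕ → O) × S => (a.2, a.1 (t + 1))) (by fun_prop)).mul h0
    have h2 : Measurable fun y : ℕ → O =>
        ∫ x, g x (y (t + 1)) * predict ξ m (filt ξ m₀ m g y t) x ∂ξ :=
      h1.stronglyMeasurable.integral_prod_right.measurable
    exact h1.div (h2.comp measurable_fst)

end Density

lemma dependsOn_filt (t : ℕ) :
    DependsOn (fun y : ℕ → O => filt ξ m₀ m g y t) (Set.Iic t) := by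
  induction t with
  | zero =>
    intro y y' hy
    simp only [filt, hy 0 (by simp)]
  | succ t ih =>
    intro y y' hy
    have := ih fun i hi => hy i (by
      have : i ≤ t := hi
      simp only [Set.mem_Iic]; omega)
    simp only [filt, this, hy (t + 1) (by simp)]

lemma stronglyMeasurable_score (h : ModelBounds ξ ε m₀ m g) (hd : ModelGradBounds κ dm dg)
    (y : ℕ → O) (t : ℕ) : StronglyMeasurable (score ξ m₀ m g dm dg y t) := by
  induction t with
  | zero => exact (h.step (y 0)).measurable.inv.stronglyMeasurable.smul (hd.step (y 0)).meas
  | succ t ih =>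
    exact stronglyMeasurable_scoreStep (h.step _) (hd.step _) (isProbDensity_filt h y t).measurable
      ih

/-- The bound on the oscillations of the conditional scores. -/
def oscBound (ε κ : ℝ) : ℝ := 4 * (κ / ε) / ε ^ 2

/-- The constant in the forgetting bounds. -/
def forgetBound (ε κ : ℝ) : ℝ :=
  2 * oscBound ε κ + (2 * (2 * (oscBound ε κ + 2 * (κ / ε))) / ε ^ 2 + 1) * ε⁻¹ ^ 4

/-- The forgetting rate. -/
def forgetRate (ε : ℝ) : ℝ := 1 - ε ^ 2 / 2

lemma oscBound_nonneg (hε : 0 < ε) (hκ : 0 ≤ κ) : 0 ≤ oscBound ε κ := by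
  unfold oscBound; positivity

lemma forgetBound_nonneg (hε : 0 < ε) (hκ : 0 ≤ κ) : 0 ≤ forgetBound ε κ := by
  have := oscBound_nonneg hε hκ
  unfold forgetBound; positivity

lemma forgetRate_pos (hε : 0 < ε) (hε1 : ε ≤ 1) : 0 < forgetRate ε := by
  unfold forgetRate; nlinarith

lemma forgetRate_lt_one (hε : 0 < ε) : forgetRate ε < 1 := by
  unfold forgetRate; nlinarith

lemma score_osc (h : ModelBounds ξ ε m₀ m g) (hd : ModelGradBounds κ dm dg)
    (y : ℕ → O) (t : ℕ) (a b : S) :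
    ‖score ξ m₀ m g dm dg y t a - score ξ m₀ m g dm dg y t b‖ ≤ oscBound ε κ := by
  have hs := h.step (y 0)
  have hε := hs.pos
  have hκ := (hd.step (y 0)).nonneg
  induction t generalizing a b with
  | zero =>
    simp only [score]
    refine (norm_sub_le _ _).trans ?_
    have h1 := norm_inv_smul_le hε (hs.ge a) ((hd.step (y 0)).le a)
    have h2 := norm_inv_smul_le hε (hs.ge b) ((hd.step (y 0)).le b)
    have h3 : 4 * (κ / ε) ≤ oscBound ε κ := by
      rw [oscBound, le_div_iff₀ (by positivity)]
      exact mul_le_of_le_one_right (by positivity) (pow_le_one₀ hε.le hs.le_one)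
    have : 0 ≤ κ / ε := by positivity
    linarith
  | succ t ih =>
    refine (scoreStep_osc (h.step _) (hd.step _) (isProbDensity_filt h y t)
      (stronglyMeasurable_score h hd y t) ih a b).trans (le_of_eq ?_)
    -- `oscBound` is the fixed point of `B ↦ (1 - ε ^ 2) B + 4 κ / ε`.
    rw [oscBound]
    field_simp
    ring

/-- The restarted filter begins from `m₀` at time `j` and may initially be incomparable with the
true one. One step makes them comparable, hence the index `k + 1`; each later step contracts. -/
lemma relClose_filt_shift (h : ModelBounds ξ ε m₀ m g) (y : ℕ → O) (j k : ℕ) :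
    RelClose ((1 - ε ^ 2) ^ k * ε⁻¹ ^ 4) (filt ξ m₀ m g y (j + (k + 1)))
      (filt ξ m₀ m g (shift j y) (k + 1)) := by
  induction k with
  | zero =>
    rw [pow_zero, one_mul]
    exact (h.step _).relClose_filterStep (isProbDensity_filt h y j)
      (isProbDensity_filt h (shift j y) 0)
  | succ k ih =>
    have hs := h.step (y 0)
    have hε2 : 0 ≤ 1 - ε ^ 2 := by
      have := pow_le_one₀ hs.pos.le hs.le_one (n := 2)
      linarith
    have hε := hs.pos
    have := (h.step (y (j + (k + 1) + 1))).relClose_filterStep_of_relClose (by positivity)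
      (isProbDensity_filt h y (j + (k + 1))) (isProbDensity_filt h (shift j y) (k + 1)) ih
    rwa [← mul_assoc, ← pow_succ'] at this

lemma score_sub_shift_osc (h : ModelBounds ξ ε m₀ m g) (hd : ModelGradBounds κ dm dg)
    (y : ℕ → O) (j k : ℕ) (a b : S) :
    ‖(score ξ m₀ m g dm dg y (j + (k + 1)) a - score ξ m₀ m g dm dg (shift j y) (k + 1) a) -
      (score ξ m₀ m g dm dg y (j + (k + 1)) b - score ξ m₀ m g dm dg (shift j y) (k + 1) b)‖ ≤
      forgetRate ε ^ k * (2 * oscBound ε κ +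
        2 * (2 * (oscBound ε κ + 2 * (κ / ε))) / ε ^ 2 * ε⁻¹ ^ 4) := by
  have hs := h.step (y 0)
  have hε := hs.pos
  have hκ := (hd.step (y 0)).nonneg
  have hB := oscBound_nonneg hε hκ
  have hε2 : 0 ≤ 1 - ε ^ 2 := by
    have := pow_le_one₀ hs.pos.le hs.le_one (n := 2)
    linarith
  induction k generalizing a b with
  | zero =>
    rw [sub_sub_sub_comm, pow_zero, one_mul]
    refine (norm_sub_le _ _).trans ?_
    have : 0 ≤ 2 * (2 * (oscBound ε κ + 2 * (κ / ε))) / ε ^ 2 * ε⁻¹ ^ 4 := by positivity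
    linarith [score_osc h hd y (j + (0 + 1)) a b, score_osc h hd (shift j y) (0 + 1) a b]
  | succ k ih =>
    refine (scoreStep_sub_osc (h.step (y (j + (k + 1) + 1))) (hd.step _)
      (isProbDensity_filt h y (j + (k + 1))) (isProbDensity_filt h (shift j y) (k + 1))
      (by positivity) (relClose_filt_shift h y j k)
      (stronglyMeasurable_score h hd _ _) (stronglyMeasurable_score h hd _ _)
      (score_osc h hd _ _) ih a b).trans ?_
    -- The score recursion contracts at rate `1 - ε ^ 2` and is driven by a filter error decaying at
    -- that same rate. Passing to the slower rate `r = 1 - ε ^ 2 / 2` absorbs the resonance: `A` is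
    -- chosen so that the forcing term is at most `(ε ^ 2 / 2) A`.
    set B := oscBound ε κ
    set c := 2 * (B + 2 * (κ / ε))
    have hr := forgetRate_pos hε hs.le_one
    set r := forgetRate ε with hrdef
    set A := 2 * B + 2 * c / ε ^ 2 * ε⁻¹ ^ 4 with hA
    have hc : 0 ≤ c := by positivity
    have h1 : (1 - ε ^ 2) ^ k ≤ r ^ k := pow_le_pow_left₀ hε2 (by
      rw [hrdef, forgetRate]; nlinarith) k
    have h2 : c * ε⁻¹ ^ 4 ≤ ε ^ 2 / 2 * A := by
      have : ε ^ 2 / 2 * A = ε ^ 2 * B + c * ε⁻¹ ^ 4 := by rw [hA]; field_simp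
      rw [this]
      have : 0 ≤ ε ^ 2 * B := by positivity
      linarith
    calc (1 - ε ^ 2) * (r ^ k * A) + c * ((1 - ε ^ 2) ^ k * ε⁻¹ ^ 4)
        ≤ (1 - ε ^ 2) * (r ^ k * A) + c * (r ^ k * ε⁻¹ ^ 4) := by gcongr
      _ = r ^ k * ((1 - ε ^ 2) * A + c * ε⁻¹ ^ 4) := by ring
      _ ≤ r ^ k * ((1 - ε ^ 2) * A + ε ^ 2 / 2 * A) := by gcongr
      _ = r ^ (k + 1) * A := by rw [hrdef, forgetRate]; ring

/-- Geometric forgetting of the filter. -/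
lemma relClose_filt_forget (h : ModelBounds ξ ε m₀ m g) (hκ : 0 ≤ κ) (y : ℕ → O) (j k : ℕ) :
    RelClose (forgetBound ε κ * forgetRate ε ^ k) (filt ξ m₀ m g y (j + (k + 1)))
      (filt ξ m₀ m g (shift j y) (k + 1)) := by
  have hs := h.step (y 0)
  have hε := hs.pos
  have hB := oscBound_nonneg hε hκ
  have hε2 : 0 ≤ 1 - ε ^ 2 := by
    have := pow_le_one₀ hs.pos.le hs.le_one (n := 2)
    linarith
  refine (relClose_filt_shift h y j k).mono (isProbDensity_filt h y _).nonneg ?_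
  have h1 : (1 - ε ^ 2) ^ k ≤ forgetRate ε ^ k := pow_le_pow_left₀ hε2 (by
      rw [forgetRate]; nlinarith) k
  have h2 : ε⁻¹ ^ 4 ≤ forgetBound ε κ := by
    have : 0 ≤ 2 * oscBound ε κ + 2 * (2 * (oscBound ε κ + 2 * (κ / ε))) / ε ^ 2 * ε⁻¹ ^ 4 := by
      positivity
    rw [forgetBound]
    linarith
  rw [mul_comm]
  have := forgetRate_pos hε hs.le_one
  have := forgetBound_nonneg hε hκ
  gcongr

/-- Geometric forgetting of the conditional scores. -/
lemma score_osc_forget (h : ModelBounds ξ ε m₀ m g) (hd : ModelGradBounds κ dm dg)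
    (y : ℕ → O) (j k : ℕ) (a b : S) :
    ‖(score ξ m₀ m g dm dg y (j + (k + 1)) a - score ξ m₀ m g dm dg (shift j y) (k + 1) a) -
      (score ξ m₀ m g dm dg y (j + (k + 1)) b - score ξ m₀ m g dm dg (shift j y) (k + 1) b)‖ ≤
      forgetBound ε κ * forgetRate ε ^ k := by
  have hs := h.step (y 0)
  have hε := hs.pos
  refine (score_sub_shift_osc h hd y j k a b).trans ?_
  rw [mul_comm]
  have := forgetRate_pos hε hs.le_one
  refine mul_le_mul_of_nonneg_right ?_ (by positivity)
  have : 0 ≤ ε⁻¹ ^ 4 := by positivity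
  rw [forgetBound]
  linarith

end FilterSequence

/-! ### Identification of the filter density with the recursion. -/

section FilterDensity

variable {S O : Type*} [MeasurableSpace S] [MeasurableSpace O]
  {ξ : Measure S} [IsFiniteMeasure ξ] {ε : ℝ} {m₀ : S → ℝ} {m : S → S → ℝ} {g : S → O → ℝ}

lemma ModelBounds.measurable_jointDensity (h : ModelBounds ξ ε m₀ m g) (y : ℕ → O) (t : ℕ) :
    Measurable fun x : Fin (t + 1) → S => jointDensity m₀ m g t x fun s => y s :=
  (OSIWAE.measurable_jointDensity h.initial.measurable (h.step (y 0)).trans.measurable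
    h.measurable t).comp (f := fun x : Fin (t + 1) → S => (x, fun s : Fin (t + 1) => y s))
    (by fun_prop)

lemma ModelBounds.integrable_jointDensity (h : ModelBounds ξ ε m₀ m g) (y : ℕ → O) (t : ℕ) :
    Integrable (fun x : Fin (t + 1) → S => jointDensity m₀ m g t x fun s => y s)
      (Measure.pi fun _ => ξ) := by
  have hi : Integrable (fun x : Fin (t + 1) → S => m₀ (x 0)) (Measure.pi fun _ => ξ) :=
    integrable_comp_eval (μ := fun _ : Fin (t + 1) => ξ) (i := 0) h.initial.integrable
  have hε := (h.step (y 0)).pos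
  refine (hi.mul_const (ε⁻¹ * (ε⁻¹ * ε⁻¹) ^ t)).mono'
    (h.measurable_jointDensity y t).aestronglyMeasurable (ae_of_all _ fun x => ?_)
  rw [Real.norm_of_nonneg (jointDensity_nonneg h.initial.nonneg (h.step (y 0)).trans_nonneg
    (fun x y => (h.step y).nonneg x) t x _), jointDensity, mul_assoc]
  refine mul_le_mul_of_nonneg_left ?_ (h.initial.nonneg _)
  refine mul_le_mul ((h.step _).le _) ?_ (Finset.prod_nonneg fun i _ => mul_nonneg
    ((h.step (y 0)).trans_nonneg _ _) ((h.step _).nonneg _)) (by positivity)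
  calc ∏ i : Fin t, m (x i.castSucc) (x i.succ) * g (x i.succ) (y (i.succ : Fin (t + 1)))
      ≤ ∏ _i : Fin t, ε⁻¹ * ε⁻¹ := Finset.prod_le_prod
        (fun i _ => mul_nonneg ((h.step (y 0)).trans_nonneg _ _) ((h.step _).nonneg _))
        (fun i _ => mul_le_mul ((h.step (y 0)).trans_le _ _) ((h.step _).le _)
          ((h.step _).nonneg _) (by positivity))
    _ = (ε⁻¹ * ε⁻¹) ^ t := by simp

/-- Integrating out the oldest states first reproduces prediction and update without normalisation.
The constant `c`, the likelihood of the observations, is independent of `x` and cancels in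
`filterDensity`. -/
lemma exists_numerator_eq (h : ModelBounds ξ ε m₀ m g) (y : ℕ → O) (t : ℕ) :
    ∃ c : ℝ, 0 < c ∧ ∀ x, (∫ x' : Fin t → S, jointDensity m₀ m g t
      (Fin.snoc (α := fun _ => S) x' x) (fun s => y s) ∂Measure.pi fun _ => ξ) =
        c * filt ξ m₀ m g y t x := by
  induction t with
  | zero =>
    have hZ := (h.step (y 0)).pos.trans_le (integral_mul_initial_ge h (y 0))
    refine ⟨_, hZ, fun x => ?_⟩
    simp only [filt]
    rw [mul_div_cancel₀ _ hZ.ne', Measure.pi_of_empty, integral_dirac]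
    simp [jointDensity, Fin.snoc, mul_comm]
  | succ t ih =>
    obtain ⟨c, hc, ih⟩ := ih
    have hst := h.step (y (t + 1))
    have hφ := isProbDensity_filt h y t
    have hZ := hst.integral_mul_predict_pos hφ
    refine ⟨c * ∫ x', g x' (y (t + 1)) * predict ξ m (filt ξ m₀ m g y t) x' ∂ξ, mul_pos hc hZ,
      fun x => ?_⟩
    have hi := (h.integrable_jointDensity y t).mul_bdd (c := ε⁻¹)
      (g := fun v : Fin (t + 1) → S => m (v (Fin.last t)) x)
      ((hst.measurable_left x).comp (measurable_pi_apply (Fin.last t))).aestronglyMeasurable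
      (ae_of_all _ fun v => by
        rw [Real.norm_of_nonneg (hst.trans_nonneg _ _)]
        exact hst.trans_le _ _)
    have e1 : ∀ v : Fin (t + 1) → S, jointDensity m₀ m g (t + 1)
        (Fin.snoc (α := fun _ => S) v x) (fun s => y s) =
        g x (y (t + 1)) * ((jointDensity m₀ m g t v fun s => y s) * m (v (Fin.last t)) x) := by
      intro v
      rw [jointDensity_succ]
      simp only [Fin.snoc_castSucc, Fin.snoc_last, Fin.val_castSucc, Fin.val_last]
      ring
    simp_rw [e1]
    rw [integral_const_mul, integral_pi_insertNth ξ (Fin.last t),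
      integral_prod _ (integrable_pi_insertNth ξ (Fin.last t) hi)]
    simp only [Fin.insertNth_last', Fin.snoc_last]
    simp_rw [integral_mul_const, ih]
    simp only [filt, filterStep]
    rw [mul_assoc c, mul_div_cancel₀ _ hZ.ne', predict, ← integral_const_mul,
      ← integral_const_mul, ← integral_const_mul]
    congr 1 with a
    ring

/-- The filter densities satisfy the filtering recursion. -/
lemma filterDensity_eq_filt (h : ModelBounds ξ ε m₀ m g) (y : ℕ → O) (t : ℕ) :
    filterDensity ξ m₀ m g y t = filt ξ m₀ m g y t := by
  obtain ⟨c, hc, H⟩ := exists_numerator_eq h y t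
  funext x
  rw [filterDensity, H, integral_pi_insertNth ξ (Fin.last t),
    integral_prod _ (integrable_pi_insertNth ξ (Fin.last t) (h.integrable_jointDensity y t))]
  simp only [Fin.insertNth_last']
  simp_rw [H]
  rw [integral_const_mul, (isProbDensity_filt h y t).integral_eq_one, mul_one,
    mul_div_cancel_left₀ _ hc.ne']

end FilterDensity

/-! ### Invariance of the score recursion under additive constants. -/

section Shift

variable {S E : Type*} [MeasurableSpace S] [NormedAddCommGroup E] [NormedSpace ℝ E]
  [CompleteSpace E] {ξ : Measure S} [IsFiniteMeasure ξ] {ε κ B : ℝ} {m : S → S → ℝ}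
  {γ φ : S → ℝ} {dm : S → S → E} {dγ : S → E} {s : S → E}

lemma tangent_sub_const (hφ : IsProbDensity ξ φ) (hs : StronglyMeasurable s)
    (hB : ∀ a b, ‖s a - s b‖ ≤ B) (c : E) :
    tangent ξ φ (fun x => s x - c) = tangent ξ φ s := by
  funext x
  simp only [tangent, smul_sub]
  rw [integral_sub (integrable_smul_of_osc hφ.integrable hs hB) (hφ.integrable.smul_const _),
    integral_smul_const, hφ.integral_eq_one]
  module

/-- Backward kernels have mass one, so constants pass through. This permits recentring the score by
its filter mean before each step, which bounds it uniformly in the parameter. -/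
lemma scoreStep_sub_const (h : StepBounds ξ ε m γ) (hd : GradBounds κ dm dγ)
    (hφ : IsProbDensity ξ φ) (hs : StronglyMeasurable s)
    (hB : ∀ a b, ‖s a - s b‖ ≤ B) (c : E) :
    scoreStep ξ m dm γ dγ φ (fun x => s x - c) = fun x => scoreStep ξ m dm γ dγ φ s x - c := by
  funext x'
  have hb := h.isTransitionDensity_backward hφ
  simp only [scoreStep, sub_add_eq_add_sub, smul_sub]
  rw [integral_sub (integrable_smul_of_osc (hb.integrable x')
      (stronglyMeasurable_augmented h hd hs x')
    (augmented_osc h hd hB x')) ((hb.integrable x').smul_const _),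
    integral_smul_const, hb.integral_eq_one]
  module

lemma norm_scoreStep_le (h : StepBounds ξ ε m γ) (hd : GradBounds κ dm dγ)
    (hφ : IsProbDensity ξ φ) (hs : StronglyMeasurable s) (hB : ∀ a, ‖s a‖ ≤ B) (x' : S) :
    ‖scoreStep ξ m dm γ dγ φ s x'‖ ≤ B + 2 * (κ / ε) := by
  have hb := h.isTransitionDensity_backward hφ
  obtain ⟨v, hv, ev⟩ := scoreStep_split h hd hφ hs (B := B + B)
    (fun a b => (norm_sub_le _ _).trans (add_le_add (hB a) (hB b))) x'
  rw [ev]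
  refine (norm_add_le _ _).trans (add_le_add ?_ hv)
  have := norm_integral_le_of_norm_le ((hb.integrable x').mul_const B)
    (f := fun x => backward ξ m φ x' x • s x) (ae_of_all _ fun x => by
      rw [norm_smul, Real.norm_of_nonneg (hb.nonneg x' x)]
      exact mul_le_mul_of_nonneg_left (hB x) (hb.nonneg x' x))
  rwa [integral_mul_const, hb.integral_eq_one, one_mul] at this

end Shift

/-! ### Fisher's identity: the tangent filter is the gradient of the filter. -/

section Parametric

variable {p : ℕ} {S O : Type*} [MeasurableSpace S] [MeasurableSpace O]

/-- The gradient in the parameter of a family of kernels. -/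
def paramGrad {A B : Type*} (k : EuclideanSpace ℝ (Fin p) → A → B → ℝ)
    (θ : EuclideanSpace ℝ (Fin p)) (a : A) (b : B) : EuclideanSpace ℝ (Fin p) :=
  gradient (fun θ' => k θ' a b) θ

/-- A parametric state-space model satisfying the strong mixing and bounded gradient
assumptions. -/
structure ParamModel (ξ : Measure S) (Θ : Set (EuclideanSpace ℝ (Fin p))) (ε κ : ℝ) (m₀ : S → ℝ)
    (m : EuclideanSpace ℝ (Fin p) → S → S → ℝ) (g : EuclideanSpace ℝ (Fin p) → S → O → ℝ) :
    Prop where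
  isOpen : IsOpen Θ
  bounds : ∀ θ ∈ Θ, ModelBounds ξ ε m₀ (m θ) (g θ)
  diff_trans : ∀ θ ∈ Θ, ∀ x x', DifferentiableAt ℝ (fun θ' => m θ' x x') θ ∧
      ‖gradient (fun θ' => m θ' x x') θ‖ ≤ κ
  diff_emission : ∀ θ ∈ Θ, ∀ x y, DifferentiableAt ℝ (fun θ' => g θ' x y) θ ∧
      ‖gradient (fun θ' => g θ' x y) θ‖ ≤ κ

variable {ξ : Measure S} [IsFiniteMeasure ξ] {Θ : Set (EuclideanSpace ℝ (Fin p))} {ε κ : ℝ}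
  {m₀ : S → ℝ} {m : EuclideanSpace ℝ (Fin p) → S → S → ℝ}
  {g : EuclideanSpace ℝ (Fin p) → S → O → ℝ} {θ : EuclideanSpace ℝ (Fin p)}

/-- The conditional score of the parametric model. -/
def paramScore (ξ : Measure S) (m₀ : S → ℝ) (m : EuclideanSpace ℝ (Fin p) → S → S → ℝ)
    (g : EuclideanSpace ℝ (Fin p) → S → O → ℝ) (θ : EuclideanSpace ℝ (Fin p)) (y : ℕ → O)
    (t : ℕ) : S → EuclideanSpace ℝ (Fin p) :=
  score ξ m₀ (m θ) (g θ) (paramGrad m θ) (paramGrad g θ) y t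

/-- The tangent filter of the parametric model, expressed through the conditional score. -/
def paramTangent (ξ : Measure S) (m₀ : S → ℝ) (m : EuclideanSpace ℝ (Fin p) → S → S → ℝ)
    (g : EuclideanSpace ℝ (Fin p) → S → O → ℝ) (θ : EuclideanSpace ℝ (Fin p)) (y : ℕ → O)
    (t : ℕ) : S → EuclideanSpace ℝ (Fin p) :=
  tangent ξ (filt ξ m₀ (m θ) (g θ) y t) (paramScore ξ m₀ m g θ y t)

namespace ParamModel

variable (h : ParamModel ξ Θ ε κ m₀ m g)
include h

lemma hasGradientAt_trans (hθ : θ ∈ Θ) (x x' : S) :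
    HasGradientAt (fun θ' => m θ' x x') (paramGrad m θ x x') θ :=
  (h.diff_trans θ hθ x x').1.hasGradientAt

lemma hasGradientAt_emission (hθ : θ ∈ Θ) (x : S) (y : O) :
    HasGradientAt (fun θ' => g θ' x y) (paramGrad g θ x y) θ :=
  (h.diff_emission θ hθ x y).1.hasGradientAt

lemma grad_nonneg (hθ : θ ∈ Θ) : 0 ≤ κ := by
  obtain ⟨x⟩ := (h.bounds θ hθ).initial.nonempty
  exact (norm_nonneg _).trans (h.diff_trans θ hθ x x).2

lemma gradBounds (hθ : θ ∈ Θ) : ModelGradBounds κ (paramGrad m θ) (paramGrad g θ) where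
  step y :=
    { nonneg := h.grad_nonneg hθ
      trans_meas := (measurable_of_hasGradientAt h.isOpen hθ (A := S × S)
        (F := fun θ' a => m θ' a.1 a.2) (fun θ' hθ' => ((h.bounds θ' hθ').step y).trans.measurable)
        (fun a => h.hasGradientAt_trans hθ a.1 a.2)).stronglyMeasurable
      trans_le := fun x x' => (h.diff_trans θ hθ x x').2
      meas := (measurable_of_hasGradientAt h.isOpen hθ (F := fun θ' x => g θ' x y)
        (fun θ' hθ' => ((h.bounds θ' hθ').step y).measurable)
        (fun x => h.hasGradientAt_emission hθ x y)).stronglyMeasurable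
      le := fun x => (h.diff_emission θ hθ x y).2 }

lemma stronglyMeasurable_paramScore (hθ : θ ∈ Θ) (y : ℕ → O) (t : ℕ) :
    StronglyMeasurable (paramScore ξ m₀ m g θ y t) :=
  stronglyMeasurable_score (h.bounds θ hθ) (h.gradBounds hθ) y t

lemma paramScore_osc (hθ : θ ∈ Θ) (y : ℕ → O) (t : ℕ) (a b : S) :
    ‖paramScore ξ m₀ m g θ y t a - paramScore ξ m₀ m g θ y t b‖ ≤ oscBound ε κ :=
  score_osc (h.bounds θ hθ) (h.gradBounds hθ) y t a b

lemma norm_paramTangent_le (hθ : θ ∈ Θ) (y : ℕ → O) (t : ℕ) (x : S) :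
    ‖paramTangent ξ m₀ m g θ y t x‖ ≤ oscBound ε κ * filt ξ m₀ (m θ) (g θ) y t x :=
  norm_tangent_le (isProbDensity_filt (h.bounds θ hθ) y t)
    (h.stronglyMeasurable_paramScore hθ y t) (h.paramScore_osc hθ y t) x

lemma stronglyMeasurable_paramTangent (hθ : θ ∈ Θ) (y : ℕ → O) (t : ℕ) :
    StronglyMeasurable (paramTangent ξ m₀ m g θ y t) :=
  stronglyMeasurable_tangent (isProbDensity_filt (h.bounds θ hθ) y t).measurable
    (h.stronglyMeasurable_paramScore hθ y t)

end ParamModel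

/-- Differentiation of a normalised family of functions. -/
lemma hasGradientAt_normalize (hΘ : IsOpen Θ) (hθ : θ ∈ Θ)
    {N : EuclideanSpace ℝ (Fin p) → S → ℝ}
    {w : EuclideanSpace ℝ (Fin p) → S → EuclideanSpace ℝ (Fin p)} {env : S → ℝ} {C : ℝ}
    (hNm : ∀ θ' ∈ Θ, Measurable (N θ')) (hN0 : ∀ θ' ∈ Θ, ∀ x, 0 ≤ N θ' x)
    (hNe : ∀ θ' ∈ Θ, ∀ x, N θ' x ≤ env x) (he : Integrable env ξ)
    (hw : StronglyMeasurable (w θ)) (hwC : ∀ θ' ∈ Θ, ∀ x, ‖w θ' x‖ ≤ C)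
    (hZ : 0 < ∫ x, N θ x ∂ξ)
    (hd : ∀ θ' ∈ Θ, ∀ x, HasGradientAt (fun θ'' => N θ'' x) (N θ' x • w θ' x) θ') (x : S) :
    HasGradientAt (fun θ' => N θ' x / ∫ x', N θ' x' ∂ξ)
      (tangent ξ (fun x => N θ x / ∫ x', N θ x' ∂ξ) (w θ) x) θ := by
  have hNi : Integrable (N θ) ξ := he.mono' (hNm θ hθ).aestronglyMeasurable
    (ae_of_all _ fun x => by rw [Real.norm_of_nonneg (hN0 θ hθ x)]; exact hNe θ hθ x)
  have hI : HasGradientAt (fun θ' => ∫ x', N θ' x' ∂ξ) (∫ x', N θ x' • w θ x' ∂ξ) θ :=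
    hasGradientAt_integral hΘ hθ (G := fun θ' x => N θ' x • w θ' x) (bound := fun x => env x * C)
      (fun θ' hθ' => (hNm θ' hθ').aestronglyMeasurable) hNi
      ((hNm θ hθ).stronglyMeasurable.smul hw).aestronglyMeasurable
      (fun θ' hθ' x => by
        rw [norm_smul, Real.norm_of_nonneg (hN0 θ' hθ' x)]
        exact mul_le_mul (hNe θ' hθ' x) (hwC θ' hθ' x) (norm_nonneg _)
          ((hN0 θ' hθ' x).trans (hNe θ' hθ' x)))
      (he.mul_const C) hd
  -- By the quotient rule, normalisation subtracts from the logarithmic derivative `w` its mean,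
  -- which is the centring in `tangent`.
  convert hasGradientAt_div (hd θ hθ x) hI hZ.ne' using 1
  simp only [tangent, div_eq_inv_mul, mul_smul]
  rw [integral_smul]
  module

namespace ParamModel

variable (h : ParamModel ξ Θ ε κ m₀ m g)
include h

/-- If `s` is the logarithmic derivative of `φ`, then `scoreStep` is that of the unnormalised next
filter: dividing `m φ` by the prediction produces the backward kernel. -/
lemma hasGradientAt_mul_predict (hθ : θ ∈ Θ) {φ : EuclideanSpace ℝ (Fin p) → S → ℝ}
    {s : EuclideanSpace ℝ (Fin p) → S → EuclideanSpace ℝ (Fin p)} {env : S → ℝ} {B : ℝ}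
    (hB0 : 0 ≤ B)
    (hφ : ∀ θ' ∈ Θ, IsProbDensity ξ (φ θ')) (hφe : ∀ θ' ∈ Θ, ∀ x, φ θ' x ≤ env x)
    (he : Integrable env ξ) (hs : StronglyMeasurable (s θ)) (hB : ∀ θ' ∈ Θ, ∀ x, ‖s θ' x‖ ≤ B)
    (hd : ∀ θ' ∈ Θ, ∀ x, HasGradientAt (fun θ'' => φ θ'' x) (φ θ' x • s θ' x) θ')
    (y : O) (x' : S) :
    HasGradientAt (fun θ' => g θ' x' y * predict ξ (m θ') (φ θ') x')
      ((g θ x' y * predict ξ (m θ) (φ θ) x') •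
        scoreStep ξ (m θ) (paramGrad m θ) (fun x => g θ x y) (fun x => paramGrad g θ x y) (φ θ)
          (s θ) x') θ := by
  have hst := fun θ' hθ' => (h.bounds θ' hθ').step y
  have hgb := (h.gradBounds hθ).step y
  have hκ := h.grad_nonneg hθ
  have hε := (hst θ hθ).pos
  have hI : HasGradientAt (fun θ' => predict ξ (m θ') (φ θ') x')
      (∫ x, (m θ x x' • φ θ x • s θ x + φ θ x • paramGrad m θ x x') ∂ξ) θ := by
    refine hasGradientAt_integral h.isOpen hθ
      (G := fun θ x => m θ x x' • φ θ x • s θ x + φ θ x • paramGrad m θ x x')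
      (bound := fun x => (ε⁻¹ * B + κ) * env x)
      (fun θ' hθ' => (((hst θ' hθ').measurable_left x').mul
        (hφ θ' hθ').measurable).aestronglyMeasurable)
      ((hst θ hθ).integrable_trans_mul (hφ θ hθ).integrable x')
      ?_ ?_ (he.const_mul _) (fun θ' hθ' x => ?_)
    · refine (StronglyMeasurable.add ?_ ?_).aestronglyMeasurable
      · exact ((hst θ hθ).measurable_left x').stronglyMeasurable.smul
          ((hφ θ hθ).measurable.stronglyMeasurable.smul hs)
      · exact (hφ θ hθ).measurable.stronglyMeasurable.smul
          (hgb.trans_meas.comp_measurable (g := fun x => (x, x')) (by fun_prop))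
    · intro θ' hθ' x
      have h0 := (hφ θ' hθ').nonneg x
      refine (norm_add_le _ _).trans ?_
      rw [norm_smul, norm_smul, norm_smul, Real.norm_of_nonneg h0,
        Real.norm_of_nonneg ((hst θ' hθ').trans_nonneg x x')]
      have h1 := (hst θ' hθ').trans_le x x'
      have h2 := hB θ' hθ' x
      have h3 := (h.diff_trans θ' hθ' x x').2
      calc m θ' x x' * (φ θ' x * ‖s θ' x‖) + φ θ' x * ‖paramGrad m θ' x x'‖
          ≤ ε⁻¹ * (φ θ' x * B) + φ θ' x * κ := by
            gcongr
            exact h3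
        _ = (ε⁻¹ * B + κ) * φ θ' x := by ring
        _ ≤ _ := by
          have := hφe θ' hθ' x
          gcongr
    · exact hasGradientAt_mul (h.hasGradientAt_trans hθ' x x') (hd θ' hθ' x)
  convert hasGradientAt_mul (h.hasGradientAt_emission hθ x' y) hI using 1
  have hp := (hst θ hθ).predict_pos (hφ θ hθ) x'
  have hg : g θ x' y ≠ 0 := (hε.trans_le ((hst θ hθ).ge x')).ne'
  have e : predict ξ (m θ) (φ θ) x' •
      (∫ x, backward ξ (m θ) (φ θ) x' x • (s θ x + (m θ x x')⁻¹ • paramGrad m θ x x') ∂ξ) =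
      ∫ x, (m θ x x' • φ θ x • s θ x + φ θ x • paramGrad m θ x x') ∂ξ := by
    rw [← integral_smul]
    refine integral_congr_ae (ae_of_all _ fun x => ?_)
    have hmx : m θ x x' ≠ 0 := (hε.trans_le ((hst θ hθ).trans_ge x x')).ne'
    beta_reduce
    rw [backward, smul_smul, mul_div_cancel₀ _ hp.ne', smul_add, smul_smul, smul_smul]
    congr 2
    field_simp
  rw [scoreStep, smul_add, mul_smul, e, smul_smul]
  congr 2
  field_simp

/-- The filter densities are differentiable in the parameter, with the tangent filter as
gradient. -/
lemma hasGradientAt_filt (y : ℕ → O) (t : ℕ) : ∀ θ ∈ Θ, ∀ x,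
    HasGradientAt (fun θ' => filt ξ m₀ (m θ') (g θ') y t x) (paramTangent ξ m₀ m g θ y t x) θ := by
  induction t with
  | zero =>
    intro θ hθ x
    have hst := fun θ' hθ' => (h.bounds θ' hθ').step (y 0)
    have hm0 := (h.bounds θ hθ).initial
    refine hasGradientAt_normalize h.isOpen hθ (N := fun θ' x => g θ' x (y 0) * m₀ x)
      (w := fun θ' => paramScore ξ m₀ m g θ' y 0) (env := fun x => ε⁻¹ * m₀ x) (C := κ / ε)
      (fun θ' hθ' => (hst θ' hθ').measurable.mul hm0.measurable)
      (fun θ' hθ' x => mul_nonneg ((hst θ' hθ').nonneg x) (hm0.nonneg x))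
      (fun θ' hθ' x => mul_le_mul_of_nonneg_right ((hst θ' hθ').le x) (hm0.nonneg x))
      (hm0.integrable.const_mul _) (h.stronglyMeasurable_paramScore hθ y 0)
      (fun θ' hθ' x => norm_inv_smul_le (hst θ' hθ').pos ((hst θ' hθ').ge x)
        (h.diff_emission θ' hθ' x (y 0)).2)
      ((hst θ hθ).pos.trans_le (integral_mul_initial_ge (h.bounds θ hθ) (y 0)))
      (fun θ' hθ' x => ?_) x
    have hg : g θ' x (y 0) ≠ 0 := ((hst θ' hθ').pos.trans_le ((hst θ' hθ').ge x)).ne'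
    convert hasGradientAt_mul (h.hasGradientAt_emission hθ' x (y 0))
      (hasGradientAt_const θ' (m₀ x)) using 1
    simp only [paramScore, score]
    rw [smul_zero, zero_add, smul_smul]
    congr 1
    field_simp
  | succ t ih =>
    intro θ hθ x
    have hst := fun θ' hθ' => (h.bounds θ' hθ').step (y (t + 1))
    have hφ := fun θ' hθ' => isProbDensity_filt (h.bounds θ' hθ') y t
    have hε := (hst θ hθ).pos
    have hκ := h.grad_nonneg hθ
    -- By induction the gradient of the filter is `φ` times the score centred at `c θ'`. So the
    -- centred score is the logarithmic derivative to propagate, and it is bounded by `oscBound`;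
    -- the constant is removed again at the end.
    set c : EuclideanSpace ℝ (Fin p) → EuclideanSpace ℝ (Fin p) := fun θ' =>
      ∫ x', filt ξ m₀ (m θ') (g θ') y t x' • paramScore ξ m₀ m g θ' y t x' ∂ξ with hc
    have hsm := fun θ' hθ' => (h.stronglyMeasurable_paramScore (θ := θ') hθ' y t).sub
      (stronglyMeasurable_const (b := c θ'))
    have hbd : ∀ θ' ∈ Θ, ∀ x, ‖paramScore ξ m₀ m g θ' y t x - c θ'‖ ≤ oscBound ε κ :=
      fun θ' hθ' => norm_sub_integral_le (hφ θ' hθ') (h.stronglyMeasurable_paramScore hθ' y t)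
        (h.paramScore_osc hθ' y t)
    have key := hasGradientAt_normalize h.isOpen hθ (ξ := ξ)
      (N := fun θ' x => g θ' x (y (t + 1)) * predict ξ (m θ') (filt ξ m₀ (m θ') (g θ') y t) x)
      (w := fun θ' => scoreStep ξ (m θ') (paramGrad m θ') (fun x => g θ' x (y (t + 1)))
        (fun x => paramGrad g θ' x (y (t + 1))) (filt ξ m₀ (m θ') (g θ') y t)
          fun x => paramScore ξ m₀ m g θ' y t x - c θ') (env := fun _ => ε⁻¹ ^ 2)
      (C := oscBound ε κ + 2 * (κ / ε))
      (fun θ' hθ' => (hst θ' hθ').measurable.mul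
        ((hst θ' hθ').measurable_predict (hφ θ' hθ').measurable))
      (fun θ' hθ' x => mul_nonneg ((hst θ' hθ').nonneg x)
          ((hst θ' hθ').predict_pos (hφ θ' hθ') x).le)
      (fun θ' hθ' x => (hst θ' hθ').mul_predict_le (hφ θ' hθ') x)
      (integrable_const _)
      (stronglyMeasurable_scoreStep (hst θ hθ) ((h.gradBounds hθ).step _) (hφ θ hθ).measurable
        (hsm θ hθ))
      (fun θ' hθ' x => norm_scoreStep_le (hst θ' hθ') ((h.gradBounds hθ').step _) (hφ θ' hθ')
        (hsm θ' hθ') (hbd θ' hθ') x)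
      ((hst θ hθ).integral_mul_predict_pos (hφ θ hθ))
      (fun θ' hθ' x => h.hasGradientAt_mul_predict hθ' (oscBound_nonneg hε hκ) hφ
        (fun θ'' hθ'' x => filt_le (h.bounds θ'' hθ'') y t x)
        (((integrable_const 1).add (h.bounds θ hθ).initial.integrable).const_mul _)
        (hsm θ' hθ') hbd (fun θ'' hθ'' x => ih θ'' hθ'' x) (y (t + 1)) x) x
    convert key using 1
    · rfl
    rw [scoreStep_sub_const (hst θ hθ) ((h.gradBounds hθ).step _) (hφ θ hθ)
      (h.stronglyMeasurable_paramScore hθ y t) (h.paramScore_osc hθ y t) (c θ)]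
    have := tangent_sub_const (isProbDensity_filt (h.bounds θ hθ) y (t + 1))
      (h.stronglyMeasurable_paramScore hθ y (t + 1)) (h.paramScore_osc hθ y (t + 1)) (c θ)
    rw [paramTangent, ← this]
    rfl

/-- The recursion describes the filter density for parameters in `Θ` only; as `Θ` is open, the two
functions agree near `θ` and have the same gradient. -/
lemma tangentDensity_eq (hθ : θ ∈ Θ) (y : ℕ → O) (t : ℕ) :
    tangentDensity ξ m₀ m g θ y t = paramTangent ξ m₀ m g θ y t := by
  funext x
  rw [tangentDensity, ← (h.hasGradientAt_filt y t θ hθ x).gradient]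
  refine Filter.EventuallyEq.gradient_eq ?_
  filter_upwards [h.isOpen.mem_nhds hθ] with θ' hθ'
  rw [filterDensity_eq_filt (h.bounds θ' hθ')]

end ParamModel

end Parametric

/-! ### Densities with dominated tangents. -/

section Pairs

variable {S O E : Type*} [MeasurableSpace S] [MeasurableSpace O] [NormedAddCommGroup E]
  [NormedSpace ℝ E] [CompleteSpace E]

/-- A probability density together with a dominated tangent. -/
structure TangentPair (ξ : Measure S) (B : ℝ) (φ : S → ℝ) (τ : S → E) : Prop where
  dens : IsProbDensity ξ φ
  meas : StronglyMeasurable τ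
  le : ∀ x, ‖τ x‖ ≤ B * φ x

/-- Relative closeness of two densities and of their tangents. -/
def PairClose (η : ℝ) (φ : S → ℝ) (τ : S → E) (φ' : S → ℝ) (τ' : S → E) : Prop :=
  ∀ x, |φ x - φ' x| ≤ η * φ x ∧ ‖τ x - τ' x‖ ≤ η * φ x

variable {ξ : Measure S} [IsFiniteMeasure ξ] {B : ℝ} {φ : S → ℝ} {τ : S → E}

lemma TangentPair.integrable (h : TangentPair ξ B φ τ) : Integrable τ ξ :=
  (h.dens.integrable.const_mul B).mono' h.meas.aestronglyMeasurable (ae_of_all _ h.le)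

lemma TangentPair.nonneg (h : TangentPair ξ B φ τ) : 0 ≤ B := by
  have := integral_mono_of_nonneg (ae_of_all _ fun x => norm_nonneg (τ x))
    (h.dens.integrable.const_mul B) (ae_of_all _ h.le)
  rw [integral_const_mul, h.dens.integral_eq_one, mul_one] at this
  exact (integral_nonneg fun x => norm_nonneg _).trans this

lemma IsProbDensity.norm_integral_le {F : Type*} [NormedAddCommGroup F] [NormedSpace ℝ F]
    (h : IsProbDensity ξ φ) {f : S → F} {c : ℝ}
    (hf : ∀ x, ‖f x‖ ≤ c * φ x) : ‖∫ x, f x ∂ξ‖ ≤ c := by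
  have := norm_integral_le_of_norm_le (h.integrable.const_mul c) (ae_of_all _ hf)
  rwa [integral_const_mul, h.integral_eq_one, mul_one] at this

lemma dependsOn_score {m₀ : S → ℝ} {m : S → S → ℝ} {g : S → O → ℝ} {dm : S → S → E}
    {dg : S → O → E} (t : ℕ) :
    DependsOn (fun y : ℕ → O => score ξ m₀ m g dm dg y t) (Set.Iic t) := by
  induction t with
  | zero =>
    intro y y' hy
    simp only [score, hy 0 (by simp)]
  | succ t ih =>
    intro y y' hy
    have hy' : ∀ i ∈ Set.Iic t, y i = y' i := fun i hi => hy i (by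
      have : i ≤ t := hi
      simp only [Set.mem_Iic]; omega)
    have h1 := ih hy'
    have h2 := dependsOn_filt (ξ := ξ) (m₀ := m₀) (m := m) (g := g) t hy'
    simp only [score, h1, h2, hy (t + 1) (by simp)]

lemma IsForgetting.mono {Z F : Type*} [MeasurableSpace Z] [NormedAddCommGroup F]
    [MeasurableSpace F] {C C' ρ : ℝ} {V : ℕ → (ℕ → Z) → F} (h : IsForgetting C ρ V) (hρ : 0 ≤ ρ)
    (hC : C ≤ C') : IsForgetting C' ρ V where
  measurable := h.measurable
  bound k z := (h.bound k z).trans hC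
  depends := h.depends
  forget j k z := (h.forget j k z).trans (by gcongr)

lemma IsForgetting.comp_map {Z A F : Type*} [MeasurableSpace Z] [MeasurableSpace A]
    [NormedAddCommGroup F] [MeasurableSpace F] {C ρ : ℝ} {V : ℕ → (ℕ → A) → F}
    (h : IsForgetting C ρ V) {f : Z → A} (hf : Measurable f) :
    IsForgetting C ρ fun k (z : ℕ → Z) => V k fun i => f (z i) where
  measurable k := (h.measurable k).comp
    (measurable_pi_lambda _ fun i => hf.comp (measurable_pi_apply i))
  bound k z := h.bound k _
  depends k z z' hz := h.depends k fun i hi => by simp only [hz i hi]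
  forget j k z := h.forget j k _

end Pairs

/-! ### From forgetting of the filters to forgetting of functionals. -/

section Forgetting

variable {p : ℕ} {S O : Type*} [MeasurableSpace S] [MeasurableSpace O]
  {ξ : Measure S} [IsFiniteMeasure ξ] {Θ : Set (EuclideanSpace ℝ (Fin p))} {ε κ : ℝ}
  {m₀ : S → ℝ} {m : EuclideanSpace ℝ (Fin p) → S → S → ℝ}
  {g : EuclideanSpace ℝ (Fin p) → S → O → ℝ} {θ : EuclideanSpace ℝ (Fin p)}

/-- The constant in the forgetting bounds for filters and tangent filters. -/
def pairBound (ε κ : ℝ) : ℝ := (1 + 2 * oscBound ε κ) * forgetBound ε κ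

namespace ParamModel

variable (h : ParamModel ξ Θ ε κ m₀ m g)
include h

lemma tangentPair (hθ : θ ∈ Θ) (y : ℕ → O) (t : ℕ) :
    TangentPair ξ (oscBound ε κ) (filt ξ m₀ (m θ) (g θ) y t) (paramTangent ξ m₀ m g θ y t) where
  dens := isProbDensity_filt (h.bounds θ hθ) y t
  meas := h.stronglyMeasurable_paramTangent hθ y t
  le := h.norm_paramTangent_le hθ y t

lemma pairClose_forget (hθ : θ ∈ Θ) (y : ℕ → O) (j k : ℕ) :
    PairClose (pairBound ε κ * forgetRate ε ^ k)
      (filt ξ m₀ (m θ) (g θ) y (j + (k + 1))) (paramTangent ξ m₀ m g θ y (j + (k + 1)))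
      (filt ξ m₀ (m θ) (g θ) (shift j y) (k + 1))
      (paramTangent ξ m₀ m g θ (shift j y) (k + 1)) := by
  intro x
  have hb := h.bounds θ hθ
  have hd := h.gradBounds hθ
  have hε := (hb.step (y 0)).pos
  have hκ := h.grad_nonneg hθ
  have hB := oscBound_nonneg hε hκ
  have hF := forgetBound_nonneg hε hκ
  have hr := forgetRate_pos hε (hb.step (y 0)).le_one
  have hφ := isProbDensity_filt hb y (j + (k + 1))
  have hφ' := isProbDensity_filt hb (shift j y) (k + 1)
  have hc := relClose_filt_forget hb hκ y j k
  have h0 := hφ.nonneg x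
  constructor
  · refine (hc.abs_sub_le hφ hφ' (by positivity) x).trans ?_
    gcongr
    rw [pairBound]
    nlinarith
  · refine (norm_tangent_sub_le hφ hφ' (by positivity) hc (h.stronglyMeasurable_paramScore hθ _ _)
      (h.stronglyMeasurable_paramScore hθ _ _) (h.paramScore_osc hθ _ _) (h.paramScore_osc hθ _ _)
      (score_osc_forget hb hd y j k) x).trans (le_of_eq ?_)
    rw [pairBound]
    ring

/-- Bounded Lipschitz functionals of the filter and of the tangent filter are forgetting. -/
theorem isForgetting {F : Type*} [NormedAddCommGroup F] [MeasurableSpace F] (hθ : θ ∈ Θ)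
    {V : O → (S → ℝ) → (S → EuclideanSpace ℝ (Fin p)) → F} {C K : ℝ}
    (hm : ∀ k, Measurable fun y : ℕ → O =>
      V (y (k + 1)) (filt ξ m₀ (m θ) (g θ) y k) (paramTangent ξ m₀ m g θ y k))
    (hC : ∀ y φ τ, TangentPair ξ (oscBound ε κ) φ τ → ‖V y φ τ‖ ≤ C) (hK0 : 0 ≤ K)
    (hK : ∀ y φ τ φ' τ' η, TangentPair ξ (oscBound ε κ) φ τ → TangentPair ξ (oscBound ε κ) φ' τ' →
      0 ≤ η → η ≤ pairBound ε κ → PairClose η φ τ φ' τ' → ‖V y φ τ - V y φ' τ'‖ ≤ K * η)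
    (hε : 0 < ε) (hε1 : ε ≤ 1) :
    IsForgetting (2 * C + K * pairBound ε κ / forgetRate ε) (forgetRate ε) fun k (y : ℕ → O) =>
      V (y (k + 1)) (filt ξ m₀ (m θ) (g θ) y k) (paramTangent ξ m₀ m g θ y k) := by
  have hκ := h.grad_nonneg hθ
  have hB := oscBound_nonneg hε hκ
  have hF := forgetBound_nonneg hε hκ
  have hr := forgetRate_pos hε hε1
  have hr1 := forgetRate_lt_one hε
  have hp : 0 ≤ pairBound ε κ := by rw [pairBound]; positivity
  have hbd : ∀ k (y : ℕ → O),
      ‖V (y (k + 1)) (filt ξ m₀ (m θ) (g θ) y k) (paramTangent ξ m₀ m g θ y k)‖ ≤ C :=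
    fun k y => hC _ _ _ (h.tangentPair hθ y k)
  have hq : 0 ≤ K * pairBound ε κ / forgetRate ε := by positivity
  refine ⟨hm, fun k y => ?_, fun k y y' hy => ?_, fun j k y => ?_⟩
  · have := (norm_nonneg _).trans (hbd k y)
    linarith [hbd k y]
  · have hy' : ∀ i ∈ Set.Iic k, y i = y' i := fun i hi => hy i (by
      have : i ≤ k := hi
      simp only [Set.mem_Iic]; omega)
    have h1 := dependsOn_filt (ξ := ξ) (m₀ := m₀) (m := m θ) (g := g θ) k hy'
    have h2 := dependsOn_score (ξ := ξ) (m₀ := m₀) (m := m θ) (g := g θ) (dm := paramGrad m θ)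
      (dg := paramGrad g θ) k hy'
    simp only at h1 h2
    simp only [paramTangent, paramScore, h1, h2, hy (k + 1) (by simp)]
  · have hC0 := (norm_nonneg _).trans (hbd k y)
    -- Filters are comparable only after one step, so `k = 0` uses the crude bound `2 C`. For `k +
    -- 1` the available rate is `forgetRate ε ^ k`; the missing factor explains the division by
    -- `forgetRate ε` in the constant.
    cases k with
    | zero =>
      rw [pow_zero, mul_one]
      refine (norm_sub_le _ _).trans ?_
      linarith [hbd (j + 0) y, hbd 0 (shift j y)]
    | succ k =>
      refine (hK (y (j + (k + 1) + 1)) _ _ _ _ (pairBound ε κ * forgetRate ε ^ k)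
        (h.tangentPair hθ y _) (h.tangentPair hθ (shift j y) _) (by positivity)
        (mul_le_of_le_one_right hp (pow_le_one₀ hr.le hr1.le))
        (h.pairClose_forget hθ y j k)).trans ?_
      have e : K * (pairBound ε κ * forgetRate ε ^ k) =
          K * pairBound ε κ / forgetRate ε * forgetRate ε ^ (k + 1) := by
        rw [pow_succ]; field_simp
      rw [e]
      gcongr
      linarith

end ParamModel

end Forgetting

/-! ### Elementary bounds for logarithms and inverses. -/

section Scalars

lemma abs_log_sub_log_le {ε a b : ℝ} (hε : 0 < ε) (ha : ε ≤ a) (hb : ε ≤ b) :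
    |Real.log a - Real.log b| ≤ ε⁻¹ * |a - b| := by
  have key : ∀ a b : ℝ, ε ≤ a → ε ≤ b → Real.log a - Real.log b ≤ ε⁻¹ * |a - b| := by
    intro a b ha hb
    have ha0 := hε.trans_le ha
    have hb0 := hε.trans_le hb
    rw [← Real.log_div ha0.ne' hb0.ne']
    refine (Real.log_le_sub_one_of_pos (by positivity)).trans ?_
    have : a / b - 1 = b⁻¹ * (a - b) := by field_simp
    rw [this]
    refine (mul_le_mul_of_nonneg_left (le_abs_self _) (inv_nonneg.2 hb0.le)).trans ?_
    exact mul_le_mul_of_nonneg_right (inv_anti₀ hε hb) (abs_nonneg _)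
  rw [abs_le]
  have h1 := key a b ha hb
  have h2 := key b a hb ha
  rw [abs_sub_comm] at h2
  constructor <;> linarith

lemma abs_log_le {ε a : ℝ} (hε : 0 < ε) (ha : ε ≤ a) (ha' : a ≤ ε⁻¹) :
    |Real.log a| ≤ ε⁻¹ := by
  have ha0 := hε.trans_le ha
  rw [abs_le]
  constructor
  · have h1 := Real.log_le_self (inv_nonneg.2 ha0.le)
    rw [Real.log_inv] at h1
    linarith [inv_anti₀ hε ha]
  · exact (Real.log_le_self ha0.le).trans ha'

lemma norm_inv_smul_sub_le {E : Type*} [NormedAddCommGroup E] [NormedSpace ℝ E] {ε a b : ℝ}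
    {v w : E} (hε : 0 < ε) (ha : ε ≤ a) (hb : ε ≤ b) :
    ‖a⁻¹ • v - b⁻¹ • w‖ ≤ ε⁻¹ * ‖v - w‖ + ε⁻¹ ^ 2 * |a - b| * ‖w‖ := by
  have ha0 := hε.trans_le ha
  have hb0 := hε.trans_le hb
  have e : a⁻¹ • v - b⁻¹ • w = a⁻¹ • (v - w) + (a⁻¹ * b⁻¹ * (b - a)) • w := by
    have : a⁻¹ * b⁻¹ * (b - a) = a⁻¹ - b⁻¹ := by field_simp
    rw [this]
    module
  rw [e]
  refine (norm_add_le _ _).trans ?_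
  rw [norm_smul, norm_smul, norm_mul, norm_mul, norm_inv, norm_inv, Real.norm_of_nonneg ha0.le,
    Real.norm_of_nonneg hb0.le, Real.norm_eq_abs, abs_sub_comm b a, sq]
  have h1 := inv_anti₀ hε ha
  have h2 := inv_anti₀ hε hb
  gcongr

end Scalars

/-! ### The one-step predictive likelihood and its gradient. -/

section PredLogLik

variable {p : ℕ} {S O : Type*} [MeasurableSpace S] [MeasurableSpace O]
  {ξ : Measure S} [IsFiniteMeasure ξ] {Θ : Set (EuclideanSpace ℝ (Fin p))} {ε κ B η : ℝ}
  {m₀ : S → ℝ} {m : EuclideanSpace ℝ (Fin p) → S → S → ℝ}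
  {g : EuclideanSpace ℝ (Fin p) → S → O → ℝ} {θ : EuclideanSpace ℝ (Fin p)}
  {φ φ' : S → ℝ} {τ τ' : S → EuclideanSpace ℝ (Fin p)}

/-- The one-step likelihood of the observation `y` given the current state. -/
def stepLik (ξ : Measure S) (m : S → S → ℝ) (g : S → O → ℝ) (y : O) (x : S) : ℝ :=
  ∫ x', g x' y * m x x' ∂ξ

/-- The gradient in the parameter of the one-step likelihood. -/
def stepLikGrad (ξ : Measure S) (m : EuclideanSpace ℝ (Fin p) → S → S → ℝ)
    (g : EuclideanSpace ℝ (Fin p) → S → O → ℝ) (θ : EuclideanSpace ℝ (Fin p))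
    (y : O) (x : S) : EuclideanSpace ℝ (Fin p) :=
  ∫ x', gradient (fun θ' => g θ' x' y * m θ' x x') θ ∂ξ

lemma ModelBounds.stepLik_mem {m : S → S → ℝ} {g : S → O → ℝ} (h : ModelBounds ξ ε m₀ m g)
    (y : O) (x : S) : ε ≤ stepLik ξ m g y x ∧ stepLik ξ m g y x ≤ ε⁻¹ := by
  have hs := h.step y
  have hi := hs.trans.integrable x
  have hgi : Integrable (fun x' => g x' y * m x x') ξ :=
    hi.bdd_mul (c := ε⁻¹) hs.measurable.aestronglyMeasurable (ae_of_all _ fun x' => by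
      rw [Real.norm_of_nonneg (hs.nonneg x')]
      exact hs.le x')
  constructor
  · have := integral_mono (hi.const_mul ε) hgi
      fun x' => mul_le_mul_of_nonneg_right (hs.ge x') (hs.trans_nonneg x x')
    rwa [integral_const_mul, hs.trans.integral_eq_one, mul_one] at this
  · have := integral_mono hgi (hi.const_mul ε⁻¹)
      fun x' => mul_le_mul_of_nonneg_right (hs.le x') (hs.trans_nonneg x x')
    rwa [integral_const_mul, hs.trans.integral_eq_one, mul_one] at this

lemma ModelBounds.measurable_stepLik {m : S → S → ℝ} {g : S → O → ℝ}
    (h : ModelBounds ξ ε m₀ m g) (y₀ : O) :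
    Measurable fun a : O × S => stepLik ξ m g a.1 a.2 := by
  have : Measurable fun a : (O × S) × S => g a.2 a.1.1 * m a.1.2 a.2 :=
    (h.measurable.comp (f := fun a : (O × S) × S => (a.2, a.1.1)) (by fun_prop)).mul
      ((h.step y₀).trans.measurable.comp (f := fun a : (O × S) × S => (a.1.2, a.2)) (by fun_prop))
  exact this.stronglyMeasurable.integral_prod_right.measurable

lemma ModelBounds.stepLik_measurable_right {m : S → S → ℝ} {g : S → O → ℝ}
    (h : ModelBounds ξ ε m₀ m g) (y : O) : Measurable (stepLik ξ m g y) :=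
  (h.measurable_stepLik y).comp (f := fun x => (y, x)) (by fun_prop)

lemma ModelBounds.norm_stepLik_le {m : S → S → ℝ} {g : S → O → ℝ}
    (h : ModelBounds ξ ε m₀ m g) (y : O) (x : S) : ‖stepLik ξ m g y x‖ ≤ ε⁻¹ := by
  have := h.stepLik_mem y x
  rw [Real.norm_of_nonneg ((h.step y).pos.le.trans this.1)]
  exact this.2

lemma ModelBounds.integrable_stepLik_mul {m : S → S → ℝ} {g : S → O → ℝ}
    (h : ModelBounds ξ ε m₀ m g) (y : O) (hφ : Integrable φ ξ) :
    Integrable (fun x => stepLik ξ m g y x * φ x) ξ :=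
  hφ.bdd_mul (h.stepLik_measurable_right y).aestronglyMeasurable
    (ae_of_all _ (h.norm_stepLik_le y))

lemma ModelBounds.integral_stepLik_mem {m : S → S → ℝ} {g : S → O → ℝ}
    (h : ModelBounds ξ ε m₀ m g) (y : O) (hφ : IsProbDensity ξ φ) :
    ε ≤ ∫ x, stepLik ξ m g y x * φ x ∂ξ ∧ ∫ x, stepLik ξ m g y x * φ x ∂ξ ≤ ε⁻¹ := by
  constructor
  · have := integral_mono (hφ.integrable.const_mul ε) (h.integrable_stepLik_mul y hφ.integrable)
      fun x => mul_le_mul_of_nonneg_right (h.stepLik_mem y x).1 (hφ.nonneg x)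
    rwa [integral_const_mul, hφ.integral_eq_one, mul_one] at this
  · have := integral_mono (h.integrable_stepLik_mul y hφ.integrable) (hφ.integrable.const_mul ε⁻¹)
      fun x => mul_le_mul_of_nonneg_right (h.stepLik_mem y x).2 (hφ.nonneg x)
    rwa [integral_const_mul, hφ.integral_eq_one, mul_one] at this

lemma ModelBounds.abs_integral_stepLik_sub_le {m : S → S → ℝ} {g : S → O → ℝ}
    (h : ModelBounds ξ ε m₀ m g) (y : O) (hφ : IsProbDensity ξ φ) (hφ' : IsProbDensity ξ φ')
    (hc : ∀ x, |φ x - φ' x| ≤ η * φ x) :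
    |∫ x, stepLik ξ m g y x * φ x ∂ξ - ∫ x, stepLik ξ m g y x * φ' x ∂ξ| ≤ ε⁻¹ * η := by
  rw [← integral_sub (h.integrable_stepLik_mul y hφ.integrable)
    (h.integrable_stepLik_mul y hφ'.integrable)]
  refine IsProbDensity.norm_integral_le hφ
    (f := fun x => stepLik ξ m g y x * φ x - stepLik ξ m g y x * φ' x) fun x => ?_
  rw [← mul_sub, norm_mul, mul_assoc]
  exact mul_le_mul (h.norm_stepLik_le y x) (hc x) (norm_nonneg _)
    (inv_nonneg.2 (h.step y).pos.le)

namespace ParamModel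

variable (h : ParamModel ξ Θ ε κ m₀ m g)
include h

lemma gradient_mul (hθ : θ ∈ Θ) (x x' : S) (y : O) :
    HasGradientAt (fun θ' => g θ' x' y * m θ' x x')
      (gradient (fun θ' => g θ' x' y * m θ' x x') θ) θ ∧
    ‖gradient (fun θ' => g θ' x' y * m θ' x x') θ‖ ≤ 2 * (ε⁻¹ * κ) := by
  have hs := (h.bounds θ hθ).step y
  have hκ := h.grad_nonneg hθ
  have hg := hasGradientAt_mul (h.hasGradientAt_emission hθ x' y) (h.hasGradientAt_trans hθ x x')
  rw [hg.gradient]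
  refine ⟨hg, (norm_add_le _ _).trans ?_⟩
  rw [norm_smul, norm_smul, Real.norm_of_nonneg (hs.nonneg x'),
    Real.norm_of_nonneg (hs.trans_nonneg x x'), two_mul]
  have h1 := hs.le x'
  have h2 := hs.trans_le x x'
  have h3 := (h.diff_trans θ hθ x x').2
  have h4 := (h.diff_emission θ hθ x' y).2
  have := hs.pos
  exact add_le_add (mul_le_mul h1 h3 (norm_nonneg _) (by positivity))
    (mul_le_mul h2 h4 (norm_nonneg _) (by positivity))

lemma mass_le (hθ : θ ∈ Θ) (y : O) : ξ.real Set.univ ≤ ε⁻¹ := by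
  have hs := (h.bounds θ hθ).step y
  obtain ⟨x⟩ := (h.bounds θ hθ).initial.nonempty
  have := integral_mono (integrable_const ε) (hs.trans.integrable x) (hs.trans_ge x)
  rw [hs.trans.integral_eq_one, integral_const, smul_eq_mul] at this
  rwa [← one_div, le_div_iff₀ hs.pos]

lemma norm_stepLikGrad_le (hθ : θ ∈ Θ) (y : O) (x : S) :
    ‖stepLikGrad ξ m g θ y x‖ ≤ 2 * (ε⁻¹ * κ) * ε⁻¹ := by
  have hs := (h.bounds θ hθ).step y
  have hκ := h.grad_nonneg hθ
  have hε := hs.pos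
  refine (norm_integral_le_of_norm_le_const (ae_of_all _ fun x' =>
    (h.gradient_mul hθ x x' y).2)).trans ?_
  have := h.mass_le hθ y
  gcongr

lemma hasGradientAt_stepLik (hθ : θ ∈ Θ) (y : O) (x : S) :
    HasGradientAt (fun θ' => stepLik ξ (m θ') (g θ') y x) (stepLikGrad ξ m g θ y x) θ := by
  have hs := fun θ' hθ' => (h.bounds θ' hθ').step y
  have hm : ∀ θ' ∈ Θ, Measurable fun x' => g θ' x' y * m θ' x x' := fun θ' hθ' =>
    (hs θ' hθ').measurable.mul
      ((hs θ' hθ').trans.measurable.comp (f := fun x' => (x, x')) (by fun_prop))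
  refine hasGradientAt_integral h.isOpen hθ
    (G := fun θ x' => gradient (fun θ' => g θ' x' y * m θ' x x') θ)
    (bound := fun _ => 2 * (ε⁻¹ * κ)) (fun θ' hθ' => (hm θ' hθ').aestronglyMeasurable)
    (((hs θ hθ).trans.integrable x).bdd_mul (c := ε⁻¹) (hs θ hθ).measurable.aestronglyMeasurable
      (ae_of_all _ fun x' => by
        rw [Real.norm_of_nonneg ((hs θ hθ).nonneg x')]
        exact (hs θ hθ).le x'))
    (measurable_of_hasGradientAt h.isOpen hθ hm
      fun x' => (h.gradient_mul hθ x x' y).1).aestronglyMeasurable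
    (fun θ' hθ' x' => (h.gradient_mul hθ' x x' y).2) (integrable_const _)
    (fun θ' hθ' x' => (h.gradient_mul hθ' x x' y).1)

lemma measurable_stepLikGrad (hθ : θ ∈ Θ) (y : O) : Measurable (stepLikGrad ξ m g θ y) :=
  measurable_of_hasGradientAt h.isOpen hθ
    (fun θ' hθ' => (h.bounds θ' hθ').stepLik_measurable_right y)
    fun x => h.hasGradientAt_stepLik hθ y x

/-- The chain rule through both the model and the filter is exact at every time: the tangent filter
carries the dependence of the filter on the parameter. Domination comes from `filt_le`. -/
lemma hasGradientAt_predLogLik (hθ : θ ∈ Θ) (y : ℕ → O) (k : ℕ) :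
    HasGradientAt (fun θ' => predLogLik ξ (m θ') (g θ') (y (k + 1)) (filt ξ m₀ (m θ') (g θ') y k))
      (predLogLikGrad ξ m g θ (y (k + 1)) (filt ξ m₀ (m θ) (g θ) y k)
        (paramTangent ξ m₀ m g θ y k)) θ := by
  have hb := h.bounds θ hθ
  have hs := hb.step (y 0)
  have hε := hs.pos
  have hκ := h.grad_nonneg hθ
  have hB := oscBound_nonneg hε hκ
  have hφ := fun θ' hθ' => isProbDensity_filt (h.bounds θ' hθ') y k
  have hpair := fun θ' hθ' => h.tangentPair (θ := θ') hθ' y k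
  have hsl : StronglyMeasurable fun x => stepLik ξ (m θ) (g θ) (y (k + 1)) x •
      paramTangent ξ m₀ m g θ y k x :=
    (hb.stepLik_measurable_right _).stronglyMeasurable.smul (hpair θ hθ).meas
  have hsg : StronglyMeasurable fun x => filt ξ m₀ (m θ) (g θ) y k x •
      stepLikGrad ξ m g θ (y (k + 1)) x :=
    (hφ θ hθ).measurable.stronglyMeasurable.smul (h.measurable_stepLikGrad hθ _).stronglyMeasurable
  have hb1 : ∀ θ' ∈ Θ, ∀ x, ‖stepLik ξ (m θ') (g θ') (y (k + 1)) x •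
      paramTangent ξ m₀ m g θ' y k x‖ ≤ ε⁻¹ * oscBound ε κ * filt ξ m₀ (m θ') (g θ') y k x := by
    intro θ' hθ' x
    rw [norm_smul, mul_assoc]
    exact mul_le_mul ((h.bounds θ' hθ').norm_stepLik_le _ x) ((hpair θ' hθ').le x) (norm_nonneg _)
      (by positivity)
  have hb2 : ∀ θ' ∈ Θ, ∀ x, ‖filt ξ m₀ (m θ') (g θ') y k x •
      stepLikGrad ξ m g θ' (y (k + 1)) x‖ ≤
      2 * (ε⁻¹ * κ) * ε⁻¹ * filt ξ m₀ (m θ') (g θ') y k x := by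
    intro θ' hθ' x
    rw [norm_smul, mul_comm, Real.norm_of_nonneg ((hφ θ' hθ').nonneg x)]
    exact mul_le_mul_of_nonneg_right (h.norm_stepLikGrad_le hθ' _ x) ((hφ θ' hθ').nonneg x)
  have hI : HasGradientAt (fun θ' => ∫ x, stepLik ξ (m θ') (g θ') (y (k + 1)) x *
      filt ξ m₀ (m θ') (g θ') y k x ∂ξ)
      (∫ x, (stepLik ξ (m θ) (g θ) (y (k + 1)) x • paramTangent ξ m₀ m g θ y k x +
        filt ξ m₀ (m θ) (g θ) y k x • stepLikGrad ξ m g θ (y (k + 1)) x) ∂ξ) θ := by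
    refine hasGradientAt_integral h.isOpen hθ
      (G := fun θ x => stepLik ξ (m θ) (g θ) (y (k + 1)) x • paramTangent ξ m₀ m g θ y k x +
        filt ξ m₀ (m θ) (g θ) y k x • stepLikGrad ξ m g θ (y (k + 1)) x)
      (bound := fun x => (ε⁻¹ * oscBound ε κ + 2 * (ε⁻¹ * κ) * ε⁻¹) * (ε⁻¹ ^ 5 * (1 + m₀ x)))
      (fun θ' hθ' => (((h.bounds θ' hθ').stepLik_measurable_right _).mul
        (hφ θ' hθ').measurable).aestronglyMeasurable)
      (hb.integrable_stepLik_mul _ (hφ θ hθ).integrable)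
      (hsl.add hsg).aestronglyMeasurable (fun θ' hθ' x => ?_)
      ((((integrable_const 1).add hb.initial.integrable).const_mul _).const_mul _)
      (fun θ' hθ' x => ?_)
    · refine (norm_add_le _ _).trans ((add_le_add (hb1 θ' hθ' x) (hb2 θ' hθ' x)).trans ?_)
      rw [← add_mul]
      have := filt_le (h.bounds θ' hθ') y k x
      gcongr
    · exact hasGradientAt_mul (h.hasGradientAt_stepLik hθ' _ x) (h.hasGradientAt_filt y k θ' hθ' x)
  have hpos := hε.trans_le (hb.integral_stepLik_mem (y (k + 1)) (hφ θ hθ)).1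
  rw [integral_add (((hφ θ hθ).integrable.const_mul _).mono' hsl.aestronglyMeasurable
      (ae_of_all _ (hb1 θ hθ))) (((hφ θ hθ).integrable.const_mul _).mono' hsg.aestronglyMeasurable
      (ae_of_all _ (hb2 θ hθ)))] at hI
  exact hasGradientAt_log hI hpos.ne'

lemma measurable_predLogLik (hθ : θ ∈ Θ) (k : ℕ) : Measurable fun y : ℕ → O =>
    predLogLik ξ (m θ) (g θ) (y (k + 1)) (filt ξ m₀ (m θ) (g θ) y k) := by
  rcases isEmpty_or_nonempty O with hO | ⟨⟨y₀⟩⟩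
  · have : IsEmpty (ℕ → O) := ⟨fun a => hO.false (a 0)⟩
    exact measurable_of_empty _
  have : Measurable fun a : (ℕ → O) × S => stepLik ξ (m θ) (g θ) (a.1 (k + 1)) a.2 *
      filt ξ m₀ (m θ) (g θ) a.1 k a.2 :=
    (((h.bounds θ hθ).measurable_stepLik y₀).comp
      (f := fun a : (ℕ → O) × S => (a.1 (k + 1), a.2)) (by fun_prop)).mul
      (measurable_filt (h.bounds θ hθ) k)
  exact this.stronglyMeasurable.integral_prod_right.measurable.log

omit h in
lemma predLogLikGrad_eq (y : O) : predLogLikGrad ξ m g θ y φ τ =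
    (∫ x, stepLik ξ (m θ) (g θ) y x * φ x ∂ξ)⁻¹ •
      ((∫ x, stepLik ξ (m θ) (g θ) y x • τ x ∂ξ) + ∫ x, φ x • stepLikGrad ξ m g θ y x ∂ξ) := rfl

lemma isForgetting_predLogLik (hθ : θ ∈ Θ) (hε : 0 < ε) (hε1 : ε ≤ 1) :
    IsForgetting (2 * ε⁻¹ + (ε⁻¹ * ε⁻¹) * pairBound ε κ / forgetRate ε) (forgetRate ε)
      fun k (y : ℕ → O) =>
        predLogLik ξ (m θ) (g θ) (y (k + 1)) (filt ξ m₀ (m θ) (g θ) y k) := by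
  have hb := h.bounds θ hθ
  refine h.isForgetting hθ (V := fun y φ _ => predLogLik ξ (m θ) (g θ) y φ)
    (h.measurable_predLogLik hθ) (fun y φ τ hφ => ?_) (by positivity)
    (fun y φ τ φ' τ' η hφ hφ' hη _ hc => ?_) hε hε1
  · have := hb.integral_stepLik_mem y hφ.dens
    exact abs_log_le hε this.1 this.2
  · refine (abs_log_sub_log_le hε (hb.integral_stepLik_mem y hφ.dens).1
      (hb.integral_stepLik_mem y hφ'.dens).1).trans ?_
    rw [mul_assoc]
    have := hb.abs_integral_stepLik_sub_le y hφ.dens hφ'.dens fun x => (hc x).1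
    gcongr

omit h in
/-- Numerator bound in the gradient of the predictive likelihood. -/
def numBound (ε κ : ℝ) : ℝ := ε⁻¹ * oscBound ε κ + 2 * (ε⁻¹ * κ) * ε⁻¹

lemma norm_smul_tangent_le (hθ : θ ∈ Θ) (y : O) (hφ : TangentPair ξ B φ τ) (x : S) :
    ‖stepLik ξ (m θ) (g θ) y x • τ x‖ ≤ ε⁻¹ * B * φ x := by
  rw [norm_smul, mul_assoc]
  exact mul_le_mul ((h.bounds θ hθ).norm_stepLik_le _ x) (hφ.le x) (norm_nonneg _)
    (inv_nonneg.2 ((h.bounds θ hθ).step y).pos.le)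

lemma norm_smul_stepLikGrad_le (hθ : θ ∈ Θ) (y : O) (hφ : IsProbDensity ξ φ) (x : S) :
    ‖φ x • stepLikGrad ξ m g θ y x‖ ≤ 2 * (ε⁻¹ * κ) * ε⁻¹ * φ x := by
  rw [norm_smul, mul_comm, Real.norm_of_nonneg (hφ.nonneg x)]
  exact mul_le_mul_of_nonneg_right (h.norm_stepLikGrad_le hθ y x) (hφ.nonneg x)

lemma isForgetting_predLogLikGrad (hθ : θ ∈ Θ) (hε : 0 < ε) (hε1 : ε ≤ 1) :
    IsForgetting (2 * (ε⁻¹ * numBound ε κ) + (ε⁻¹ * (ε⁻¹ + 2 * (ε⁻¹ * κ) * ε⁻¹) +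
        ε⁻¹ ^ 2 * ε⁻¹ * numBound ε κ) * pairBound ε κ / forgetRate ε)
      (forgetRate ε) fun k (y : ℕ → O) =>
        predLogLikGrad ξ m g θ (y (k + 1)) (filt ξ m₀ (m θ) (g θ) y k)
          (paramTangent ξ m₀ m g θ y k) := by
  have hb := h.bounds θ hθ
  have hκ := h.grad_nonneg hθ
  have hB := oscBound_nonneg hε hκ
  have hnum0 : 0 ≤ numBound ε κ := by unfold numBound; positivity
  have hnum : ∀ y φ τ, TangentPair ξ (oscBound ε κ) φ τ →
      ‖(∫ x, stepLik ξ (m θ) (g θ) y x • τ x ∂ξ) + ∫ x, φ x • stepLikGrad ξ m g θ y x ∂ξ‖ ≤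
        numBound ε κ := fun y φ τ hφ =>
    (norm_add_le _ _).trans (add_le_add
      (hφ.dens.norm_integral_le (h.norm_smul_tangent_le hθ y hφ))
      (hφ.dens.norm_integral_le (h.norm_smul_stepLikGrad_le hθ y hφ.dens)))
  refine h.isForgetting hθ (V := fun y φ τ => predLogLikGrad ξ m g θ y φ τ)
    -- Measurability in the observations is inherited from the likelihood terms by differentiation,
    -- so joint measurability of the scores is never needed.
    (fun k => measurable_of_hasGradientAt h.isOpen hθ
      (fun θ' hθ' => h.measurable_predLogLik hθ' k)
      fun y => h.hasGradientAt_predLogLik hθ y k)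
    (fun y φ τ hφ => ?_) (by positivity)
    (fun y φ τ φ' τ' η hφ hφ' hη _ hc => ?_) hε hε1
  · rw [predLogLikGrad_eq, norm_smul, norm_inv]
    have h1 := (hb.integral_stepLik_mem y hφ.dens).1
    have h2 := hnum y φ τ hφ
    rw [Real.norm_of_nonneg (hε.le.trans h1)]
    gcongr
  · rw [predLogLikGrad_eq, predLogLikGrad_eq]
    refine (norm_inv_smul_sub_le hε (hb.integral_stepLik_mem y hφ.dens).1
      (hb.integral_stepLik_mem y hφ'.dens).1).trans ?_
    have h1 := hb.abs_integral_stepLik_sub_le y hφ.dens hφ'.dens fun x => (hc x).1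
    have h2 := hnum y φ' τ' hφ'
    have hi : ∀ φ τ, TangentPair ξ (oscBound ε κ) φ τ →
        Integrable (fun x => stepLik ξ (m θ) (g θ) y x • τ x) ξ := fun φ τ hφ =>
      (hφ.dens.integrable.const_mul _).mono'
          ((hb.stepLik_measurable_right y).stronglyMeasurable.smul
        hφ.meas).aestronglyMeasurable (ae_of_all _ (h.norm_smul_tangent_le hθ y hφ))
    have hi2 : ∀ φ, IsProbDensity ξ φ →
        Integrable (fun x => φ x • stepLikGrad ξ m g θ y x) ξ := fun φ hφ =>
      (hφ.integrable.const_mul _).mono' (hφ.measurable.stronglyMeasurable.smul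
        (h.measurable_stepLikGrad hθ y).stronglyMeasurable).aestronglyMeasurable
        (ae_of_all _ (h.norm_smul_stepLikGrad_le hθ y hφ))
    have h3 : ‖((∫ x, stepLik ξ (m θ) (g θ) y x • τ x ∂ξ) +
        ∫ x, φ x • stepLikGrad ξ m g θ y x ∂ξ) - ((∫ x, stepLik ξ (m θ) (g θ) y x • τ' x ∂ξ) +
        ∫ x, φ' x • stepLikGrad ξ m g θ y x ∂ξ)‖ ≤ (ε⁻¹ + 2 * (ε⁻¹ * κ) * ε⁻¹) * η := by
      rw [add_sub_add_comm, ← integral_sub (hi φ τ hφ) (hi φ' τ' hφ'),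
        ← integral_sub (hi2 φ hφ.dens) (hi2 φ' hφ'.dens), add_mul]
      refine (norm_add_le _ _).trans (add_le_add (hφ.dens.norm_integral_le fun x => ?_)
        (hφ.dens.norm_integral_le fun x => ?_))
      · rw [← smul_sub, norm_smul, mul_assoc]
        exact mul_le_mul (hb.norm_stepLik_le y x) (hc x).2 (norm_nonneg _) (by positivity)
      · rw [← sub_smul, norm_smul, mul_comm, mul_assoc]
        exact mul_le_mul (h.norm_stepLikGrad_le hθ y x) (hc x).1 (norm_nonneg _) (by positivity)
    calc _ ≤ ε⁻¹ * ((ε⁻¹ + 2 * (ε⁻¹ * κ) * ε⁻¹) * η) + ε⁻¹ ^ 2 * (ε⁻¹ * η) * numBound ε κ := by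
          gcongr
      _ = _ := by ring

end ParamModel

end PredLogLik

/-! ### Densities of independent draws. -/

section ProductDensities

variable {A : Type*} [MeasurableSpace A] {μ : Measure A} [IsFiniteMeasure μ] {f f' : A → ℝ}

/-- The density of `n` independent draws. -/
def prodDensity (f : A → ℝ) (n : ℕ) (z : Fin n → A) : ℝ := ∏ i, f (z i)

lemma isProbDensity_prodDensity (hf : IsProbDensity μ f) (n : ℕ) :
    IsProbDensity (Measure.pi fun _ : Fin n => μ) (prodDensity f n) where
  measurable := Finset.measurable_prod _ fun i _ => hf.measurable.comp (measurable_pi_apply i)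
  nonneg _ := Finset.prod_nonneg fun _ _ => hf.nonneg _
  integral_eq_one := by
    simp only [prodDensity]
    rw [integral_fintype_prod_eq_prod (fun _ => f)]
    simp [hf.integral_eq_one]

lemma IsProbDensity.densityMeasure_apply (hf : IsProbDensity μ f) {s : Set A}
    (hs : MeasurableSet s) : densityMeasure μ f s = ENNReal.ofReal (∫ a, s.indicator f a ∂μ) := by
  rw [densityMeasure, withDensity_apply _ hs, integral_indicator hs,
    ofReal_integral_eq_lintegral_ofReal hf.integrable.integrableOn (ae_of_all _ hf.nonneg)]

lemma IsProbDensity.isProbabilityMeasure (hf : IsProbDensity μ f) :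
    IsProbabilityMeasure (densityMeasure μ f) := by
  constructor
  rw [hf.densityMeasure_apply .univ, Set.indicator_univ, hf.integral_eq_one, ENNReal.ofReal_one]

lemma IsProbDensity.integral_densityMeasure {E : Type*} [NormedAddCommGroup E] [NormedSpace ℝ E]
    (hf : IsProbDensity μ f) (F : A → E) :
    ∫ a, F a ∂densityMeasure μ f = ∫ a, f a • F a ∂μ := by
  rw [densityMeasure, integral_withDensity_eq_integral_toReal_smul
    hf.measurable.ennreal_ofReal (ae_of_all _ fun _ => ENNReal.ofReal_lt_top)]
  exact integral_congr_ae (ae_of_all _ fun a => by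
    beta_reduce
    rw [ENNReal.toReal_ofReal (hf.nonneg a)])

lemma pi_densityMeasure (hf : IsProbDensity μ f) (n : ℕ) :
    (Measure.pi fun _ : Fin n => densityMeasure μ f) =
      densityMeasure (Measure.pi fun _ : Fin n => μ) (prodDensity f n) := by
  have := hf.isProbabilityMeasure
  refine Measure.pi_eq fun s hs => ?_
  rw [(isProbDensity_prodDensity hf n).densityMeasure_apply (MeasurableSet.univ_pi hs)]
  have e : ∀ z : Fin n → A, (Set.univ.pi s).indicator (prodDensity f n) z =
      ∏ i, (s i).indicator f (z i) := by
    intro z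
    by_cases hz : z ∈ Set.univ.pi s
    · rw [Set.indicator_of_mem hz]
      exact Finset.prod_congr rfl fun i _ => (Set.indicator_of_mem (hz i (Set.mem_univ i)) f).symm
    · rw [Set.indicator_of_notMem hz]
      simp only [Set.mem_pi, Set.mem_univ, true_imp_iff] at hz
      push Not at hz
      obtain ⟨i, hi⟩ := hz
      exact (Finset.prod_eq_zero (Finset.mem_univ i) (Set.indicator_of_notMem hi f)).symm
  simp only [e]
  rw [integral_fintype_prod_eq_prod (fun i a => (s i).indicator f a),
    ENNReal.ofReal_prod_of_nonneg fun i _ =>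
      integral_nonneg fun a => Set.indicator_nonneg (fun a _ => hf.nonneg a) a]
  exact Finset.prod_congr rfl fun i _ => (hf.densityMeasure_apply (hs i)).symm

/-- The Lipschitz constant of the product density in relative distance. -/
def prodConst (K : ℝ) (n : ℕ) : ℝ := n * (1 + K) ^ n

lemma prodConst_nonneg {K : ℝ} (hK : 0 ≤ K) (n : ℕ) : 0 ≤ prodConst K n := by
  rw [prodConst]; positivity

/-- The difference telescopes one factor at a time. The second bound controls the factors already
replaced; there `η ≤ K` keeps the constant free of `η`. -/
lemma abs_prodDensity_sub_le {η K : ℝ} (hη : 0 ≤ η) (hηK : η ≤ K) (hf : ∀ a, 0 ≤ f a)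
    (hc : ∀ a, |f a - f' a| ≤ η * f a) (n : ℕ) (z : Fin n → A) :
    |prodDensity f n z - prodDensity f' n z| ≤ prodConst K n * η * prodDensity f n z ∧
      |prodDensity f' n z| ≤ (1 + K) ^ n * prodDensity f n z := by
  have hK := hη.trans hηK
  induction n with
  | zero => simp [prodDensity, prodConst]
  | succ n ih =>
    obtain ⟨h1, h2⟩ := ih fun i => z i.succ
    have e : ∀ f : A → ℝ, prodDensity f (n + 1) z =
        f (z 0) * prodDensity f n fun i => z i.succ := fun f => Fin.prod_univ_succ _
    simp only [e]
    set P := prodDensity f n fun i => z i.succ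
    set P' := prodDensity f' n fun i => z i.succ
    have hP : 0 ≤ P := Finset.prod_nonneg fun _ _ => hf _
    have ha := hf (z 0)
    have hca := hc (z 0)
    have hpow : 0 ≤ (1 + K) ^ n := by positivity
    constructor
    · have e1 : f (z 0) * P - f' (z 0) * P' = f (z 0) * (P - P') + (f (z 0) - f' (z 0)) * P' := by
        ring
      rw [e1]
      refine (abs_add_le _ _).trans ?_
      rw [abs_mul, abs_mul, abs_of_nonneg ha]
      calc f (z 0) * |P - P'| + |f (z 0) - f' (z 0)| * |P'|
          ≤ f (z 0) * (prodConst K n * η * P) + η * f (z 0) * ((1 + K) ^ n * P) := by gcongr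
        _ = (n + 1) * (1 + K) ^ n * (η * (f (z 0) * P)) := by rw [prodConst]; ring
        _ ≤ (n + 1) * (1 + K) ^ (n + 1) * (η * (f (z 0) * P)) := by
            gcongr
            · linarith
            · omega
        _ = _ := by rw [prodConst]; push_cast; ring
    · rw [abs_mul]
      have h3 : |f' (z 0)| ≤ (1 + K) * f (z 0) := by
        have h4 : |f' (z 0)| ≤ |f (z 0)| + |f (z 0) - f' (z 0)| := by
          have := abs_sub_abs_le_abs_sub (f' (z 0)) (f (z 0))
          rw [abs_sub_comm] at this
          linarith
        rw [abs_of_nonneg ha] at h4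
        nlinarith
      calc |f' (z 0)| * |P'| ≤ ((1 + K) * f (z 0)) * ((1 + K) ^ n * P) := by gcongr
        _ = _ := by ring

lemma prod_erase_insertNth (f : A → ℝ) {n : ℕ} (i : Fin (n + 1)) (a : A) (z : Fin n → A) :
    ∏ j ∈ Finset.univ.erase i, f (i.insertNth (α := fun _ => A) a z j) = prodDensity f n z := by
  rw [Fin.univ_succAbove n i, Finset.erase_cons, Finset.prod_map]
  simp [prodDensity]

end ProductDensities

/-! ### The multi-sample objective for an abstract weight, and its gradient. -/

section MultiSample

variable {p : ℕ} {A : Type*} [MeasurableSpace A] {μ : Measure A} [IsFiniteMeasure μ] {f f' : A → ℝ}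
  {w : A → ℝ} {dw : A → EuclideanSpace ℝ (Fin p)} {δ D B η K : ℝ}
  {t t' : A → EuclideanSpace ℝ (Fin p)} {n : ℕ}

/-- Two-sided bounds on an importance weight `w` and a bound on its gradient `dw`. -/
structure WeightBounds (δ D : ℝ) (w : A → ℝ) (dw : A → EuclideanSpace ℝ (Fin p)) : Prop where
  pos : 0 < δ
  measurable : Measurable w
  ge : ∀ a, δ ≤ w a
  le : ∀ a, w a ≤ δ⁻¹
  grad_meas : StronglyMeasurable dw
  grad_le : ∀ a, ‖dw a‖ ≤ D

/-- The logarithm of the average weight. -/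
def logMean (w : A → ℝ) (n : ℕ) (z : Fin n → A) : ℝ := Real.log ((n : ℝ)⁻¹ * ∑ i, w (z i))

/-- The gradient of the logarithm of the average weight. -/
def logMeanGrad (w : A → ℝ) (dw : A → EuclideanSpace ℝ (Fin p)) (n : ℕ) (z : Fin n → A) :
    EuclideanSpace ℝ (Fin p) := (∑ i, w (z i))⁻¹ • ∑ i, dw (z i)

namespace WeightBounds

variable (h : WeightBounds δ D w dw)
include h

lemma sum_ge (z : Fin n → A) : n * δ ≤ ∑ i, w (z i) := by
  have := Finset.sum_le_sum (s := Finset.univ) fun (i : Fin n) _ => h.ge (z i)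
  simpa using this

lemma sum_le (z : Fin n → A) : ∑ i, w (z i) ≤ n * δ⁻¹ := by
  have := Finset.sum_le_sum (s := Finset.univ) fun (i : Fin n) _ => h.le (z i)
  simpa using this

lemma norm_sum_grad_le (z : Fin n → A) : ‖∑ i, dw (z i)‖ ≤ n * D := by
  have := norm_sum_le_of_le Finset.univ fun (i : Fin n) _ => h.grad_le (z i)
  simpa using this

lemma sum_pos (z : Fin (n + 1) → A) : 0 < ∑ i, w (z i) := by
  refine lt_of_lt_of_le ?_ (h.sum_ge z)
  have := h.pos
  positivity

lemma abs_logMean_le (z : Fin (n + 1) → A) : |logMean w (n + 1) z| ≤ δ⁻¹ := by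
  have hn : (0 : ℝ) < ((n + 1 : ℕ) : ℝ) := by positivity
  refine abs_log_le h.pos ?_ ?_
  · rw [le_inv_mul_iff₀ hn]; exact h.sum_ge z
  · rw [inv_mul_le_iff₀ hn]; exact h.sum_le z

lemma norm_logMeanGrad_le (z : Fin (n + 1) → A) : ‖logMeanGrad w dw (n + 1) z‖ ≤ δ⁻¹ * D := by
  have hn : (0 : ℝ) < ((n + 1 : ℕ) : ℝ) := by positivity
  have hδ := h.pos
  rw [logMeanGrad, norm_smul, norm_inv, Real.norm_of_nonneg (h.sum_pos z).le]
  calc (∑ i, w (z i))⁻¹ * ‖∑ i, dw (z i)‖ ≤ (((n + 1 : ℕ) : ℝ) * δ)⁻¹ * (((n + 1 : ℕ) : ℝ) * D) :=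
        mul_le_mul (inv_anti₀ (by positivity) (h.sum_ge z)) (h.norm_sum_grad_le z) (norm_nonneg _)
          (by positivity)
    _ = δ⁻¹ * D := by field_simp

lemma measurable_logMean : Measurable (logMean w n) :=
  ((Finset.measurable_sum _ fun i _ =>
    h.measurable.comp (measurable_pi_apply i)).const_mul _).log

lemma stronglyMeasurable_logMeanGrad : StronglyMeasurable (logMeanGrad w dw n) :=
  (Finset.measurable_sum _ fun i _ =>
    h.measurable.comp (measurable_pi_apply i)).inv.stronglyMeasurable.smul
    (Finset.stronglyMeasurable_fun_sum _ fun i _ =>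
      h.grad_meas.comp_measurable (measurable_pi_apply i))

omit h in
lemma hasGradientAt_logMean {θ : EuclideanSpace ℝ (Fin p)} {W : EuclideanSpace ℝ (Fin p) → A → ℝ}
    {dW : A → EuclideanSpace ℝ (Fin p)} (h : WeightBounds δ D (W θ) dW)
    (hd : ∀ a, HasGradientAt (fun θ' => W θ' a) (dW a) θ) (z : Fin (n + 1) → A) :
    HasGradientAt (fun θ' => logMean (W θ') (n + 1) z) (logMeanGrad (W θ) dW (n + 1) z) θ := by
  have hn : ((n + 1 : ℕ) : ℝ) ≠ 0 := by positivity
  have hs := h.sum_pos z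
  have := hasGradientAt_log (hasGradientAt_const_mul ((n + 1 : ℕ) : ℝ)⁻¹
    (hasGradientAt_sum (s := Finset.univ) fun (i : Fin (n + 1)) _ => hd (z i)))
    (mul_ne_zero (inv_ne_zero hn) hs.ne')
  have e : logMeanGrad (W θ) dW (n + 1) z = (((n + 1 : ℕ) : ℝ)⁻¹ * ∑ i, W θ (z i))⁻¹ •
      ((n + 1 : ℕ) : ℝ)⁻¹ • ∑ i, dW (z i) := by
    simp only [logMeanGrad, smul_smul]
    congr 1
    field_simp
  rw [e]
  exact this

end WeightBounds

/-- The multi-sample objective for a density `f` and a weight `w`. -/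
def multiObjective (μ : Measure A) (f w : A → ℝ) (n : ℕ) : ℝ :=
  ∫ z : Fin n → A, prodDensity f n z * logMean w n z ∂Measure.pi fun _ => μ

/-- The average of the log-weight over all draws but one. -/
def innerMean (μ : Measure A) (f w : A → ℝ) (n : ℕ) (a : A) : ℝ :=
  ∫ z : Fin n → A, prodDensity f n z *
    logMean w (n + 1) (Fin.cons (α := fun _ => A) a z) ∂Measure.pi fun _ => μ

/-- The gradient of the multi-sample objective with `n + 1` draws. -/
def multiGrad (μ : Measure A) (f w : A → ℝ) (t dw : A → EuclideanSpace ℝ (Fin p)) (n : ℕ) :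
    EuclideanSpace ℝ (Fin p) :=
  (∫ z : Fin (n + 1) → A, prodDensity f (n + 1) z • logMeanGrad w dw (n + 1) z
      ∂Measure.pi fun _ => μ) +
    ((n + 1 : ℕ) : ℝ) • ∫ a, innerMean μ f w n a • t a ∂μ

/-- The log-average is symmetric in the draws, so the position of the distinguished draw is
immaterial. -/
lemma logMean_insertNth (w : A → ℝ) (i : Fin (n + 1)) (a : A) (z : Fin n → A) :
    logMean w (n + 1) (i.insertNth (α := fun _ => A) a z) =
      logMean w (n + 1) (Fin.cons (α := fun _ => A) a z) := by
  rw [logMean, logMean, Fin.sum_univ_succAbove _ i, Fin.sum_univ_succ]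
  simp

end MultiSample

section MultiSample

variable {p : ℕ} {A : Type*} [MeasurableSpace A] {μ : Measure A} [IsFiniteMeasure μ] {f f' : A → ℝ}
  {w : A → ℝ} {dw : A → EuclideanSpace ℝ (Fin p)} {δ D B η K : ℝ}
  {t t' : A → EuclideanSpace ℝ (Fin p)} {n : ℕ}

lemma logMean_cons (w : A → ℝ) (a : A) (z : Fin n → A) :
    logMean w (n + 1) (Fin.cons (α := fun _ => A) a z) =
      Real.log (((n + 1 : ℕ) : ℝ)⁻¹ * (w a + ∑ i, w (z i))) := by
  rw [logMean, Fin.sum_univ_succ]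
  simp

namespace WeightBounds

variable (h : WeightBounds δ D w dw)
include h

lemma abs_multiObjective_le (hf : IsProbDensity μ f) :
    |multiObjective μ f w (n + 1)| ≤ δ⁻¹ := by
  refine IsProbDensity.norm_integral_le (isProbDensity_prodDensity hf (n + 1))
    (f := fun z => prodDensity f (n + 1) z * logMean w (n + 1) z) fun z => ?_
  have h0 := (isProbDensity_prodDensity hf (n + 1)).nonneg z
  rw [norm_mul, mul_comm, Real.norm_of_nonneg h0]
  exact mul_le_mul_of_nonneg_right (h.abs_logMean_le z) h0

lemma abs_innerMean_le (hf : IsProbDensity μ f) (a : A) : |innerMean μ f w n a| ≤ δ⁻¹ := by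
  refine IsProbDensity.norm_integral_le (isProbDensity_prodDensity hf n)
    (f := fun z => prodDensity f n z * logMean w (n + 1) (Fin.cons (α := fun _ => A) a z))
    fun z => ?_
  have h0 := (isProbDensity_prodDensity hf n).nonneg z
  rw [norm_mul, mul_comm, Real.norm_of_nonneg h0]
  exact mul_le_mul_of_nonneg_right (h.abs_logMean_le _) h0

lemma measurable_logMean_cons : Measurable fun b : A × (Fin n → A) =>
    logMean w (n + 1) (Fin.cons (α := fun _ => A) b.1 b.2) := by
  simp only [logMean_cons]
  refine Measurable.log (Measurable.const_mul (Measurable.add ?_ ?_) _)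
  · exact h.measurable.comp measurable_fst
  · exact Finset.measurable_sum _ fun i _ =>
      h.measurable.comp ((measurable_pi_apply i).comp measurable_snd)

lemma measurable_innerMean (hf : IsProbDensity μ f) : Measurable (innerMean μ f w n) :=
  (((isProbDensity_prodDensity hf n).measurable.comp measurable_snd).mul
    h.measurable_logMean_cons).stronglyMeasurable.integral_prod_right.measurable

lemma integrable_prodDensity_mul (hf : IsProbDensity μ f) :
    Integrable (fun z => prodDensity f (n + 1) z * logMean w (n + 1) z)
      (Measure.pi fun _ : Fin (n + 1) => μ) :=
  (isProbDensity_prodDensity hf (n + 1)).integrable.mul_bdd (c := δ⁻¹)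
    h.measurable_logMean.aestronglyMeasurable (ae_of_all _ h.abs_logMean_le)

lemma integrable_innerMean_integrand (hf : IsProbDensity μ f) (a : A) :
    Integrable (fun z => prodDensity f n z *
      logMean w (n + 1) (Fin.cons (α := fun _ => A) a z)) (Measure.pi fun _ : Fin n => μ) :=
  (isProbDensity_prodDensity hf n).integrable.mul_bdd (c := δ⁻¹)
    (h.measurable_logMean_cons.comp (f := fun z => (a, z)) (by fun_prop)).aestronglyMeasurable
    (ae_of_all _ fun _ => h.abs_logMean_le _)

lemma integrable_prodDensity_smul (hf : IsProbDensity μ f) :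
    Integrable (fun z => prodDensity f (n + 1) z • logMeanGrad w dw (n + 1) z)
      (Measure.pi fun _ : Fin (n + 1) => μ) :=
  (isProbDensity_prodDensity hf (n + 1)).integrable.smul_bdd (δ⁻¹ * D)
    h.stronglyMeasurable_logMeanGrad.aestronglyMeasurable (ae_of_all _ h.norm_logMeanGrad_le)

lemma integrable_innerMean_smul (hp : TangentPair μ B f t) :
    Integrable (fun a => innerMean μ f w n a • t a) μ :=
  hp.integrable.bdd_smul δ⁻¹ (h.measurable_innerMean hp.dens).aestronglyMeasurable
    (ae_of_all _ (h.abs_innerMean_le hp.dens))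

lemma norm_multiGrad_le (hp : TangentPair μ B f t) :
    ‖multiGrad μ f w t dw n‖ ≤ δ⁻¹ * D + (n + 1 : ℕ) * (δ⁻¹ * B) := by
  have hδ := h.pos
  refine (norm_add_le _ _).trans (add_le_add ?_ ?_)
  · refine IsProbDensity.norm_integral_le (isProbDensity_prodDensity hp.dens (n + 1)) fun z => ?_
    have h0 := (isProbDensity_prodDensity hp.dens (n + 1)).nonneg z
    rw [norm_smul, mul_comm, Real.norm_of_nonneg h0]
    exact mul_le_mul_of_nonneg_right (h.norm_logMeanGrad_le z) h0
  · rw [norm_smul, Real.norm_of_nonneg (by positivity)]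
    refine mul_le_mul_of_nonneg_left (hp.dens.norm_integral_le fun a => ?_) (by positivity)
    rw [norm_smul, mul_assoc]
    exact mul_le_mul (h.abs_innerMean_le hp.dens a) (hp.le a) (norm_nonneg _) (by positivity)

lemma abs_multiObjective_sub_le (hf : IsProbDensity μ f) (hf' : IsProbDensity μ f') (hη : 0 ≤ η)
    (hηK : η ≤ K) (hc : ∀ a, |f a - f' a| ≤ η * f a) :
    |multiObjective μ f w (n + 1) - multiObjective μ f' w (n + 1)| ≤
      prodConst K (n + 1) * δ⁻¹ * η := by
  have hδ := h.pos
  have hP := prodConst_nonneg (hη.trans hηK) (n + 1)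
  have hd := isProbDensity_prodDensity hf (n + 1)
  rw [multiObjective, multiObjective, ← integral_sub (h.integrable_prodDensity_mul hf)
    (h.integrable_prodDensity_mul hf')]
  refine hd.norm_integral_le
    (f := fun z => prodDensity f (n + 1) z * logMean w (n + 1) z -
      prodDensity f' (n + 1) z * logMean w (n + 1) z) fun z => ?_
  have h0 := hd.nonneg z
  rw [← sub_mul, norm_mul]
  calc _ ≤ prodConst K (n + 1) * η * prodDensity f (n + 1) z * δ⁻¹ :=
        mul_le_mul (abs_prodDensity_sub_le hη hηK hf.nonneg hc (n + 1) z).1 (h.abs_logMean_le z)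
          (abs_nonneg _) (by positivity)
    _ = _ := by ring

lemma abs_innerMean_sub_le (hf : IsProbDensity μ f) (hf' : IsProbDensity μ f') (hη : 0 ≤ η)
    (hηK : η ≤ K) (hc : ∀ a, |f a - f' a| ≤ η * f a) (a : A) :
    |innerMean μ f w n a - innerMean μ f' w n a| ≤ prodConst K n * δ⁻¹ * η := by
  have hδ := h.pos
  have hP := prodConst_nonneg (hη.trans hηK) n
  have hd := isProbDensity_prodDensity hf n
  rw [innerMean, innerMean, ← integral_sub (h.integrable_innerMean_integrand hf a)
    (h.integrable_innerMean_integrand hf' a)]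
  refine hd.norm_integral_le
    (f := fun z => prodDensity f n z * logMean w (n + 1) (Fin.cons (α := fun _ => A) a z) -
      prodDensity f' n z * logMean w (n + 1) (Fin.cons (α := fun _ => A) a z)) fun z => ?_
  have h0 := hd.nonneg z
  rw [← sub_mul, norm_mul]
  calc _ ≤ prodConst K n * η * prodDensity f n z * δ⁻¹ :=
        mul_le_mul (abs_prodDensity_sub_le hη hηK hf.nonneg hc n z).1 (h.abs_logMean_le _)
          (abs_nonneg _) (by positivity)
    _ = _ := by ring

lemma norm_multiGrad_sub_le (hp : TangentPair μ B f t) (hp' : TangentPair μ B f' t') (hη : 0 ≤ η)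
    (hηK : η ≤ K) (hc : PairClose η f t f' t') :
    ‖multiGrad μ f w t dw n - multiGrad μ f' w t' dw n‖ ≤
      (prodConst K (n + 1) * (δ⁻¹ * D) +
        (n + 1 : ℕ) * (prodConst K n * δ⁻¹ * B + δ⁻¹)) * η := by
  have hδ := h.pos
  have hB := hp.nonneg
  have hP := prodConst_nonneg (hη.trans hηK) (n + 1)
  have hP' := prodConst_nonneg (hη.trans hηK) n
  have hd := isProbDensity_prodDensity hp.dens (n + 1)
  have hc1 := fun a => (hc a).1
  rw [multiGrad, multiGrad, add_sub_add_comm, ← smul_sub, add_mul]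
  refine (norm_add_le _ _).trans (add_le_add ?_ ?_)
  · rw [← integral_sub (h.integrable_prodDensity_smul hp.dens)
      (h.integrable_prodDensity_smul hp'.dens)]
    refine hd.norm_integral_le fun z => ?_
    have h0 := hd.nonneg z
    rw [← sub_smul, norm_smul]
    calc _ ≤ prodConst K (n + 1) * η * prodDensity f (n + 1) z * (δ⁻¹ * D) :=
          mul_le_mul (abs_prodDensity_sub_le hη hηK hp.dens.nonneg hc1 (n + 1) z).1
            (h.norm_logMeanGrad_le z) (norm_nonneg _) (by positivity)
      _ = _ := by ring
  · rw [norm_smul, Real.norm_of_nonneg (by positivity), mul_assoc,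
      ← integral_sub (h.integrable_innerMean_smul hp) (h.integrable_innerMean_smul hp')]
    refine mul_le_mul_of_nonneg_left (hp.dens.norm_integral_le fun a => ?_) (by positivity)
    have h0 := hp.dens.nonneg a
    have e : innerMean μ f w n a • t a - innerMean μ f' w n a • t' a =
        (innerMean μ f w n a - innerMean μ f' w n a) • t a +
          innerMean μ f' w n a • (t a - t' a) := by module
    rw [e]
    refine (norm_add_le _ _).trans ?_
    rw [norm_smul, norm_smul]
    calc _ ≤ (prodConst K n * δ⁻¹ * η) * (B * f a) + δ⁻¹ * (η * f a) :=
          add_le_add (mul_le_mul (h.abs_innerMean_sub_le hp.dens hp'.dens hη hηK hc1 a) (hp.le a)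
            (norm_nonneg _) (by positivity)) (mul_le_mul (h.abs_innerMean_le hp'.dens a) (hc a).2
            (norm_nonneg _) (by positivity))
      _ = _ := by ring

end WeightBounds

/-- The gradient of the density of `n` independent draws. -/
def prodTangent (f : A → ℝ) (t : A → EuclideanSpace ℝ (Fin p)) (n : ℕ) (z : Fin n → A) :
    EuclideanSpace ℝ (Fin p) :=
  ∑ i, (∏ j ∈ Finset.univ.erase i, f (z j)) • t (z i)

lemma TangentPair.norm_prod_erase_smul_le (hp : TangentPair μ B f t) (z : Fin n → A) (i : Fin n) :
    ‖(∏ j ∈ Finset.univ.erase i, f (z j)) • t (z i)‖ ≤ B * prodDensity f n z := by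
  have h0 : 0 ≤ ∏ j ∈ Finset.univ.erase i, f (z j) := Finset.prod_nonneg fun _ _ => hp.dens.nonneg _
  rw [norm_smul, Real.norm_of_nonneg h0, prodDensity,
      ← Finset.prod_erase_mul _ _ (Finset.mem_univ i)]
  calc _ ≤ (∏ j ∈ Finset.univ.erase i, f (z j)) * (B * f (z i)) :=
        mul_le_mul_of_nonneg_left (hp.le _) h0
    _ = _ := by ring

lemma TangentPair.norm_prodTangent_le (hp : TangentPair μ B f t) (z : Fin n → A) :
    ‖prodTangent f t n z‖ ≤ n * (B * prodDensity f n z) := by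
  rw [prodTangent]
  have := norm_sum_le_of_le Finset.univ fun (i : Fin n) _ => hp.norm_prod_erase_smul_le z i
  simpa using this

lemma TangentPair.stronglyMeasurable_prod_erase_smul (hp : TangentPair μ B f t) (i : Fin n) :
    StronglyMeasurable fun z : Fin n → A => (∏ j ∈ Finset.univ.erase i, f (z j)) • t (z i) :=
  (Finset.measurable_prod _ fun j _ =>
    hp.dens.measurable.comp (measurable_pi_apply j)).stronglyMeasurable.smul
    (hp.meas.comp_measurable (measurable_pi_apply i))

/-- In the `i`-th term only draw `i` carries the tangent. Integrating out the others leaves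
`innerMean`, and by symmetry all `n + 1` terms coincide. -/
lemma integral_logMean_smul_prodTangent (h : WeightBounds δ D w dw) (hp : TangentPair μ B f t) :
    Integrable (fun z => logMean w (n + 1) z • prodTangent f t (n + 1) z)
        (Measure.pi fun _ : Fin (n + 1) => μ) ∧
    ∫ z : Fin (n + 1) → A, logMean w (n + 1) z • prodTangent f t (n + 1) z
        ∂(Measure.pi fun _ => μ) = ((n + 1 : ℕ) : ℝ) • ∫ a, innerMean μ f w n a • t a ∂μ := by
  have hδ := h.pos
  have hd := isProbDensity_prodDensity hp.dens (n + 1)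
  have hi : ∀ i, Integrable (fun z : Fin (n + 1) → A => logMean w (n + 1) z •
      ((∏ j ∈ Finset.univ.erase i, f (z j)) • t (z i))) (Measure.pi fun _ => μ) := fun i =>
    ((hd.integrable.const_mul B).const_mul δ⁻¹).mono'
      (h.measurable_logMean.stronglyMeasurable.smul
        (hp.stronglyMeasurable_prod_erase_smul i)).aestronglyMeasurable
      (ae_of_all _ fun z => by
        rw [norm_smul]
        exact mul_le_mul (h.abs_logMean_le z) (hp.norm_prod_erase_smul_le z i) (norm_nonneg _)
          (by positivity))
  simp only [prodTangent, Finset.smul_sum]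
  refine ⟨integrable_finsetSum _ fun i _ => hi i, ?_⟩
  rw [integral_finsetSum _ fun i _ => hi i]
  have key : ∀ i : Fin (n + 1), ∫ z : Fin (n + 1) → A, logMean w (n + 1) z •
      ((∏ j ∈ Finset.univ.erase i, f (z j)) • t (z i)) ∂(Measure.pi fun _ => μ) =
      ∫ a, innerMean μ f w n a • t a ∂μ := by
    intro i
    have hint := integrable_pi_insertNth μ i (hi i)
    rw [integral_pi_insertNth μ i]
    simp only [prod_erase_insertNth, logMean_insertNth, Fin.insertNth_apply_same] at hint ⊢
    rw [integral_prod _ hint]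
    refine integral_congr_ae (ae_of_all _ fun a => ?_)
    simp only [smul_smul]
    rw [integral_smul_const, innerMean]
    simp only [mul_comm]
  rw [Finset.sum_congr rfl fun i _ => key i, Finset.sum_const, Finset.card_univ, Fintype.card_fin,
    Nat.cast_smul_eq_nsmul]

/-- Differentiation of the multi-sample objective. -/
lemma hasGradientAt_multiObjective {Θ : Set (EuclideanSpace ℝ (Fin p))}
    {θ : EuclideanSpace ℝ (Fin p)} (hΘ : IsOpen Θ) (hθ : θ ∈ Θ)
    {F W : EuclideanSpace ℝ (Fin p) → A → ℝ}
    {T dW : EuclideanSpace ℝ (Fin p) → A → EuclideanSpace ℝ (Fin p)} {env : A → ℝ}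
    (hp : ∀ θ' ∈ Θ, TangentPair μ B (F θ') (T θ'))
    (hw : ∀ θ' ∈ Θ, WeightBounds δ D (W θ') (dW θ'))
    (hdF : ∀ θ' ∈ Θ, ∀ a, HasGradientAt (fun θ'' => F θ'' a) (T θ' a) θ')
    (hdW : ∀ θ' ∈ Θ, ∀ a, HasGradientAt (fun θ'' => W θ'' a) (dW θ' a) θ')
    (henv : ∀ θ' ∈ Θ, ∀ a, F θ' a ≤ env a) (he : Integrable env μ) (hD : 0 ≤ D) :
    HasGradientAt (fun θ' => multiObjective μ (F θ') (W θ') (n + 1))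
      (multiGrad μ (F θ) (W θ) (T θ) (dW θ) n) θ := by
  have hδ := (hw θ hθ).pos
  have hB := (hp θ hθ).nonneg
  have hd := fun θ' hθ' => isProbDensity_prodDensity (hp θ' hθ').dens (n + 1)
  obtain ⟨hi, hint⟩ := integral_logMean_smul_prodTangent (n := n) (hw θ hθ) (hp θ hθ)
  have hi' := (hw θ hθ).integrable_prodDensity_smul (n := n) (hp θ hθ).dens
  have key : HasGradientAt (fun θ' => multiObjective μ (F θ') (W θ') (n + 1))
      (∫ z : Fin (n + 1) → A, (prodDensity (F θ) (n + 1) z • logMeanGrad (W θ) (dW θ) (n + 1) z +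
        logMean (W θ) (n + 1) z • prodTangent (F θ) (T θ) (n + 1) z) ∂(Measure.pi fun _ => μ))
      θ := by
    refine hasGradientAt_integral hΘ hθ
      (G := fun θ z => prodDensity (F θ) (n + 1) z • logMeanGrad (W θ) (dW θ) (n + 1) z +
        logMean (W θ) (n + 1) z • prodTangent (F θ) (T θ) (n + 1) z)
      -- Every part of the gradient is at most a constant times the product density, which is
      -- dominated by the product of one-coordinate envelopes.
      (bound := fun z => (δ⁻¹ * D + δ⁻¹ * ((n + 1 : ℕ) * B)) * ∏ i, env (z i))
      (fun θ' hθ' =>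
          ((hd θ' hθ').measurable.mul (hw θ' hθ').measurable_logMean).aestronglyMeasurable)
      ((hw θ hθ).integrable_prodDensity_mul (hp θ hθ).dens)
      (hi'.add hi).aestronglyMeasurable (fun θ' hθ' z => ?_)
      ((Integrable.fintype_prod (f := fun (_ : Fin (n + 1)) => env) fun _ => he).const_mul _)
      (fun θ' hθ' z => ?_)
    · have h0 := (hd θ' hθ').nonneg z
      have h1 := (hw θ' hθ').norm_logMeanGrad_le z
      have h2 := (hw θ' hθ').abs_logMean_le z
      have h3 := (hp θ' hθ').norm_prodTangent_le z
      have h4 : prodDensity (F θ') (n + 1) z ≤ ∏ i, env (z i) :=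
        Finset.prod_le_prod (fun _ _ => (hp θ' hθ').dens.nonneg _) fun _ _ => henv θ' hθ' _
      refine (norm_add_le _ _).trans ?_
      rw [norm_smul, norm_smul, Real.norm_of_nonneg h0, Real.norm_eq_abs]
      calc _ ≤ prodDensity (F θ') (n + 1) z * (δ⁻¹ * D) +
            δ⁻¹ * ((n + 1 : ℕ) * (B * prodDensity (F θ') (n + 1) z)) := by gcongr
        _ = (δ⁻¹ * D + δ⁻¹ * ((n + 1 : ℕ) * B)) * prodDensity (F θ') (n + 1) z := by ring
        _ ≤ _ := by gcongr
    · exact hasGradientAt_mul (hasGradientAt_prod (s := Finset.univ)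
        fun (i : Fin (n + 1)) _ => hdF θ' hθ' (z i))
        (WeightBounds.hasGradientAt_logMean (hw θ' hθ') (hdW θ' hθ') z)
  rw [integral_add hi' hi, hint] at key
  exact key

end MultiSample

/-! ### Adjoining the noise variable. -/

section Lift

variable {S U : Type*} [MeasurableSpace S] [MeasurableSpace U] {ξ : Measure S} [IsFiniteMeasure ξ]
  {ν : Measure U} [IsProbabilityMeasure ν] {φ φ' : S → ℝ}

lemma IsProbDensity.comp_fst (hφ : IsProbDensity ξ φ) (ν : Measure U) [IsProbabilityMeasure ν] :
    IsProbDensity (ξ.prod ν) fun a : S × U => φ a.1 where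
  measurable := hφ.measurable.comp measurable_fst
  nonneg _ := hφ.nonneg _
  integral_eq_one := by rw [integral_fun_fst, probReal_univ, one_smul, hφ.integral_eq_one]

lemma TangentPair.comp_fst {E : Type*} [NormedAddCommGroup E] {B : ℝ} {τ : S → E}
    (h : TangentPair ξ B φ τ) (ν : Measure U) [IsProbabilityMeasure ν] :
    TangentPair (ξ.prod ν) B (fun a : S × U => φ a.1) fun a => τ a.1 where
  dens := h.dens.comp_fst ν
  meas := h.meas.comp_measurable measurable_fst
  le _ := h.le _

lemma densityMeasure_prod (hφ : IsProbDensity ξ φ) :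
    (densityMeasure ξ φ).prod ν = densityMeasure (ξ.prod ν) fun a : S × U => φ a.1 :=
  prod_withDensity_left hφ.measurable.ennreal_ofReal

end Lift

/-! ### Reparameterised proposals and importance weights. -/

section Proposal

variable {p : ℕ} {S O U : Type*} [MeasurableSpace S] [MeasurableSpace O] [MeasurableSpace U]
  {ξ : Measure S} [IsFiniteMeasure ξ] {ν : Measure U} [IsProbabilityMeasure ν]
  {Θ : Set (EuclideanSpace ℝ (Fin p))} {ε κ : ℝ}
  {m₀ : S → ℝ} {m : EuclideanSpace ℝ (Fin p) → S → S → ℝ}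
  {g : EuclideanSpace ℝ (Fin p) → S → O → ℝ} {r : EuclideanSpace ℝ (Fin p) → S → O → S → ℝ}
  {h : EuclideanSpace ℝ (Fin p) → S → O → U → S} {θ : EuclideanSpace ℝ (Fin p)}
  {φ : S → ℝ} {τ : S → EuclideanSpace ℝ (Fin p)}

/-- A parametric state-space model together with a reparameterised proposal. -/
structure ProposalModel (ξ : Measure S) (ν : Measure U) (Θ : Set (EuclideanSpace ℝ (Fin p)))
    (ε κ : ℝ) (m₀ : S → ℝ) (m : EuclideanSpace ℝ (Fin p) → S → S → ℝ)
    (g : EuclideanSpace ℝ (Fin p) → S → O → ℝ) (r : EuclideanSpace ℝ (Fin p) → S → O → S → ℝ)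
    (h : EuclideanSpace ℝ (Fin p) → S → O → U → S) : Prop where
  model : ParamModel ξ Θ ε κ m₀ m g
  dens : ∀ θ ∈ Θ, IsTransitionDensity ξ (fun (a : S × O) x' => r θ a.1 a.2 x')
  meas : ∀ θ ∈ Θ, Measurable fun a : S × O × U => h θ a.1 a.2.1 a.2.2
  map_eq : ∀ θ ∈ Θ, ∀ x y, ν.map (h θ x y) = densityMeasure ξ (r θ x y)
  mem : ∀ θ ∈ Θ, ∀ x y x', ε ≤ r θ x y x' ∧ r θ x y x' ≤ ε⁻¹
  diff_trans : ∀ θ ∈ Θ, ∀ x y u, DifferentiableAt ℝ (fun θ' => m θ' x (h θ' x y u)) θ ∧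
      ‖gradient (fun θ' => m θ' x (h θ' x y u)) θ‖ ≤ κ
  diff_emission : ∀ θ ∈ Θ, ∀ x y u, DifferentiableAt ℝ (fun θ' => g θ' (h θ' x y u) y) θ ∧
      ‖gradient (fun θ' => g θ' (h θ' x y u) y) θ‖ ≤ κ
  diff_dens : ∀ θ ∈ Θ, ∀ x y u, DifferentiableAt ℝ (fun θ' => r θ' x y (h θ' x y u)) θ ∧
      ‖gradient (fun θ' => r θ' x y (h θ' x y u)) θ‖ ≤ κ

/-- The bound on the gradient of the importance weights. -/
def weightGradBound (ε κ : ℝ) : ℝ := 2 * (ε⁻¹ ^ 2 * κ) + ε⁻¹ ^ 4 * κ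

namespace ProposalModel

variable (H : ProposalModel ξ ν Θ ε κ m₀ m g r h)
include H

lemma hasGradientAt_weight (hθ : θ ∈ Θ) (x : S) (y : O) (u : U) :
    HasGradientAt (fun θ' => weight m g r h θ' x y u)
      (gradient (fun θ' => weight m g r h θ' x y u) θ) θ ∧
    ‖gradient (fun θ' => weight m g r h θ' x y u) θ‖ ≤ weightGradBound ε κ := by
  have hs := (H.model.bounds θ hθ).step y
  have hε := hs.pos
  have hκ := H.model.grad_nonneg hθ
  obtain ⟨dm, bm⟩ := H.diff_trans θ hθ x y u
  obtain ⟨dg, bg⟩ := H.diff_emission θ hθ x y u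
  obtain ⟨dr, br⟩ := H.diff_dens θ hθ x y u
  obtain ⟨r1, r2⟩ := H.mem θ hθ x y (h θ x y u)
  have r0 := hε.trans_le r1
  have hw : HasGradientAt (fun θ' => weight m g r h θ' x y u) _ θ :=
    hasGradientAt_div (hasGradientAt_mul dg.hasGradientAt dm.hasGradientAt) dr.hasGradientAt r0.ne'
  rw [hw.gradient]
  refine ⟨hw, (norm_sub_le _ _).trans ?_⟩
  have g0 := hs.nonneg (h θ x y u)
  have m0 := hs.trans_nonneg x (h θ x y u)
  have g1 := hs.le (h θ x y u)
  have m1 := hs.trans_le x (h θ x y u)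
  have ri := inv_anti₀ hε r1
  rw [norm_smul, norm_smul, norm_inv, norm_mul, norm_mul, norm_inv, norm_pow,
    Real.norm_of_nonneg r0.le, Real.norm_of_nonneg g0, Real.norm_of_nonneg m0, ← inv_pow]
  have hn : ‖g θ (h θ x y u) y • gradient (fun θ' => m θ' x (h θ' x y u)) θ +
      m θ x (h θ x y u) • gradient (fun θ' => g θ' (h θ' x y u) y) θ‖ ≤ ε⁻¹ * κ + ε⁻¹ * κ := by
    refine (norm_add_le _ _).trans ?_
    rw [norm_smul, norm_smul, Real.norm_of_nonneg g0, Real.norm_of_nonneg m0]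
    gcongr
  calc _ ≤ ε⁻¹ * (ε⁻¹ * κ + ε⁻¹ * κ) + ε⁻¹ * ε⁻¹ * ε⁻¹ ^ 2 * κ := by gcongr
    _ = _ := by rw [weightGradBound]; ring

lemma weight_mem (hθ : θ ∈ Θ) (x : S) (y : O) (u : U) :
    ε ^ 3 ≤ weight m g r h θ x y u ∧ weight m g r h θ x y u ≤ (ε ^ 3)⁻¹ := by
  have hs := (H.model.bounds θ hθ).step y
  have hε := hs.pos
  obtain ⟨r1, r2⟩ := H.mem θ hθ x y (h θ x y u)
  have r0 := hε.trans_le r1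
  have g1 := hs.le (h θ x y u)
  have m1 := hs.trans_le x (h θ x y u)
  have g2 := hs.ge (h θ x y u)
  have m2 := hs.trans_ge x (h θ x y u)
  have g0 := hs.nonneg (h θ x y u)
  have m0 := hs.trans_nonneg x (h θ x y u)
  rw [weight, div_eq_mul_inv]
  constructor
  · have ri : ε ≤ (r θ x y (h θ x y u))⁻¹ := by
      have := inv_anti₀ r0 r2
      rwa [inv_inv] at this
    calc ε ^ 3 = ε * ε * ε := by ring
      _ ≤ _ := by gcongr
  · have ri := inv_anti₀ hε r1
    calc _ ≤ ε⁻¹ * ε⁻¹ * ε⁻¹ := by gcongr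
      _ = _ := by rw [← inv_pow]; ring

lemma measurable_weight (hθ : θ ∈ Θ) :
    Measurable fun a : O × (S × U) => weight m g r h θ a.2.1 a.1 a.2.2 := by
  rcases isEmpty_or_nonempty O with hO | ⟨⟨y₀⟩⟩
  · have : IsEmpty (O × (S × U)) := ⟨fun a => hO.false a.1⟩
    exact measurable_of_empty _
  have hb := H.model.bounds θ hθ
  have hh : Measurable fun a : O × (S × U) => h θ a.2.1 a.1 a.2.2 :=
    (H.meas θ hθ).comp (f := fun a : O × (S × U) => (a.2.1, a.1, a.2.2)) (by fun_prop)
  have hg : Measurable fun a : O × (S × U) => g θ (h θ a.2.1 a.1 a.2.2) a.1 :=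
    hb.measurable.comp (hh.prodMk measurable_fst)
  have hm : Measurable fun a : O × (S × U) => m θ a.2.1 (h θ a.2.1 a.1 a.2.2) :=
    (hb.step y₀).trans.measurable.comp ((measurable_fst.comp measurable_snd).prodMk hh)
  have hr : Measurable fun a : O × (S × U) => r θ a.2.1 a.1 (h θ a.2.1 a.1 a.2.2) :=
    (H.dens θ hθ).measurable.comp
      (((measurable_fst.comp measurable_snd).prodMk measurable_fst).prodMk hh)
  exact (hg.mul hm).div hr

lemma weightBounds (hθ : θ ∈ Θ) (y : O) :
    WeightBounds (ε ^ 3) (weightGradBound ε κ) (fun a : S × U => weight m g r h θ a.1 y a.2)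
      fun a => gradient (fun θ' => weight m g r h θ' a.1 y a.2) θ where
  pos := pow_pos ((H.model.bounds θ hθ).step y).pos 3
  measurable := (H.measurable_weight hθ).comp (f := fun a => (y, a)) (by fun_prop)
  ge a := (H.weight_mem hθ a.1 y a.2).1
  le a := (H.weight_mem hθ a.1 y a.2).2
  grad_meas := (measurable_of_hasGradientAt H.model.isOpen hθ
    (F := fun θ' (a : S × U) => weight m g r h θ' a.1 y a.2)
    (fun θ' hθ' => (H.measurable_weight hθ').comp (f := fun a => (y, a)) (by fun_prop))
    fun a => (H.hasGradientAt_weight hθ a.1 y a.2).1).stronglyMeasurable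
  grad_le a := (H.hasGradientAt_weight hθ a.1 y a.2).2

/-- Given the first coordinate this is the push-forward identity `map_eq`; Fubini does the rest. It
moves the dependence on `r` from the sampling law into the weights. -/
lemma recognition_eq (hθ : θ ∈ Θ) (y : O) (hφ : IsProbDensity ξ φ) :
    recognition ξ (r θ) y φ =
      ((densityMeasure ξ φ).prod ν).map fun a : S × U => (a.1, h θ a.1 y a.2) := by
  have hh : Measurable fun a : S × U => h θ a.1 y a.2 :=
    (H.meas θ hθ).comp (f := fun a : S × U => (a.1, y, a.2)) (by fun_prop)
  have hr : Measurable fun z : S × S => r θ z.1 y z.2 :=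
    (H.dens θ hθ).measurable.comp (f := fun z : S × S => ((z.1, y), z.2)) (by fun_prop)
  have := hφ.isProbabilityMeasure
  have hd : Measurable fun z : S × S => ENNReal.ofReal (φ z.1 * r θ z.1 y z.2) :=
    ((hφ.measurable.comp measurable_fst).mul hr).ennreal_ofReal
  refine Measure.ext_of_lintegral _ fun F hF => ?_
  have hFh : Measurable fun a : S × U => F (a.1, h θ a.1 y a.2) :=
      hF.comp (measurable_fst.prodMk hh)
  rw [lintegral_map hF (measurable_fst.prodMk hh), recognition,
    lintegral_withDensity_eq_lintegral_mul _ hd hF, lintegral_prod _ (hd.mul hF).aemeasurable,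
    lintegral_prod _ hFh.aemeasurable, densityMeasure, lintegral_withDensity_eq_lintegral_mul _
      hφ.measurable.ennreal_ofReal hFh.lintegral_prod_right']
  refine lintegral_congr fun x => ?_
  have hFx : Measurable fun x' => F (x, x') := hF.comp (f := fun x' => (x, x')) (by fun_prop)
  have hhx : Measurable (h θ x y) := hh.comp (f := fun u => (x, u)) (by fun_prop)
  have hrx : Measurable (r θ x y) := hr.comp (f := fun x' => (x, x')) (by fun_prop)
  simp only [Pi.mul_apply, ENNReal.ofReal_mul (hφ.nonneg x), mul_assoc]
  have hrF : Measurable fun x' => ENNReal.ofReal (r θ x y x') * F (x, x') :=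
    hrx.ennreal_ofReal.mul hFx
  rw [lintegral_const_mul _ hrF]
  congr 1
  rw [← lintegral_map hFx hhx, H.map_eq θ hθ x y, densityMeasure,
    lintegral_withDensity_eq_lintegral_mul _ hrx.ennreal_ofReal hFx]
  rfl

lemma iwaeObjective_eq (hθ : θ ∈ Θ) (M : ℕ) (y : O) (hφ : IsProbDensity ξ φ) :
    iwaeObjective ξ (m θ) (g θ) (r θ) M y φ =
      multiObjective (ξ.prod ν) (fun a => φ a.1) (fun a => weight m g r h θ a.1 y a.2) M := by
  have hb := H.model.bounds θ hθ
  have hε := (hb.step y).pos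
  have hh : Measurable fun a : S × U => (a.1, h θ a.1 y a.2) := measurable_fst.prodMk
    ((H.meas θ hθ).comp (f := fun a : S × U => (a.1, y, a.2)) (by fun_prop))
  have hr : Measurable fun z : S × S => r θ z.1 y z.2 :=
    (H.dens θ hθ).measurable.comp (f := fun z : S × S => ((z.1, y), z.2)) (by fun_prop)
  have hg : Measurable fun z : S × S => g θ z.2 y :=
    hb.measurable.comp (f := fun z : S × S => (z.2, y)) (by fun_prop)
  have hφ1 : Measurable fun z : S × S => φ z.1 := hφ.measurable.comp measurable_fst
  have hratio : Measurable fun z : S × S =>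
      φ z.1 * m θ z.1 z.2 * g θ z.2 y / (φ z.1 * r θ z.1 y z.2) :=
    ((hφ1.mul (hb.step y).trans.measurable).mul hg).div (hφ1.mul hr)
  have := hφ.isProbabilityMeasure
  have := Measure.isProbabilityMeasure_map (μ := (densityMeasure ξ φ).prod ν) hh.aemeasurable
  have hm : Measurable fun z : Fin M → S × S => Real.log ((M : ℝ)⁻¹ * ∑ i,
      (φ (z i).1 * m θ (z i).1 (z i).2 * g θ (z i).2 y) / (φ (z i).1 * r θ (z i).1 y (z i).2)) :=
    ((Finset.measurable_sum _ fun i _ => hratio.comp (measurable_pi_apply i)).const_mul _).log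
  have hpm : Measurable fun (z : Fin M → S × U) (i : Fin M) =>
      ((z i).1, h θ (z i).1 y (z i).2) :=
    measurable_pi_lambda _ fun i => hh.comp (measurable_pi_apply i)
  rw [iwaeObjective, H.recognition_eq hθ y hφ,
    ← Measure.pi_map_pi (μ := fun _ : Fin M => (densityMeasure ξ φ).prod ν)
      (f := fun _ (a : S × U) => (a.1, h θ a.1 y a.2)) fun _ => hh.aemeasurable,
    integral_map hpm.aemeasurable hm.aestronglyMeasurable,
    densityMeasure_prod hφ, pi_densityMeasure (hφ.comp_fst ν),
    (isProbDensity_prodDensity (hφ.comp_fst ν) M).integral_densityMeasure, multiObjective]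
  refine integral_congr_ae (ae_of_all _ fun z => ?_)
  simp only [smul_eq_mul]
  -- The ratio cancels `φ` only where it is nonzero. If `φ` vanishes at some draw, the product
  -- density is zero and the value of the logarithm is irrelevant.
  by_cases h0 : ∃ i, φ (z i).1 = 0
  · obtain ⟨i, hi⟩ := h0
    have : prodDensity (fun a : S × U => φ a.1) M z = 0 :=
      Finset.prod_eq_zero (Finset.mem_univ i) hi
    rw [this, zero_mul, zero_mul]
  · push Not at h0
    congr 1
    rw [logMean]
    congr 2
    refine Finset.sum_congr rfl fun i _ => ?_
    rw [mul_assoc, mul_div_mul_left _ _ (h0 i), weight, mul_comm (m θ _ _)]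

lemma iwaeGrad_eq {B : ℝ} (hθ : θ ∈ Θ) (n : ℕ) (y : O) (hp : TangentPair ξ B φ τ) :
    iwaeGrad ξ ν m g r h (n + 1) θ y φ τ =
      multiGrad (ξ.prod ν) (fun a => φ a.1) (fun a => weight m g r h θ a.1 y a.2)
        (fun a => τ a.1) (fun a => gradient (fun θ' => weight m g r h θ' a.1 y a.2) θ) n := by
  have hφ := hp.dens.comp_fst ν
  have hint := (H.weightBounds hθ y).integrable_innerMean_smul (n := n) (hp.comp_fst ν)
  rw [iwaeGrad, multiGrad, densityMeasure_prod hp.dens, pi_densityMeasure hφ,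
    (isProbDensity_prodDensity hφ (n + 1)).integral_densityMeasure, integral_prod _ hint]
  have e : ∀ x u, ∫ z : Fin (n + 1 - 1) → S × U, Real.log (((n + 1 : ℕ) : ℝ)⁻¹ *
      weight m g r h θ x y u + ((n + 1 : ℕ) : ℝ)⁻¹ * ∑ i, weight m g r h θ (z i).1 y (z i).2)
      ∂(Measure.pi fun _ => densityMeasure (ξ.prod ν) fun a : S × U => φ a.1) =
      innerMean (ξ.prod ν) (fun a => φ a.1) (fun a => weight m g r h θ a.1 y a.2) n (x, u) := by
    intro x u
    -- Here `n + 1 - 1` reduces to `n` by definition.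
    change ∫ z : Fin n → S × U, _ ∂(Measure.pi fun _ : Fin n => _) = _
    rw [pi_densityMeasure hφ, (isProbDensity_prodDensity hφ n).integral_densityMeasure, innerMean]
    simp only [logMean_cons, mul_add, smul_eq_mul]
    rfl
  simp only [e]
  rfl

end ProposalModel

end Proposal

/-! ### Forgetting of the multi-sample objective and of its gradient. -/

section Forgetting

variable {p : ℕ} {S O U : Type*} [MeasurableSpace S] [MeasurableSpace O] [MeasurableSpace U]
  {ξ : Measure S} [IsFiniteMeasure ξ] {ν : Measure U} [IsProbabilityMeasure ν]
  {Θ : Set (EuclideanSpace ℝ (Fin p))} {ε κ : ℝ}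
  {m₀ : S → ℝ} {m : EuclideanSpace ℝ (Fin p) → S → S → ℝ}
  {g : EuclideanSpace ℝ (Fin p) → S → O → ℝ} {r : EuclideanSpace ℝ (Fin p) → S → O → S → ℝ}
  {h : EuclideanSpace ℝ (Fin p) → S → O → U → S} {θ : EuclideanSpace ℝ (Fin p)}

lemma weightGradBound_nonneg (hε : 0 < ε) (hκ : 0 ≤ κ) : 0 ≤ weightGradBound ε κ := by
  rw [weightGradBound]; positivity

lemma pairBound_nonneg (hε : 0 < ε) (hκ : 0 ≤ κ) : 0 ≤ pairBound ε κ := by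
  have hB := oscBound_nonneg hε hκ
  have hF := forgetBound_nonneg hε hκ
  rw [pairBound]; positivity

namespace ProposalModel

variable (H : ProposalModel ξ ν Θ ε κ m₀ m g r h)
include H

lemma hasGradientAt_iwaeObjective (hθ : θ ∈ Θ) (n : ℕ) (y : ℕ → O) (k : ℕ) :
    HasGradientAt (fun θ' => iwaeObjective ξ (m θ') (g θ') (r θ') (n + 1) (y (k + 1))
      (filt ξ m₀ (m θ') (g θ') y k))
      (iwaeGrad ξ ν m g r h (n + 1) θ (y (k + 1)) (filt ξ m₀ (m θ) (g θ) y k)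
        (paramTangent ξ m₀ m g θ y k)) θ := by
  have hb := H.model.bounds θ hθ
  have key := hasGradientAt_multiObjective (n := n) (μ := ξ.prod ν) H.model.isOpen hθ
    (F := fun θ' a => filt ξ m₀ (m θ') (g θ') y k a.1)
    (T := fun θ' a => paramTangent ξ m₀ m g θ' y k a.1)
    (W := fun θ' a => weight m g r h θ' a.1 (y (k + 1)) a.2)
    (dW := fun θ' a => gradient (fun θ'' => weight m g r h θ'' a.1 (y (k + 1)) a.2) θ')
    (env := fun a => ε⁻¹ ^ 5 * (1 + m₀ a.1))
    (fun θ' hθ' => (H.model.tangentPair hθ' y k).comp_fst ν)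
    (fun θ' hθ' => H.weightBounds hθ' (y (k + 1)))
    (fun θ' hθ' a => H.model.hasGradientAt_filt y k θ' hθ' a.1)
    (fun θ' hθ' a => (H.hasGradientAt_weight hθ' a.1 (y (k + 1)) a.2).1)
    (fun θ' hθ' a => filt_le (H.model.bounds θ' hθ') y k a.1)
    ((((integrable_const 1).add hb.initial.integrable).const_mul (ε⁻¹ ^ 5)).comp_fst ν)
    (weightGradBound_nonneg (hb.step (y 0)).pos (H.model.grad_nonneg hθ))
  rw [H.iwaeGrad_eq hθ n _ (H.model.tangentPair hθ y k)]
  refine key.congr_of_eventuallyEq ?_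
  filter_upwards [H.model.isOpen.mem_nhds hθ] with θ' hθ'
  exact H.iwaeObjective_eq hθ' (n + 1) _ (isProbDensity_filt (H.model.bounds θ' hθ') y k)

lemma measurable_iwaeObjective (hθ : θ ∈ Θ) (M k : ℕ) : Measurable fun y : ℕ → O =>
    iwaeObjective ξ (m θ) (g θ) (r θ) M (y (k + 1)) (filt ξ m₀ (m θ) (g θ) y k) := by
  have hb := H.model.bounds θ hθ
  simp only [H.iwaeObjective_eq hθ M _ (isProbDensity_filt hb _ k)]
  have hf : Measurable fun a : (ℕ → O) × (Fin M → S × U) =>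
      prodDensity (fun b : S × U => filt ξ m₀ (m θ) (g θ) a.1 k b.1) M a.2 :=
    Finset.measurable_prod _ fun i _ => (measurable_filt hb k).comp
      (f := fun a : (ℕ → O) × (Fin M → S × U) => (a.1, (a.2 i).1)) (by fun_prop)
  have hw : Measurable fun a : (ℕ → O) × (Fin M → S × U) =>
      logMean (fun b : S × U => weight m g r h θ b.1 (a.1 (k + 1)) b.2) M a.2 :=
    ((Finset.measurable_sum _ fun i _ => (H.measurable_weight hθ).comp
      (f := fun a : (ℕ → O) × (Fin M → S × U) => (a.1 (k + 1), a.2 i))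
      (by fun_prop)).const_mul _).log
  exact (hf.mul hw).stronglyMeasurable.integral_prod_right.measurable

lemma isForgetting_iwaeObjective (hθ : θ ∈ Θ) (hε : 0 < ε) (hε1 : ε ≤ 1) (n : ℕ) :
    IsForgetting (2 * (ε ^ 3)⁻¹ + (prodConst (pairBound ε κ) (n + 1) * (ε ^ 3)⁻¹) *
      pairBound ε κ / forgetRate ε) (forgetRate ε) fun k (y : ℕ → O) =>
        iwaeObjective ξ (m θ) (g θ) (r θ) (n + 1) (y (k + 1)) (filt ξ m₀ (m θ) (g θ) y k) := by
  have hκ := H.model.grad_nonneg hθ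
  have hP := prodConst_nonneg (pairBound_nonneg hε hκ) (n + 1)
  refine H.model.isForgetting hθ
    (V := fun y φ _ => iwaeObjective ξ (m θ) (g θ) (r θ) (n + 1) y φ)
    (H.measurable_iwaeObjective hθ (n + 1)) (fun y φ τ hφ => ?_) (by positivity)
    (fun y φ τ φ' τ' η hφ hφ' hη hηK hc => ?_) hε hε1
  · rw [H.iwaeObjective_eq hθ _ y hφ.dens]
    exact (H.weightBounds hθ y).abs_multiObjective_le (hφ.dens.comp_fst ν)
  · rw [H.iwaeObjective_eq hθ _ y hφ.dens, H.iwaeObjective_eq hθ _ y hφ'.dens]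
    exact (H.weightBounds hθ y).abs_multiObjective_sub_le (hφ.dens.comp_fst ν)
      (hφ'.dens.comp_fst ν) hη hηK fun a => (hc a.1).1

lemma isForgetting_iwaeGrad (hθ : θ ∈ Θ) (hε : 0 < ε) (hε1 : ε ≤ 1) (n : ℕ) :
    IsForgetting (2 * ((ε ^ 3)⁻¹ * weightGradBound ε κ + (n + 1 : ℕ) * ((ε ^ 3)⁻¹ * oscBound ε κ)) +
      (prodConst (pairBound ε κ) (n + 1) * ((ε ^ 3)⁻¹ * weightGradBound ε κ) +
        (n + 1 : ℕ) * (prodConst (pairBound ε κ) n * (ε ^ 3)⁻¹ * oscBound ε κ + (ε ^ 3)⁻¹)) *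
      pairBound ε κ / forgetRate ε) (forgetRate ε) fun k (y : ℕ → O) =>
        iwaeGrad ξ ν m g r h (n + 1) θ (y (k + 1)) (filt ξ m₀ (m θ) (g θ) y k)
          (paramTangent ξ m₀ m g θ y k) := by
  have hκ := H.model.grad_nonneg hθ
  have hK := pairBound_nonneg hε hκ
  have hB := oscBound_nonneg hε hκ
  have hW := weightGradBound_nonneg hε hκ
  have hP := prodConst_nonneg hK (n + 1)
  have hP' := prodConst_nonneg hK n
  refine H.model.isForgetting hθ (V := fun y φ τ => iwaeGrad ξ ν m g r h (n + 1) θ y φ τ)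
    (fun k => measurable_of_hasGradientAt H.model.isOpen hθ
      (fun θ' hθ' => H.measurable_iwaeObjective hθ' (n + 1) k)
      fun y => H.hasGradientAt_iwaeObjective hθ n y k)
    (fun y φ τ hφ => ?_) (by positivity) (fun y φ τ φ' τ' η hφ hφ' hη hηK hc => ?_) hε hε1
  · rw [H.iwaeGrad_eq hθ n y hφ]
    exact (H.weightBounds hθ y).norm_multiGrad_le (hφ.comp_fst ν)
  · rw [H.iwaeGrad_eq hθ n y hφ, H.iwaeGrad_eq hθ n y hφ']
    exact (H.weightBounds hθ y).norm_multiGrad_sub_le (hφ.comp_fst ν) (hφ'.comp_fst ν) hη hηK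
      fun a => hc a.1

end ProposalModel

end Forgetting

/-! ### Contrast functions for functionals of the observations alone. -/

section Contrast

variable {p : ℕ} {Z O Ω : Type*} [MeasurableSpace Z] [MeasurableSpace O] [MeasurableSpace Ω]
  {P : Measure Ω} [IsProbabilityMeasure P] {μ : Measure Z} [IsFiniteMeasure μ] {q : Z → Z → ℝ}
  {W : ℕ → Ω → Z} {C C' ρ : ℝ}

/-- The contrast function associated with forgetting functionals of a function of a mixing
process. -/
lemma IsMixingSeq.exists_contrast_comp (hW : IsMixingSeq P μ q W ρ)
    {Θ : Set (EuclideanSpace ℝ (Fin p))} (hΘ : IsOpen Θ) {f : Z → O} (hf : Measurable f)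
    {F : EuclideanSpace ℝ (Fin p) → ℕ → (ℕ → O) → ℝ}
    {G : EuclideanSpace ℝ (Fin p) → ℕ → (ℕ → O) → EuclideanSpace ℝ (Fin p)}
    (hF : ∀ θ ∈ Θ, IsForgetting C ρ (F θ)) (hG : ∀ θ ∈ Θ, IsForgetting C' ρ (G θ))
    (hFG : ∀ θ ∈ Θ, ∀ k y, HasGradientAt (fun x => F x k y) (G θ k y) θ) :
    ∃ l : EuclideanSpace ℝ (Fin p) → ℝ, DifferentiableOn ℝ l Θ ∧ ∀ θ ∈ Θ,
      (∀ᵐ ω ∂P,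
        Tendsto (timeAverage fun s => F θ s (fun i => f (W i ω))) atTop (𝓝 (l θ)) ∧
        Tendsto (timeAverage fun s => G θ s (fun i => f (W i ω))) atTop (𝓝 (gradient l θ))) ∧
      MeanAverageTendsto P (fun s ω => F θ s (fun i => f (W i ω))) (l θ) ∧
      MeanAverageTendsto P (fun s ω => G θ s (fun i => f (W i ω))) (gradient l θ) :=
  -- The objective and its gradient forget with different constants; the larger one serves both.
  hW.exists_contrast hΘ (C := max C C')
    (F := fun θ k z => F θ k fun i => f (z i)) (G := fun θ k z => G θ k fun i => f (z i))
    (fun θ hθ => ((hF θ hθ).mono hW.pos.le (le_max_left _ _)).comp_map hf)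
    (fun θ hθ => ((hG θ hθ).mono hW.pos.le (le_max_right _ _)).comp_map hf)
    fun θ hθ k _ => hFG θ hθ k _

end Contrast

end OSIWAE

end

/-! ### The main result. -/

theorem proposition3p1 {p : ℕ} {S O U Ω : Type*}
    [MeasurableSpace S] [MeasurableSpace O] [MeasurableSpace U] [MeasurableSpace Ω]
    -- reference measures, noise distribution, underlying probability space, parameter space
    (ξ : Measure S) [IsFiniteMeasure ξ] (η : Measure O) [IsFiniteMeasure η]
    (ν : Measure U) [IsProbabilityMeasure ν] (P : Measure Ω) [IsProbabilityMeasure P]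
    (Θ : Set (EuclideanSpace ℝ (Fin p))) (hΘ : IsOpen Θ)
    -- parametric model, proposal and reparameterisation function
    (m₀ : S → ℝ) (m : EuclideanSpace ℝ (Fin p) → S → S → ℝ)
    (g : EuclideanSpace ℝ (Fin p) → S → O → ℝ)
    (r : EuclideanSpace ℝ (Fin p) → S → O → S → ℝ)
    (h : EuclideanSpace ℝ (Fin p) → S → O → U → S)
    (hm₀ : OSIWAE.IsProbDensity ξ m₀)
    (hm : ∀ θ ∈ Θ, OSIWAE.IsTransitionDensity ξ (m θ))
    (hg : ∀ θ ∈ Θ, OSIWAE.IsTransitionDensity η (g θ))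
    (hr : ∀ θ ∈ Θ, OSIWAE.IsTransitionDensity ξ (fun (a : S × O) x' => r θ a.1 a.2 x'))
    (hh : ∀ θ ∈ Θ, Measurable fun a : S × O × U => h θ a.1 a.2.1 a.2.2)
    (hhr : ∀ θ ∈ Θ, ∀ x y, ν.map (h θ x y) = OSIWAE.densityMeasure ξ (r θ x y))
    -- data-generating state-space model, not necessarily in the parametric family
    (mstar : S → S → ℝ) (gstar : S → O → ℝ)
    (hmstar : OSIWAE.IsTransitionDensity ξ mstar) (hgstar : OSIWAE.IsTransitionDensity η gstar)
    (X : ℕ → Ω → S) (Y : ℕ → Ω → O)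
    (hXY : OSIWAE.IsStateSpaceModel P ξ η m₀ mstar gstar X Y)
    -- strong mixing
    (ε : ℝ) (hε0 : 0 < ε) (hε1 : ε < 1)
    (hmε : ∀ θ ∈ Θ, ∀ x x', ε ≤ m θ x x' ∧ m θ x x' ≤ ε⁻¹)
    (hgε : ∀ θ ∈ Θ, ∀ x y, ε ≤ g θ x y ∧ g θ x y ≤ ε⁻¹)
    (hrε : ∀ θ ∈ Θ, ∀ x y x', ε ≤ r θ x y x' ∧ r θ x y x' ≤ ε⁻¹)
    (hmstarε : ∀ x x', ε ≤ mstar x x' ∧ mstar x x' ≤ ε⁻¹)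
    -- differentiability in the parameter with bounded gradients
    (κ : ℝ)
    (hmd : ∀ θ ∈ Θ, ∀ x x', DifferentiableAt ℝ (fun θ' => m θ' x x') θ ∧
      ‖gradient (fun θ' => m θ' x x') θ‖ ≤ κ)
    (hgd : ∀ θ ∈ Θ, ∀ x y, DifferentiableAt ℝ (fun θ' => g θ' x y) θ ∧
      ‖gradient (fun θ' => g θ' x y) θ‖ ≤ κ)
    (hmhd : ∀ θ ∈ Θ, ∀ x y u, DifferentiableAt ℝ (fun θ' => m θ' x (h θ' x y u)) θ ∧
      ‖gradient (fun θ' => m θ' x (h θ' x y u)) θ‖ ≤ κ)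
    (hghd : ∀ θ ∈ Θ, ∀ x y u, DifferentiableAt ℝ (fun θ' => g θ' (h θ' x y u) y) θ ∧
      ‖gradient (fun θ' => g θ' (h θ' x y u) y) θ‖ ≤ κ)
    (hrhd : ∀ θ ∈ Θ, ∀ x y u, DifferentiableAt ℝ (fun θ' => r θ' x y (h θ' x y u)) θ ∧
      ‖gradient (fun θ' => r θ' x y (h θ' x y u)) θ‖ ≤ κ) :
    -- the contrast function `l` and, for every sample size `M`, the COLBO `lM`
    ∃ l : EuclideanSpace ℝ (Fin p) → ℝ, DifferentiableOn ℝ l Θ ∧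
      ∀ M : ℕ, 0 < M → ∃ lM : EuclideanSpace ℝ (Fin p) → ℝ, DifferentiableOn ℝ lM Θ ∧
        ∀ θ ∈ Θ,
          -- the filter and the tangent filter along the observations
          let φ : ℕ → Ω → S → ℝ := fun s ω =>
            OSIWAE.filterDensity ξ m₀ (m θ) (g θ) (fun k => Y k ω) s
          let τ : ℕ → Ω → S → EuclideanSpace ℝ (Fin p) := fun s ω =>
            OSIWAE.tangentDensity ξ m₀ m g θ (fun k => Y k ω) s
          let L : ℕ → Ω → ℝ := fun s ω =>
            OSIWAE.predLogLik ξ (m θ) (g θ) (Y (s + 1) ω) (φ s ω)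
          let DL : ℕ → Ω → EuclideanSpace ℝ (Fin p) := fun s ω =>
            OSIWAE.predLogLikGrad ξ m g θ (Y (s + 1) ω) (φ s ω) (τ s ω)
          let LM : ℕ → Ω → ℝ := fun s ω =>
            OSIWAE.iwaeObjective ξ (m θ) (g θ) (r θ) M (Y (s + 1) ω) (φ s ω)
          let DLM : ℕ → Ω → EuclideanSpace ℝ (Fin p) := fun s ω =>
            OSIWAE.iwaeGrad ξ ν m g r h M θ (Y (s + 1) ω) (φ s ω) (τ s ω)
          (∀ᵐ ω ∂P,
            Tendsto (OSIWAE.timeAverage fun s => L s ω) atTop (𝓝 (l θ)) ∧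
            Tendsto (OSIWAE.timeAverage fun s => DL s ω) atTop (𝓝 (gradient l θ)) ∧
            Tendsto (OSIWAE.timeAverage fun s => LM s ω) atTop (𝓝 (lM θ)) ∧
            Tendsto (OSIWAE.timeAverage fun s => DLM s ω) atTop (𝓝 (gradient lM θ))) ∧
          OSIWAE.MeanAverageTendsto P L (l θ) ∧
          OSIWAE.MeanAverageTendsto P DL (gradient l θ) ∧
          OSIWAE.MeanAverageTendsto P LM (lM θ) ∧
          OSIWAE.MeanAverageTendsto P DLM (gradient lM θ) := by
  have hpar : OSIWAE.ParamModel ξ Θ ε κ m₀ m g :=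
    { isOpen := hΘ
      bounds := fun θ hθ =>
        { initial := hm₀
          step := fun y =>
            { pos := hε0
              le_one := hε1.le
              trans := hm θ hθ
              trans_ge := fun x x' => (hmε θ hθ x x').1
              trans_le := fun x x' => (hmε θ hθ x x').2
              measurable := (hg θ hθ).measurable.comp (f := fun x => (x, y)) (by fun_prop)
              ge := fun x => (hgε θ hθ x y).1
              le := fun x => (hgε θ hθ x y).2 }
          measurable := (hg θ hθ).measurable }
      diff_trans := hmd
      diff_emission := hgd }
  have H : OSIWAE.ProposalModel ξ ν Θ ε κ m₀ m g r h :=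
    ⟨hpar, hr, hh, hhr, hrε, hmhd, hghd, hrhd⟩
  -- Chain and functionals must share one rate, so the chain is given the slower `forgetRate ε`;
  -- this is allowed because `1 - ρ = ε ^ 2 / 2 ≤ ε ^ 2`.
  have hW := hXY.isMixingSeq hm₀ hmstar hgstar hε0 hmstarε (ρ := OSIWAE.forgetRate ε)
    (by rw [OSIWAE.forgetRate]; nlinarith [sq_nonneg ε]) (OSIWAE.forgetRate_pos hε0 hε1.le)
    (OSIWAE.forgetRate_lt_one hε0)
  obtain ⟨l, hl, hL⟩ := hW.exists_contrast_comp hΘ measurable_snd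
    (fun θ hθ => hpar.isForgetting_predLogLik hθ hε0 hε1.le)
    (fun θ hθ => hpar.isForgetting_predLogLikGrad hθ hε0 hε1.le)
    (fun θ hθ k y => hpar.hasGradientAt_predLogLik hθ y k)
  refine ⟨l, hl, fun M hM => ?_⟩
  -- With at least one draw, written `n + 1`, the average weight is positive and one draw can be
  -- singled out in the gradient.
  obtain ⟨n, rfl⟩ := Nat.exists_eq_succ_of_ne_zero hM.ne'
  obtain ⟨lM, hlM, hLM⟩ := hW.exists_contrast_comp hΘ measurable_snd
    (fun θ hθ => H.isForgetting_iwaeObjective hθ hε0 hε1.le n)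
    (fun θ hθ => H.isForgetting_iwaeGrad hθ hε0 hε1.le n)
    (fun θ hθ k y => H.hasGradientAt_iwaeObjective hθ n y k)
  refine ⟨lM, hlM, fun θ hθ => ?_⟩
  obtain ⟨ha, hb, hc⟩ := hL θ hθ
  obtain ⟨ha', hb', hc'⟩ := hLM θ hθ
  have hφ := fun y t => OSIWAE.filterDensity_eq_filt (hpar.bounds θ hθ) y t
  have hτ := fun y t => hpar.tangentDensity_eq hθ y t
  simp only [hφ, hτ]
  refine ⟨?_, hb, hc, hb', hc'⟩
  filter_upwards [ha, ha'] with ω h1 h2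
  exact ⟨h1.1, h1.2, h2.1, h2.2⟩
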